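/- **Setting.** There are $K$ arms. Pulling arm $i$ for the $n$-th time yields the reward $X^{(i)}_n$; all rewards are mutually independent and $X^{(i)}_n$ has distribution function $F^{(i)}$. An admissible policy $\pi$ chooses the arm $\pi_t\in\{1,\dots,K\}$ of round $t$ as a measurable function of a random variable $V$ that is independent of the rewards and of the arms and rewards of the previous rounds; $\tau_i(t)$ is the number of pulls of arm $i$ in the first $t$ rounds. Let $L$ be a normed space which is a linear subspace of the space of bounded functions $\mathbb R\to\mathbb R$ (the norm $\|\cdot\|$ of $L$ is arbitrary) and which contains all $F^{(i)}$ and all empirical distribution functions $\hat F_t(x_1,\dots,x_t)=\frac1t\sum_{s\le t}1_{[x_s,\infty)}$. Let $\hat F^{(i)}_t$ be the empirical distribution function of $X^{(i)}_1,\dots,X^{(i)}_t$, and $\hat F^\pi_T$ that of the first $T$ rewards received under $\pi$. Write $F_p=\sum_i p_iF^{(i)}$ for $p$ in the probability simplex $\Delta_{K-1}$, $\mathcal D^\Delta=\{F_p: p\in\Delta_{K-1}\}$, and $\hat{\mathcal D}$ for the set of all empirical distribution functions of finite nonempty real sequences. The performance measure is a function $\hat R:L\to\mathbb R$ (with $\hat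 R(\hat F_t(x_1,\dots,x_t))$ and $\|\hat F_t(x_1,\dots,x_t)-F^{(i)}\|$ measurable in $x_1,\dots,x_t$). * $\hat R$ is *quasiconvex* if it is quasiconvex on the convex set of all distribution functions of real random variables that belong to $L$. * $\hat R$ is *strongly stable* with parameters $a>0$, $b>0$, $q\ge1$ if $|\hat R(F)-\hat R(G)|\le b(\|F-G\|+\|F-G\|^q)$ for all $F\in\mathcal D^\Delta$, $G\in\mathcal D^\Delta\cup\hat{\mathcal D}$, and $\mathbb P(\|\hat F^{(i)}_t-F^{(i)}\|\ge x)\le 2e^{-atx^2}$ for all $i$, $x>0$, $t\ge1$. * $\hat R$ is *smooth* with parameters $d_1,d_2\ge0$, $M_0>0$ if there is a map $A$ from $L$ to the bounded linear functionals on $L$ such that for all $F\in\mathcal D^\Delta$: $|A_F(G-F)|\le d_1\|G-F\|$ for all $G\in\mathcal D^\Delta\cup\hat{\mathcal D}$, and $|\hat R(G)-\hat R(F)-A_F(G-F)|\le\frac12d_2\|G-F\|^2$ for all $G\in\mathcal D^\Delta\cup\{G\in\hat{\mathcal D}:\|F-G\|\le M_0\}$. * The *gaps* are $\Delta_i=\max_{p\in\Delta_{K-1}}\hat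 R(F_p)-\hat R(F^{(i)})$, and $i^*\in\arg\min_i\Delta_i$. * The *$\hat R$-UCB* policy with exploration parameter $\alpha>2$ pulls each arm once in the first $K$ rounds, and in each round $t\ge K+1$ pulls an arm (ties broken arbitrarily) that maximizes $\hat R\big(\hat F^{(i)}_{\tau_i(t-1)}\big)+\varphi^{-1}\big(\tfrac{\alpha\log t}{\tau_i(t-1)}\big)$, where $\varphi^{-1}(y)=\max\{2b(y/a)^{1/2},\,2b(y/a)^{q/2}\}$. * The *regret* at horizon $T$ is $\mathrm{Reg}_T=\sup_{\pi}\mathbb E[\hat R(\hat F^{\pi}_T)]-\mathbb E[\hat R(\hat F^{\hat R\text{-UCB}}_T)]$, the supremum being over all admissible policies. **Corollary.** Let $\hat R$ be quasiconvex and strongly stable with parameters $a,b,q$, and let $\Delta_i>0$ for all $i\ne i^*$; say $\Delta_i\ge\delta>0$ for all $i\neq i^*$ and $\|F^{(i)}-F^{(j)}\|\le D$ for all $i,j$. Then for every $T\ge1$ all expectations in the definition of the regret exist, the supremum is finite, and $$\mathrm{Reg}_T=O\!\left(\sqrt{\frac{K^2\log(KT)}{T}}\right):$$ there is a constant $C$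 depending only on $a,b,q,\alpha,\delta,D$ such that $|\mathrm{Reg}_T|\le C\sqrt{K^2\log(KT)/T}$ for all $T\ge1$ with $K^2\log(KT)\le T$. If $\hat R$ is in addition smooth with parameters $d_1,d_2,M_0$, then $$\mathrm{Reg}_T=O\!\left(\frac{K^2\log(KT)}{T}\right):$$ there is a constant $C$ depending only on $a,b,q,\alpha,\delta,D,d_1,d_2,M_0$ such that $|\mathrm{Reg}_T|\le C\,K^2\log(KT)/T$ for all sufficiently large $T$ (how large may depend on the whole instance). -/

import Mathlib

open MeasureTheory ProbabilityTheory Filter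
open scoped BigOperators

namespace EDPM

/-- A normed space `L` that is (through the injective linear map `toFun`) a linear subspace of the
space of all bounded functions `ℝ → ℝ` and contains the distribution functions `1_{[x,∞)}` of all
point masses.  The norm of `L` is arbitrary; it need not be related to the supremum norm. -/
structure FunSpace (L : Type*) [NormedAddCommGroup L] [NormedSpace ℝ L] where
  toFun : L →ₗ[ℝ] (ℝ → ℝ)
  injective : Function.Injective toFun
  bounded : ∀ f : L, ∃ C : ℝ, ∀ y : ℝ, |toFun f y| ≤ C
  step : ℝ → L
  step_apply : ∀ x y : ℝ, toFun (step x) y = if x ≤ y then 1 else 0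

section Space

variable {L : Type*} [NormedAddCommGroup L] [NormedSpace ℝ L]

/-- The elements of `L` that are distribution functions of probability measures on `ℝ`. -/
def FunSpace.distSet (S : FunSpace L) : Set L :=
  {f | ∃ μ : Measure ℝ, IsProbabilityMeasure μ ∧ ∀ y, S.toFun f y = cdf μ y}

/-- The empirical distribution function of `x₁, …, x_t`. -/
noncomputable def FunSpace.emp (S : FunSpace L) {t : ℕ} (x : Fin t → ℝ) : L :=
  (t : ℝ)⁻¹ • ∑ s, S.step (x s)

/-- All empirical distributions of sequences of any length `t ≥ 1`. -/
def FunSpace.empSet (S : FunSpace L) : Set L :=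
  {f | ∃ t : ℕ, 1 ≤ t ∧ ∃ x : Fin t → ℝ, f = S.emp x}

/-- `K` reward distributions whose distribution functions `F i` lie in `L`. -/
structure Arms (S : FunSpace L) (K : ℕ) where
  law : Fin K → Measure ℝ
  isProb : ∀ i, IsProbabilityMeasure (law i)
  F : Fin K → L
  F_eq : ∀ i y, S.toFun (F i) y = cdf (law i) y

variable {S : FunSpace L} {K : ℕ}

/-- The mixture `F_p = ∑ i, p_i F_i`. -/
noncomputable def Arms.mix (B : Arms S K) (p : Fin K → ℝ) : L := ∑ i, p i • B.F i

/-- The set of all mixtures of the arm distributions. -/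
def Arms.mixSet (B : Arms S K) : Set L := B.mix '' stdSimplex ℝ (Fin K)

/-- The gap `Δ_i = max_p R(F_p) - R(F_i)`. -/
noncomputable def Arms.gap (B : Arms S K) (R : L → ℝ) (i : Fin K) : ℝ :=
  (⨆ p : stdSimplex ℝ (Fin K), R (B.mix p)) - R (B.F i)

/-- Measurability of the quantities whose expectations and probabilities are considered. -/
structure MeasurableEDPM (B : Arms S K) (R : L → ℝ) : Prop where
  measurable_value : ∀ t : ℕ, Measurable fun x : Fin t → ℝ => R (S.emp x)
  measurable_dist : ∀ (t : ℕ) (i : Fin K), Measurable fun x : Fin t → ℝ => ‖S.emp x - B.F i‖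

/-- Strong stability with parameters `a`, `b`, `q`. -/
structure StronglyStable (B : Arms S K) (R : L → ℝ) (a b q : ℝ) : Prop where
  a_pos : 0 < a
  b_pos : 0 < b
  one_le_q : 1 ≤ q
  modulus : ∀ F ∈ B.mixSet, ∀ G ∈ B.mixSet ∪ S.empSet,
    |R F - R G| ≤ b * (‖F - G‖ + ‖F - G‖ ^ q)
  concentration : ∀ (i : Fin K) (x : ℝ), 0 < x → ∀ t : ℕ, 1 ≤ t →
    (Measure.pi fun _ : Fin t => B.law i).real {y | x ≤ ‖S.emp y - B.F i‖}
      ≤ 2 * Real.exp (-(a * t * x ^ 2))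

/-- Smoothness with parameters `d₁`, `d₂`, `M₀`. -/
def Smooth (B : Arms S K) (R : L → ℝ) (d₁ d₂ M₀ : ℝ) : Prop :=
  0 ≤ d₁ ∧ 0 ≤ d₂ ∧ 0 < M₀ ∧ ∃ A : L → (L →L[ℝ] ℝ), ∀ F ∈ B.mixSet,
    (∀ G ∈ B.mixSet ∪ S.empSet, |A F (G - F)| ≤ d₁ * ‖G - F‖) ∧
    (∀ G ∈ B.mixSet ∪ {G ∈ S.empSet | ‖F - G‖ ≤ M₀},
      |R G - R F - A F (G - F)| ≤ 1 / 2 * d₂ * ‖G - F‖ ^ 2)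

end Space

/-- An admissible policy: the action of round `t + 1` is a measurable function of the
randomization variable and of the `t` past pairs (action, reward). -/
structure Policy (K : ℕ) (𝕍 : Type*) [MeasurableSpace 𝕍] where
  act : (t : ℕ) → 𝕍 × (Fin t → Fin K × ℝ) → Fin K
  measurable_act : ∀ t, Measurable (act t)

section Run

variable {K : ℕ} {𝕍 : Type*} [MeasurableSpace 𝕍]

/-- The first `t` pairs (action, reward) when the randomization variable has value `v` and the
`(n+1)`-st pull of arm `i` yields `x i n`. -/
def Policy.hist (π : Policy K 𝕍) (v : 𝕍) (x : Fin K → ℕ → ℝ) : (t : ℕ) → Fin t → Fin K × ℝ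
  | 0 => Fin.elim0
  | t + 1 =>
    let h := Policy.hist π v x t
    let i := π.act t (v, h)
    Fin.snoc (α := fun _ => Fin K × ℝ) h
      (i, x i (Finset.univ.filter fun s : Fin t => (h s).1 = i).card)

/-- The action of round `t + 1`. -/
def Policy.action (π : Policy K 𝕍) (v : 𝕍) (x : Fin K → ℕ → ℝ) (t : ℕ) : Fin K :=
  π.act t (v, π.hist v x t)

/-- The number of pulls of arm `i` in the first `t` rounds. -/
def Policy.pulls (π : Policy K 𝕍) (v : 𝕍) (x : Fin K → ℕ → ℝ) (t : ℕ) (i : Fin K) : ℕ :=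
  (Finset.univ.filter fun s : Fin t => (π.hist v x t s).1 = i).card

variable {L : Type*} [NormedAddCommGroup L] [NormedSpace ℝ L]

/-- The value of `R` at the empirical distribution of the first `T` rewards of the policy. -/
noncomputable def Policy.value (S : FunSpace L) (R : L → ℝ) (π : Policy K 𝕍)
    (v : 𝕍) (x : Fin K → ℕ → ℝ) (T : ℕ) : ℝ :=
  R (S.emp fun s : Fin T => (π.hist v x T s).2)

/-- The function `φ⁻¹` of the exploration bonus. -/
noncomputable def phiInv (a b q y : ℝ) : ℝ :=
  max (2 * b * (y / a) ^ (1 / 2 : ℝ)) (2 * b * (y / a) ^ (q / 2))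

/-- The index of arm `i` that is used for the choice of the action of round `t + 1`. -/
noncomputable def ucbIndex (S : FunSpace L) (R : L → ℝ) (a b q α : ℝ) (π : Policy K 𝕍)
    (v : 𝕍) (x : Fin K → ℕ → ℝ) (t : ℕ) (i : Fin K) : ℝ :=
  R (S.emp fun s : Fin (π.pulls v x t i) => x i s) +
    phiInv a b q (α * Real.log ((t + 1 : ℕ) : ℝ) / (π.pulls v x t i : ℝ))

/-- `π` is an `R`-UCB policy: every arm is pulled once in the first `K` rounds, afterwards an arm
with maximal index is pulled (ties are broken arbitrarily). -/
def IsUCB (S : FunSpace L) (R : L → ℝ) (a b q α : ℝ) (π : Policy K 𝕍) : Prop :=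
  ∀ (v : 𝕍) (x : Fin K → ℕ → ℝ),
    (∀ i, π.pulls v x K i = 1) ∧
    ∀ t, K ≤ t → ∀ j,
      ucbIndex S R a b q α π v x t j ≤ ucbIndex S R a b q α π v x t (π.action v x t)

variable {Ω : Type*} [MeasurableSpace Ω]

/-- `X i n` is the reward of the `(n+1)`-st pull of arm `i`; all rewards are mutually independent,
those of arm `i` have law `B.law i`, and `V` is independent of the rewards. -/
structure IsModel {S : FunSpace L} (B : Arms S K) (μ : Measure Ω) (V : Ω → 𝕍)
    (X : Fin K → ℕ → Ω → ℝ) : Prop where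
  isProb : IsProbabilityMeasure μ
  measurable_V : Measurable V
  measurable_X : ∀ i n, Measurable (X i n)
  law_X : ∀ i n, μ.map (X i n) = B.law i
  indep_X : iIndepFun (fun (c : Fin K × ℕ) (ω : Ω) => X c.1 c.2 ω) μ
  indep_V : IndepFun V (fun (ω : Ω) (c : Fin K × ℕ) => X c.1 c.2 ω) μ

/-- The random value of the performance measure at horizon `T`. -/
noncomputable def perf (S : FunSpace L) (R : L → ℝ) (V : Ω → 𝕍) (X : Fin K → ℕ → Ω → ℝ)
    (π : Policy K 𝕍) (T : ℕ) (ω : Ω) : ℝ :=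
  π.value S R (V ω) (fun i n => X i n ω) T

/-- The expected regret at horizon `T`: the optimal expected performance over all admissible
policies minus the expected performance of `π`. -/
noncomputable def regret (S : FunSpace L) (R : L → ℝ) (μ : Measure Ω) (V : Ω → 𝕍)
    (X : Fin K → ℕ → Ω → ℝ) (π : Policy K 𝕍) (T : ℕ) : ℝ :=
  (⨆ π' : Policy K 𝕍, ∫ ω, perf S R V X π' T ω ∂μ) - ∫ ω, perf S R V X π T ω ∂μ

/-- The standing assumptions: `R` is quasiconvex on the distribution functions in `L` and strongly
stable with parameters `a`, `b`, `q`; all arms but one optimal arm have gaps at least `δ`; the arm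
distributions have mutual distances at most `D`; `π` is an `R`-UCB policy with exploration
parameter `α`, run in the bandit model `(μ, V, X)`. -/
structure Setting {S : FunSpace L} (B : Arms S K) (R : L → ℝ) (μ : Measure Ω) (V : Ω → 𝕍)
    (X : Fin K → ℕ → Ω → ℝ) (π : Policy K 𝕍) (a b q α δ D : ℝ) : Prop where
  model : IsModel B μ V X
  measurable : MeasurableEDPM B R
  stable : StronglyStable B R a b q
  quasiconvex : QuasiconvexOn ℝ S.distSet R
  gaps : ∃ iStar : Fin K, (∀ j, B.gap R iStar ≤ B.gap R j) ∧ ∀ i, i ≠ iStar → δ ≤ B.gap R i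
  dist_le : ∀ i j, ‖B.F i - B.F j‖ ≤ D
  ucb : IsUCB S R a b q α π

end Run

end EDPM

/-! Let `k` be the optimal arm and `ε = K ^ 2 * log (K * T) / T`. The rewards received under any
policy form a pool containing, for every arm, an initial segment of its rewards. If `z` bounds the
normalized deviations for all arms and all sample sizes up to `T` at once, the empirical
distribution function of the pool is within `h = K * z` of the mixture with the pull frequencies
(`IsSample.norm_pool_sub_mix`). Exponential moments summed over the `K * T` pairs (arm, size) give
that the `r`-th moment of `h` is of order `ε ^ (r / 2)` (`IsModel.exists_deviation`).

By quasiconvexity no mixture beats the best arm, so every policy has value at most `R (B.F k) + b *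
(h + h ^ q)`. Conversely, the usual UCB argument bounds the expected frequency of suboptimal arms by
a multiple of `ε` (`IsModel.integral_freq_le`), and stability turns this into a lower bound.
Together they give the rate `√ε`.

Under smoothness `R` is expanded to second order at `B.F k`. The fluctuation of the pool around the
mixture enters linearly and has mean zero under every policy, by a Wald identity
(`IsModel.integral_received`, `IsModel.integral_fluct`); the quadratic remainder has mean of order
`ε`. The lower bound for UCB follows directly. The upper bound for an arbitrary policy distinguishes
two cases for the linear functional `A` at `B.F k`. If `A (B.F i - B.F k) < 0` for all `i ≠ k`, then
near the vertex `k` the negative drift absorbs the quadratic term in the frequency of the other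
arms, and away from it the mixture is worse by a fixed amount (`SmoothAt.pool_le_of_separated`). The
instance-dependent constant multiplies only moments of order at least four, which are `O(ε ^ 2)` and
vanish into `ε` for large `T`. If some `A (B.F i - B.F k) ≥ 0`, then quasiconvexity and the gap of
arm `i` force `A (G - B.F k) ≤ 0` for every empirical `G` (`SmoothAt.map_emp_nonpos`). The linear
term can then be dropped, and splitting the pool into the rewards of arm `k` and the rest gives a
purely quadratic bound with uniform constants (`SmoothAt.pool_le_of_not_separated`). -/

namespace EDPM

/-! ### Empirical distribution functions and quasiconvexity -/

section Empirical

variable {L : Type*} [NormedAddCommGroup L] [NormedSpace ℝ L]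

/-- The sum of the step functions at the first `n` terms of a sequence. -/
def FunSpace.esum (S : FunSpace L) (x : ℕ → ℝ) (n : ℕ) : L := ∑ s ∈ Finset.range n, S.step (x s)

lemma FunSpace.emp_eq_esum (S : FunSpace L) (x : ℕ → ℝ) (n : ℕ) :
    S.emp (fun s : Fin n => x s) = (n : ℝ)⁻¹ • S.esum x n := by
  simp [FunSpace.emp, FunSpace.esum, Finset.sum_range]

/-- `f` is a sum of `n` step functions. -/
def FunSpace.IsSum (S : FunSpace L) (n : ℕ) (f : L) : Prop :=
  ∃ x : Fin n → ℝ, f = ∑ s, S.step (x s)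

variable {S : FunSpace L}

lemma FunSpace.IsSum.zero : S.IsSum 0 0 := ⟨Fin.elim0, by simp⟩

lemma FunSpace.IsSum.add {m n : ℕ} {f g : L} (hf : S.IsSum m f) (hg : S.IsSum n g) :
    S.IsSum (m + n) (f + g) := by
  obtain ⟨x, rfl⟩ := hf
  obtain ⟨y, rfl⟩ := hg
  exact ⟨Fin.append x y, by simp [Fin.sum_univ_add]⟩

lemma FunSpace.IsSum.nsmul {n : ℕ} {f : L} (hf : S.IsSum n f) (k : ℕ) :
    S.IsSum (k * n) ((k : ℝ) • f) := by
  induction k with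
  | zero => simpa using FunSpace.IsSum.zero
  | succ k ih =>
    have := ih.add hf
    rw [Nat.succ_mul]
    simpa [add_smul] using this

lemma FunSpace.IsSum.sum {ι : Type*} (s : Finset ι) {n : ι → ℕ} {f : ι → L}
    (h : ∀ i ∈ s, S.IsSum (n i) (f i)) : S.IsSum (∑ i ∈ s, n i) (∑ i ∈ s, f i) := by
  classical
  induction s using Finset.induction_on with
  | empty => simpa using FunSpace.IsSum.zero
  | insert i s hi ih =>
    rw [Finset.sum_insert hi, Finset.sum_insert hi]
    exact (h i (Finset.mem_insert_self _ _)).add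
      (ih fun j hj => h j (Finset.mem_insert_of_mem hj))

lemma FunSpace.isSum_esum (x : ℕ → ℝ) (n : ℕ) : S.IsSum n (S.esum x n) :=
  ⟨fun s => x s, by simp [FunSpace.esum, Finset.sum_range]⟩

lemma FunSpace.IsSum.mem_empSet {n : ℕ} {f : L} (hf : S.IsSum n f) (hn : 1 ≤ n) :
    (n : ℝ)⁻¹ • f ∈ S.empSet := by
  obtain ⟨x, rfl⟩ := hf
  exact ⟨n, hn, x, rfl⟩

lemma FunSpace.step_mem_empSet (x : ℝ) : S.step x ∈ S.empSet :=
  ⟨1, le_rfl, fun _ => x, by simp [FunSpace.emp]⟩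

/-- Empirical distribution functions are closed under mixing with rational weights. -/
lemma FunSpace.mix_mem_empSet {f g : L} (hf : f ∈ S.empSet) (hg : g ∈ S.empSet) (k : ℕ) :
    ((k : ℝ) / (k + 1)) • f + ((1 : ℝ) / (k + 1)) • g ∈ S.empSet := by
  obtain ⟨m, hm, x, rfl⟩ := hf
  obtain ⟨n, hn, y, rfl⟩ := hg
  have hx : S.IsSum m (∑ s, S.step (x s)) := ⟨x, rfl⟩
  have hy : S.IsSum n (∑ s, S.step (y s)) := ⟨y, rfl⟩
  -- Repeating the first sample `k * n` times and the second `m` times produces sizes in the ratio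
  -- `k : 1`.
  have := ((hx.nsmul (k * n)).add (hy.nsmul m)).mem_empSet (by nlinarith [Nat.zero_le (k * n * m)])
  convert this using 1
  have hm' : (m : ℝ) ≠ 0 := by positivity
  have hn' : (n : ℝ) ≠ 0 := by positivity
  have hk : (k : ℝ) + 1 ≠ 0 := by positivity
  rw [FunSpace.emp, FunSpace.emp, smul_add, smul_smul, smul_smul, smul_smul, smul_smul]
  have hc : (k : ℝ) * n * m + m * n ≠ 0 := by
    have : (k : ℝ) * n * m + m * n = (k + 1) * (m * n) := by ring
    rw [this]; positivity
  congr 2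
  · push_cast; field_simp
  · push_cast; field_simp

lemma FunSpace.step_mem_distSet (x : ℝ) : S.step x ∈ S.distSet := by
  refine ⟨Measure.dirac x, inferInstance, fun y => ?_⟩
  rw [S.step_apply, cdf_eq_real, measureReal_def, Measure.dirac_apply' _ measurableSet_Iic]
  by_cases h : x ≤ y <;> simp [h]

/-- An empirical distribution function averages point masses. The convexity assumed here is part of
the quasiconvexity of `R`, which thereby becomes applicable to samples. -/
lemma FunSpace.empSet_subset_distSet (hS : Convex ℝ S.distSet) : S.empSet ⊆ S.distSet := by
  rintro _ ⟨t, ht, x, rfl⟩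
  rw [FunSpace.emp, Finset.smul_sum]
  refine hS.sum_mem (fun _ _ => by positivity) ?_ fun s _ => S.step_mem_distSet (x s)
  have : (t : ℝ) ≠ 0 := by positivity
  simp [this]

lemma _root_.QuasiconvexOn.le_max' {E : Type*} [AddCommMonoid E] [SMul ℝ E] {s : Set E} {f : E → ℝ}
    (hf : QuasiconvexOn ℝ s f) {x y : E} (hx : x ∈ s) (hy : y ∈ s) {u v : ℝ} (hu : 0 ≤ u)
    (hv : 0 ≤ v) (huv : u + v = 1) : f (u • x + v • y) ≤ max (f x) (f y) :=
  (hf (max (f x) (f y)) ⟨hx, le_max_left _ _⟩ ⟨hy, le_max_right _ _⟩ hu hv huv).2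

end Empirical

/-! ### Mixtures of the arms -/

section Mix

variable {L : Type*} [NormedAddCommGroup L] [NormedSpace ℝ L] {S : FunSpace L} {K : ℕ}
  {B : Arms S K}

lemma Arms.F_mem_distSet (B : Arms S K) (i : Fin K) : B.F i ∈ S.distSet :=
  ⟨B.law i, B.isProb i, B.F_eq i⟩

lemma Arms.F_mem_mixSet (B : Arms S K) (i : Fin K) : B.F i ∈ B.mixSet :=
  ⟨Pi.single i 1, single_mem_stdSimplex ℝ i, by simp [Arms.mix, Pi.single_apply]⟩

lemma Arms.mix_mem_mixSet (B : Arms S K) {p : Fin K → ℝ} (hp : p ∈ stdSimplex ℝ (Fin K)) :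
    B.mix p ∈ B.mixSet := ⟨p, hp, rfl⟩

lemma Arms.convex_mixSet (B : Arms S K) : Convex ℝ B.mixSet := by
  rintro _ ⟨p, hp, rfl⟩ _ ⟨r, hr, rfl⟩ u v hu hv huv
  refine ⟨u • p + v • r, convex_stdSimplex ℝ _ hp hr hu hv huv, ?_⟩
  simp [Arms.mix, add_smul, Finset.sum_add_distrib, Finset.smul_sum, smul_smul]

/-- Only arms in the support of `p` are tested, so that the conclusion can be used on the face of
the simplex opposite to the optimal arm. -/
lemma Arms.mix_mem_of_convex {s : Set L} (hs : Convex ℝ s) {p : Fin K → ℝ}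
    (hp : p ∈ stdSimplex ℝ (Fin K)) (h : ∀ i, p i ≠ 0 → B.F i ∈ s) : B.mix p ∈ s := by
  classical
  have : B.mix p = ∑ i ∈ Finset.univ.filter (fun i => p i ≠ 0), p i • B.F i := by
    rw [Arms.mix, Finset.sum_filter]
    exact Finset.sum_congr rfl fun i _ => by by_cases hi : p i = 0 <;> simp [hi]
  rw [this]
  refine hs.sum_mem (fun i _ => hp.1 i) ?_ fun i hi => h i (Finset.mem_filter.1 hi).2
  rw [← hp.2, Finset.sum_filter]
  exact Finset.sum_congr rfl fun i _ => by by_cases hi : p i = 0 <;> simp [hi]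

lemma Arms.mixSet_subset_distSet (hS : Convex ℝ S.distSet) : B.mixSet ⊆ S.distSet := by
  rintro _ ⟨p, hp, rfl⟩
  exact Arms.mix_mem_of_convex hS hp fun i _ => B.F_mem_distSet i

lemma QuasiconvexOn.mix_le {R : L → ℝ} (hR : QuasiconvexOn ℝ S.distSet R) {r : ℝ}
    {p : Fin K → ℝ} (hp : p ∈ stdSimplex ℝ (Fin K)) (h : ∀ i, p i ≠ 0 → R (B.F i) ≤ r) :
    R (B.mix p) ≤ r :=
  (Arms.mix_mem_of_convex (hR r) hp fun i hi => ⟨B.F_mem_distSet i, h i hi⟩).2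

/-- The arm with the smallest gap has the largest value, and gaps are differences of values. -/
lemma gap_eq {R : L → ℝ} (hR : QuasiconvexOn ℝ S.distSet R) {k : Fin K}
    (hk : ∀ j, B.gap R k ≤ B.gap R j) (i : Fin K) : B.gap R i = R (B.F k) - R (B.F i) := by
  have hmax : ∀ j, R (B.F j) ≤ R (B.F k) := fun j => by
    have := hk j
    simp only [Arms.gap] at this
    linarith
  have hle : ∀ p : stdSimplex ℝ (Fin K), R (B.mix p) ≤ R (B.F k) := fun p =>
    QuasiconvexOn.mix_le hR p.2 fun i _ => hmax i
  have hsup : (⨆ p : stdSimplex ℝ (Fin K), R (B.mix p)) = R (B.F k) := by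
    apply le_antisymm
    · have : Nonempty (stdSimplex ℝ (Fin K)) := ⟨⟨_, single_mem_stdSimplex ℝ k⟩⟩
      exact ciSup_le hle
    · refine le_ciSup_of_le ⟨_, Set.forall_mem_range.2 hle⟩ ⟨_, single_mem_stdSimplex ℝ k⟩ ?_
      simp [Arms.mix, Pi.single_apply]
  rw [Arms.gap, hsup]

/-- By concentration, every arm distribution is close to empirical distributions of every size. -/
lemma StronglyStable.exists_emp_near {R : L → ℝ} {a b q : ℝ} (h : StronglyStable B R a b q)
    (i : Fin K) {n : ℕ} (hn : 1 ≤ n) :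
    ∃ y : Fin n → ℝ, ‖S.emp y - B.F i‖ ≤ (Real.sqrt (a * n))⁻¹ := by
  by_contra! hc
  have ha := h.a_pos
  have hn' : (0 : ℝ) < n := by positivity
  have := h.concentration i (Real.sqrt (a * n))⁻¹ (by positivity) n hn
  have hu : {y : Fin n → ℝ | (Real.sqrt (a * n))⁻¹ ≤ ‖S.emp y - B.F i‖} = Set.univ :=
    Set.eq_univ_of_forall fun y => (hc y).le
  have hP := B.isProb i
  -- At this radius the tail bound equals `2 / e < 1`, so the deviation cannot exceed it surely.
  rw [hu, probReal_univ, inv_pow, Real.sq_sqrt (by positivity),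
    mul_inv_cancel₀ (by positivity)] at this
  have h1 := Real.exp_one_gt_d9
  have h2 : Real.exp (-1) * Real.exp 1 = 1 := by rw [← Real.exp_add]; simp
  nlinarith [Real.exp_pos (-1)]

end Mix

/-! ### Elementary inequalities for powers -/

lemma add_rpow_le_two_rpow {x y r : ℝ} (hx : 0 ≤ x) (hy : 0 ≤ y) (hr : 0 ≤ r) :
    (x + y) ^ r ≤ 2 ^ r * (x ^ r + y ^ r) := by
  have hm : 0 ≤ max x y := le_max_of_le_left hx
  calc (x + y) ^ r ≤ (2 * max x y) ^ r := by
        apply Real.rpow_le_rpow (by positivity) _ hr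
        linarith [le_max_left x y, le_max_right x y]
    _ = 2 ^ r * (max x y) ^ r := Real.mul_rpow (by norm_num) hm
    _ ≤ 2 ^ r * (x ^ r + y ^ r) := by
        gcongr
        rcases max_choice x y with h | h <;> rw [h]
        · linarith [Real.rpow_nonneg hy r]
        · linarith [Real.rpow_nonneg hx r]

lemma rpow_le_self_of_le_one' {x r : ℝ} (hx : 0 ≤ x) (hx1 : x ≤ 1) (hr : 1 ≤ r) : x ^ r ≤ x := by
  simpa using Real.rpow_le_rpow_of_exponent_ge' hx hx1 zero_le_one hr

/-! ### Pooled samples, pull frequencies and first-order bounds -/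

section Landscape

variable {L : Type*} [NormedAddCommGroup L] [NormedSpace ℝ L] {S : FunSpace L} {K : ℕ}

/-- A quasiconvex, strongly stable performance measure for which arm `k` is optimal and the other
arms are worse by at least `δ`. -/
structure Landscape (B : Arms S K) (R : L → ℝ) (a b q δ D : ℝ) (k : Fin K) : Prop where
  stable : StronglyStable B R a b q
  quasiconvex : QuasiconvexOn ℝ S.distSet R
  pos : 0 < δ
  gap : ∀ i, i ≠ k → R (B.F i) ≤ R (B.F k) - δ
  dist_le : ∀ i j, ‖B.F i - B.F j‖ ≤ D

/-- The smoothness conditions at the distribution function of arm `k`. -/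
structure SmoothAt (B : Arms S K) (R : L → ℝ) (d₁ d₂ M₀ : ℝ) (k : Fin K) (A : L →L[ℝ] ℝ) :
    Prop where
  d₁_nonneg : 0 ≤ d₁
  d₂_nonneg : 0 ≤ d₂
  M₀_pos : 0 < M₀
  lip : ∀ G ∈ B.mixSet ∪ S.empSet, |A (G - B.F k)| ≤ d₁ * ‖G - B.F k‖
  quad : ∀ G ∈ B.mixSet ∪ {G ∈ S.empSet | ‖B.F k - G‖ ≤ M₀},
    |R G - R (B.F k) - A (G - B.F k)| ≤ 1 / 2 * d₂ * ‖G - B.F k‖ ^ 2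

lemma Smooth.smoothAt {B : Arms S K} {R : L → ℝ} {d₁ d₂ M₀ : ℝ} (h : Smooth B R d₁ d₂ M₀)
    (k : Fin K) : ∃ A, SmoothAt B R d₁ d₂ M₀ k A := by
  obtain ⟨h1, h2, h3, A, hA⟩ := h
  obtain ⟨h4, h5⟩ := hA _ (B.F_mem_mixSet k)
  exact ⟨A (B.F k), h1, h2, h3, h4, h5⟩

/-- The empirical distribution function of a sample that contains the first `τ i` rewards of every
arm `i`, `T` rewards in total. -/
noncomputable def FunSpace.pool (S : FunSpace L) (x : Fin K → ℕ → ℝ) (τ : Fin K → ℕ) (T : ℕ) : L :=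
  (T : ℝ)⁻¹ • ∑ i, S.esum (x i) (τ i)

/-- The frequencies of the arms. -/
noncomputable def freq (τ : Fin K → ℕ) (T : ℕ) (i : Fin K) : ℝ := τ i / T

/-- `τ` are counts with sum `T ≥ 1`, and the sums of the step functions at the rewards deviate from
their means by at most `T * z`. -/
structure IsSample (B : Arms S K) (x : Fin K → ℕ → ℝ) (τ : Fin K → ℕ) (T : ℕ) (z : ℝ) : Prop where
  one_le : 1 ≤ T
  sum_eq : ∑ i, τ i = T
  dev : ∀ i, ‖S.esum (x i) (τ i) - (τ i : ℝ) • B.F i‖ ≤ T * z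

variable {B : Arms S K} {R : L → ℝ} {a b q δ D : ℝ} {k : Fin K}
  {x : Fin K → ℕ → ℝ} {τ : Fin K → ℕ} {T : ℕ} {z : ℝ}

namespace IsSample

lemma pos (h : IsSample B x τ T z) : (0 : ℝ) < T := by exact_mod_cast h.one_le

lemma freq_mem (h : IsSample B x τ T z) : freq τ T ∈ stdSimplex ℝ (Fin K) := by
  have := h.pos
  refine ⟨fun i => by unfold freq; positivity, ?_⟩
  simp only [freq]
  rw [← Finset.sum_div, ← Nat.cast_sum, h.sum_eq]
  field_simp

lemma pool_mem (h : IsSample B x τ T z) : S.pool x τ T ∈ S.empSet := by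
  have := FunSpace.IsSum.sum (S := S) Finset.univ (n := τ) (f := fun i => S.esum (x i) (τ i))
    fun i _ => FunSpace.isSum_esum _ _
  rw [h.sum_eq] at this
  exact this.mem_empSet h.one_le

/-- Each arm contributes at most `z`; the triangle inequality over the arms costs the factor `K`
that reappears as `K ^ 2` in the rate. -/
lemma norm_pool_sub_mix (h : IsSample B x τ T z) :
    ‖S.pool x τ T - B.mix (freq τ T)‖ ≤ K * z := by
  have hT := h.pos
  have : S.pool x τ T - B.mix (freq τ T)
      = (T : ℝ)⁻¹ • ∑ i, (S.esum (x i) (τ i) - (τ i : ℝ) • B.F i) := by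
    rw [FunSpace.pool, Arms.mix, Finset.sum_sub_distrib, smul_sub, Finset.smul_sum, Finset.smul_sum]
    congr 1
    refine Finset.sum_congr rfl fun i _ => ?_
    rw [smul_smul, freq, div_eq_inv_mul]
  rw [this, norm_smul, norm_inv, Real.norm_natCast]
  have h2 : ‖∑ i, (S.esum (x i) (τ i) - (τ i : ℝ) • B.F i)‖ ≤ ∑ _i : Fin K, (T : ℝ) * z :=
    norm_sum_le_of_le _ fun i _ => h.dev i
  rw [Finset.sum_const, Finset.card_univ, Fintype.card_fin, nsmul_eq_mul] at h2
  rw [inv_mul_le_iff₀ hT]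
  linarith

lemma z_nonneg (h : IsSample B x τ T z) (k : Fin K) : 0 ≤ z :=
  nonneg_of_mul_nonneg_right ((norm_nonneg _).trans (h.dev k)) h.pos

lemma z_le (h : IsSample B x τ T z) (k : Fin K) : z ≤ K * z := by
  have : (1 : ℝ) ≤ K := by exact_mod_cast k.pos
  nlinarith [h.z_nonneg k]

lemma h_nonneg (h : IsSample B x τ T z) (k : Fin K) : 0 ≤ K * z :=
  (h.z_nonneg k).trans (h.z_le k)

end IsSample

lemma stdSimplex_le_one {p : Fin K → ℝ} (hp : p ∈ stdSimplex ℝ (Fin K)) (k : Fin K) : p k ≤ 1 := by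
  rw [← hp.2]
  exact Finset.single_le_sum (fun i _ => hp.1 i) (Finset.mem_univ k)

/-- The conditional distribution on the arms other than `k`. -/
noncomputable def others (p : Fin K → ℝ) (k : Fin K) (i : Fin K) : ℝ :=
  if i = k then 0 else (1 - p k)⁻¹ * p i

lemma sum_erase_eq {p : Fin K → ℝ} (hp : p ∈ stdSimplex ℝ (Fin K)) (k : Fin K) :
    ∑ i ∈ Finset.univ.erase k, p i = 1 - p k := by
  rw [← hp.2, ← Finset.add_sum_erase _ _ (Finset.mem_univ k)]; ring

lemma others_mem {p : Fin K → ℝ} (hp : p ∈ stdSimplex ℝ (Fin K)) (h : p k < 1) :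
    others p k ∈ stdSimplex ℝ (Fin K) := by
  have h1 : 0 < 1 - p k := by linarith
  refine ⟨fun i => ?_, ?_⟩
  · unfold others
    split_ifs
    · exact le_rfl
    · have := hp.1 i; positivity
  · rw [← Finset.add_sum_erase _ _ (Finset.mem_univ k)]
    have : ∑ i ∈ Finset.univ.erase k, others p k i
        = ∑ i ∈ Finset.univ.erase k, (1 - p k)⁻¹ * p i :=
      Finset.sum_congr rfl fun i hi => by simp [others, Finset.ne_of_mem_erase hi]
    rw [this, ← Finset.mul_sum, sum_erase_eq hp]
    simp [others, h1.ne']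

lemma Arms.mix_eq_others (B : Arms S K) {p : Fin K → ℝ} (h : p k < 1) :
    B.mix p = p k • B.F k + (1 - p k) • B.mix (others p k) := by
  have h1 : 1 - p k ≠ 0 := by linarith
  rw [Arms.mix, Arms.mix, ← Finset.add_sum_erase _ _ (Finset.mem_univ k),
    ← Finset.add_sum_erase _ (fun i => others p k i • B.F i) (Finset.mem_univ k)]
  have h0 : others p k k = 0 := by simp [others]
  rw [h0, zero_smul, zero_add, Finset.smul_sum]
  congr 1
  refine Finset.sum_congr rfl fun i hi => ?_
  rw [others, if_neg (Finset.ne_of_mem_erase hi), smul_smul, mul_inv_cancel_left₀ h1]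

/-- Writing `B.F k` as `∑ i, p i • B.F k` cancels the contribution of arm `k`, so only the weight of
the other arms is charged. -/
lemma Arms.norm_mix_sub_le {D : ℝ} (hD : ∀ i j, ‖B.F i - B.F j‖ ≤ D) {p : Fin K → ℝ}
    (hp : p ∈ stdSimplex ℝ (Fin K)) (k : Fin K) : ‖B.mix p - B.F k‖ ≤ D * (1 - p k) := by
  have h1 : B.mix p - B.F k = ∑ i ∈ Finset.univ.erase k, p i • (B.F i - B.F k) := by
    have : B.F k = ∑ i, p i • B.F k := by rw [← Finset.sum_smul, hp.2, one_smul]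
    rw [Arms.mix]
    nth_rewrite 1 [this]
    rw [← Finset.sum_sub_distrib, ← Finset.add_sum_erase _ _ (Finset.mem_univ k)]
    simp [smul_sub]
  rw [h1]
  have := norm_sum_le_of_le (Finset.univ.erase k) (f := fun i => p i • (B.F i - B.F k))
    (n := fun i => p i * D) fun i _ => by
      rw [norm_smul, Real.norm_of_nonneg (hp.1 i)]
      exact mul_le_mul_of_nonneg_left (hD i k) (hp.1 i)
  rw [← Finset.sum_mul, sum_erase_eq hp] at this
  linarith

namespace Landscape

variable (H : Landscape B R a b q δ D k)
include H

lemma D_nonneg : 0 ≤ D := (norm_nonneg _).trans (H.dist_le k k)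

lemma q_pos : 0 < q := zero_lt_one.trans_le H.stable.one_le_q

lemma mix_le {p : Fin K → ℝ} (hp : p ∈ stdSimplex ℝ (Fin K)) : R (B.mix p) ≤ R (B.F k) :=
  QuasiconvexOn.mix_le H.quasiconvex hp fun i _ => by
    by_cases hi : i = k
    · rw [hi]
    · linarith [H.gap i hi, H.pos]

/-- Quasiconvexity makes the gap uniform over the face without arm `k`, independently of the number
of arms. -/
lemma mix_others_le {p : Fin K → ℝ} (hp : p ∈ stdSimplex ℝ (Fin K)) (h : p k < 1) :
    R (B.mix (others p k)) ≤ R (B.F k) - δ :=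
  QuasiconvexOn.mix_le H.quasiconvex (others_mem hp h) fun i hi =>
    H.gap i fun hik => hi (by simp [others, hik])

lemma abs_sub_le {F G : L} (hF : F ∈ B.mixSet) (hG : G ∈ B.mixSet ∪ S.empSet) {n : ℝ}
    (hn : ‖G - F‖ ≤ n) : |R G - R F| ≤ b * (n + n ^ q) := by
  have h1 := H.stable.modulus F hF G hG
  rw [abs_sub_comm, norm_sub_rev] at h1
  have hb := H.stable.b_pos
  have := Real.rpow_le_rpow (norm_nonneg _) hn H.q_pos.le
  exact h1.trans (by gcongr)

/-- Within a small distance the value changes by at most `δ / 2`. -/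
lemma modulus_small {n : ℝ} (hn0 : 0 ≤ n) (hn : n ≤ min 1 (δ / (4 * b))) :
    b * (n + n ^ q) ≤ δ / 2 := by
  have hb := H.stable.b_pos
  have h1 := rpow_le_self_of_le_one' hn0 (hn.trans (min_le_left _ _)) H.stable.one_le_q
  have h2 : n ≤ δ / (4 * b) := hn.trans (min_le_right _ _)
  rw [le_div_iff₀ (by positivity)] at h2
  nlinarith

/-- The sampled mixture is no better than the best arm, so only the sampling error is lost; no
information about the policy enters. -/
lemma pool_le (hs : IsSample B x τ T z) :
    R (S.pool x τ T) ≤ R (B.F k) + b * (K * z + (K * z) ^ q) := by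
  have h1 := H.abs_sub_le (B.mix_mem_mixSet hs.freq_mem) (Or.inr hs.pool_mem) hs.norm_pool_sub_mix
  have h2 := H.mix_le hs.freq_mem
  linarith [le_abs_self (R (S.pool x τ T) - R (B.mix (freq τ T)))]

lemma norm_pool_sub_le (hs : IsSample B x τ T z) :
    ‖S.pool x τ T - B.F k‖ ≤ K * z + D * (1 - freq τ T k) := by
  have h1 := hs.norm_pool_sub_mix
  have h2 := Arms.norm_mix_sub_le H.dist_le hs.freq_mem k
  have := norm_sub_le_norm_sub_add_norm_sub (S.pool x τ T) (B.mix (freq τ T)) (B.F k)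
  linarith

lemma abs_pool_sub_le (hs : IsSample B x τ T z) :
    |R (S.pool x τ T) - R (B.F k)| ≤
      b * ((K * z + D * (1 - freq τ T k)) + (K * z + D * (1 - freq τ T k)) ^ q) :=
  H.abs_sub_le (B.F_mem_mixSet k) (Or.inr hs.pool_mem) (H.norm_pool_sub_le hs)

end Landscape

end Landscape

/-! ### Calculus of the second-order error -/

/-- The error function of the second-order expansion. -/
noncomputable def quadErr (q n : ℝ) : ℝ := n ^ 2 + n ^ (q + 2)

lemma quadErr_nonneg {q n : ℝ} (hn : 0 ≤ n) : 0 ≤ quadErr q n := by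
  unfold quadErr; positivity

lemma quadErr_mono {q n m : ℝ} (hq : 0 < q) (hn : 0 ≤ n) (h : n ≤ m) : quadErr q n ≤ quadErr q m := by
  unfold quadErr; gcongr

lemma quadErr_mul {q n m : ℝ} (hn : 0 ≤ n) (hm : 0 ≤ m) :
    quadErr q (n * m) ≤ quadErr q n * quadErr q m := by
  unfold quadErr
  rw [mul_pow, Real.mul_rpow hn hm]
  have h1 : 0 ≤ n ^ (q + 2) := by positivity
  have h2 : 0 ≤ m ^ (q + 2) := by positivity
  nlinarith [mul_nonneg h1 (sq_nonneg m), mul_nonneg h2 (sq_nonneg n)]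

/-- Since `l ≤ 1`, both powers of `l` are bounded by `l ^ 2`. With `l` the frequency of suboptimal
arms this term can be compared with a drift linear in `l`. -/
lemma quadErr_add {q h d l : ℝ} (hq : 0 < q) (hh : 0 ≤ h) (hd : 0 ≤ d) (hl : 0 ≤ l) (hl1 : l ≤ 1) :
    quadErr q (h + d * l) ≤ 2 ^ (q + 2) * (quadErr q h + quadErr q d * l ^ 2) := by
  unfold quadErr
  have h1 := add_rpow_le_two_rpow hh (mul_nonneg hd hl) (r := q + 2) (by linarith)
  have h2 : (h + d * l) ^ 2 ≤ 2 * (h ^ 2 + (d * l) ^ 2) := by nlinarith [sq_nonneg (h - d * l)]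
  have h3 : (2 : ℝ) ≤ 2 ^ (q + 2) := by
    simpa using Real.rpow_le_rpow_of_exponent_le one_le_two (show (1 : ℝ) ≤ q + 2 by linarith)
  have h4 : (d * l) ^ (q + 2) ≤ d ^ (q + 2) * l ^ 2 := by
    rw [Real.mul_rpow hd hl]
    gcongr
    have := Real.rpow_le_rpow_of_exponent_ge' hl hl1 (by norm_num : (0 : ℝ) ≤ 2)
      (show (2 : ℝ) ≤ q + 2 by linarith)
    rwa [Real.rpow_two] at this
  calc (h + d * l) ^ 2 + (h + d * l) ^ (q + 2)
      ≤ 2 ^ (q + 2) * (h ^ 2 + (d * l) ^ 2) + 2 ^ (q + 2) * (h ^ (q + 2) + d ^ (q + 2) * l ^ 2) := by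
        refine add_le_add (h2.trans ?_) (h1.trans ?_)
        · gcongr
        · gcongr
    _ = 2 ^ (q + 2) * (h ^ 2 + h ^ (q + 2) + (d ^ 2 + d ^ (q + 2)) * l ^ 2) := by ring

lemma quadErr_mul_le_sq {q w t : ℝ} (hq : 0 < q) (hw : 0 ≤ w) (ht : 0 ≤ t) (ht1 : t ≤ 1) :
    quadErr q (w * t) ≤ quadErr q w * t ^ 2 := by
  have h1 : t ^ (q + 2) ≤ t ^ 2 := by
    have := Real.rpow_le_rpow_of_exponent_ge' ht ht1 (by norm_num : (0 : ℝ) ≤ 2)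
      (show (2 : ℝ) ≤ q + 2 by linarith)
    rwa [Real.rpow_two] at this
  rw [quadErr, quadErr, mul_pow, Real.mul_rpow hw ht]
  have h3 : 0 ≤ w ^ (q + 2) := by positivity
  nlinarith

/-- Away from `0` first-order terms are dominated by terms of higher order. -/
lemma le_mul_rpow_add {q s n m : ℝ} (hs : 0 < s) (hsn : s ≤ n) {r : ℝ} (hr : 0 ≤ r)
    (hm : m = q + r) : n ^ q ≤ (s ^ r)⁻¹ * n ^ m := by
  have hn : 0 < n := hs.trans_le hsn
  rw [hm, Real.rpow_add hn, le_inv_mul_iff₀ (by positivity), mul_comm]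
  gcongr

/-- This is why `quadErr` has the exponents `2` and `q + 2`: at distances bounded below it dominates
the two terms of the stability modulus. -/
lemma linear_le_quadErr {q s n : ℝ} (hs : 0 < s) (hsn : s ≤ n) :
    n ≤ s⁻¹ * quadErr q n ∧ n ^ q ≤ (s ^ 2)⁻¹ * quadErr q n := by
  have hn : 0 < n := hs.trans_le hsn
  have h1 : 0 ≤ n ^ (q + 2) := by positivity
  constructor
  · rw [le_inv_mul_iff₀ hs, quadErr]
    nlinarith
  · have := le_mul_rpow_add hs hsn (q := q) (r := 2) (by norm_num) rfl
    rw [Real.rpow_two] at this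
    refine this.trans ?_
    rw [quadErr]
    gcongr
    nlinarith

/-- A first-order error minus a constant is dominated by errors of order at least four. -/
lemma sub_le_of_dominated {b e q η h : ℝ} (hb : 0 < b) (he : 0 ≤ e) (hq : 1 ≤ q) (hη : 0 < η)
    (hh : 0 ≤ h) :
    -η + (b + e) * h + b * h ^ q ≤
      ((b + e) * ((min 1 (η / (2 * b + e))) ^ (3 : ℝ))⁻¹
        + b * ((min 1 (η / (2 * b + e))) ^ (4 : ℝ))⁻¹) * (h ^ (4 : ℝ) + h ^ (q + 4)) := by
  have hbe : 0 < 2 * b + e := by positivity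
  set s := min 1 (η / (2 * b + e))
  have hs : 0 < s := lt_min one_pos (by positivity)
  -- Up to `s` the first-order terms sum to at most `(2 * b + e) * h ≤ η`, so the left side is
  -- nonpositive. Beyond `s` they are traded for higher powers.
  rcases le_or_gt h s with hhs | hhs
  · have h5 := rpow_le_self_of_le_one' hh (hhs.trans (min_le_left _ _)) hq
    have h6 : h ≤ η / (2 * b + e) := hhs.trans (min_le_right _ _)
    rw [le_div_iff₀ hbe] at h6
    have h7 := mul_le_mul_of_nonneg_left h5 hb.le
    refine le_trans ?_ (by positivity)
    linarith
  · have h5 := le_mul_rpow_add hs hhs.le (q := 1) (r := 3) (m := 4) (by norm_num) (by norm_num)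
    have h6 := le_mul_rpow_add hs hhs.le (q := q) (r := 4) (by norm_num) rfl
    rw [Real.rpow_one] at h5
    have h7 := mul_le_mul_of_nonneg_left h5 (add_nonneg hb.le he)
    have h8 := mul_le_mul_of_nonneg_left h6 hb.le
    have h9 : 0 ≤ (b + e) * (s ^ (3 : ℝ))⁻¹ * h ^ (q + 4) := by positivity
    have h10 : 0 ≤ b * (s ^ (4 : ℝ))⁻¹ * h ^ (4 : ℝ) := by positivity
    linarith

/-! ### Second-order expansion at the optimal arm: the separated case -/

section Smooth

variable {L : Type*} [NormedAddCommGroup L] [NormedSpace ℝ L] {S : FunSpace L} {K : ℕ}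
  {B : Arms S K} {R : L → ℝ} {a b q δ D : ℝ} {k : Fin K}
  {x : Fin K → ℕ → ℝ} {τ : Fin K → ℕ} {T : ℕ} {z : ℝ} {d₁ d₂ M₀ : ℝ} {A : L →L[ℝ] ℝ}

/-- The constant of the global second-order expansion. -/
noncomputable def smoothConst (b d₁ d₂ M₀ : ℝ) : ℝ := d₂ / 2 + (b + d₁) / M₀ + b / M₀ ^ 2

lemma smoothConst_nonneg (H : Landscape B R a b q δ D k) (A' : SmoothAt B R d₁ d₂ M₀ k A) :
    0 ≤ smoothConst b d₁ d₂ M₀ := by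
  have := H.stable.b_pos
  have := A'.d₁_nonneg
  have := A'.d₂_nonneg
  have := A'.M₀_pos
  unfold smoothConst; positivity

/-- The second-order expansion at `F k`, valid for all empirical distribution functions. -/
lemma SmoothAt.abs_sub_le (H : Landscape B R a b q δ D k) (A' : SmoothAt B R d₁ d₂ M₀ k A) {G : L}
    (hG : G ∈ S.empSet) :
    |R G - R (B.F k) - A (G - B.F k)| ≤ smoothConst b d₁ d₂ M₀ * quadErr q ‖G - B.F k‖ := by
  have hb := H.stable.b_pos
  have h1 := A'.d₁_nonneg
  have h2 := A'.d₂_nonneg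
  have h3 := A'.M₀_pos
  set n := ‖G - B.F k‖ with hn
  have hn0 : 0 ≤ n := norm_nonneg _
  have hQ := quadErr_nonneg (q := q) hn0
  rw [smoothConst, add_mul, add_mul]
  rcases le_or_gt n M₀ with hle | hgt
  · have := A'.quad G (Or.inr ⟨hG, by rw [norm_sub_rev]; exact hle⟩)
    have h5 : n ^ 2 ≤ quadErr q n := by
      unfold quadErr; linarith [Real.rpow_nonneg hn0 (q + 2)]
    have h6 : 1 / 2 * d₂ * n ^ 2 ≤ d₂ / 2 * quadErr q n := by
      have := mul_le_mul_of_nonneg_left h5 h2; linarith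
    have h7 : 0 ≤ (b + d₁) / M₀ * quadErr q n := by positivity
    have h8 : 0 ≤ b / M₀ ^ 2 * quadErr q n := by positivity
    linarith
  -- Outside the radius `M₀` the expansion is not available; stability and the bound for `A` suffice
  -- because the distance is bounded below.
  · obtain ⟨h5, h6⟩ := linear_le_quadErr (q := q) h3 hgt.le
    have h7 := H.abs_sub_le (B.F_mem_mixSet k) (Or.inr hG) hn.ge
    have h8 := A'.lip G (Or.inr hG)
    have h9 := abs_sub (R G - R (B.F k)) (A (G - B.F k))
    have h10 := mul_le_mul_of_nonneg_left h5 (add_nonneg hb.le h1)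
    have h11 := mul_le_mul_of_nonneg_left h6 hb.le
    have h12 : 0 ≤ d₂ / 2 * quadErr q n := by positivity
    have h13 : (b + d₁) / M₀ * quadErr q n = (b + d₁) * (M₀⁻¹ * quadErr q n) := by ring
    have h14 : b / M₀ ^ 2 * quadErr q n = b * ((M₀ ^ 2)⁻¹ * quadErr q n) := by ring
    rw [h13, h14]
    have h15 : (b + d₁) * n = b * n + d₁ * n := by ring
    have h16 : b * (n + n ^ q) = b * n + b * n ^ q := by ring
    linarith

/-- The linear term of the fluctuations around the mixture. -/
noncomputable def FunSpace.fluct (S : FunSpace L) (B : Arms S K) (A : L →L[ℝ] ℝ)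
    (x : Fin K → ℕ → ℝ) (τ : Fin K → ℕ) (T : ℕ) : ℝ :=
  A (S.pool x τ T - B.mix (freq τ T))

lemma fluct_add (A : L →L[ℝ] ℝ) : A (S.pool x τ T - B.F k) =
    S.fluct B A x τ T + A (B.mix (freq τ T) - B.F k) := by
  rw [FunSpace.fluct, ← map_add]; congr 1; abel

lemma quadErr_pool_le (H : Landscape B R a b q δ D k) (hs : IsSample B x τ T z) :
    quadErr q ‖S.pool x τ T - B.F k‖ ≤
      2 ^ (q + 2) * (quadErr q (K * z) + quadErr q D * (1 - freq τ T k) ^ 2) := by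
  have h1 := stdSimplex_le_one hs.freq_mem k
  have h2 := hs.freq_mem.1 k
  exact (quadErr_mono H.q_pos (norm_nonneg _) (H.norm_pool_sub_le hs)).trans
    (quadErr_add H.q_pos (hs.h_nonneg k) H.D_nonneg (by linarith) (by linarith))

/-- Lower bound for the value of a sample in which most rewards come from the optimal arm. -/
lemma SmoothAt.pool_ge (H : Landscape B R a b q δ D k) (A' : SmoothAt B R d₁ d₂ M₀ k A)
    (hs : IsSample B x τ T z) :
    R (B.F k) + S.fluct B A x τ T
      - (smoothConst b d₁ d₂ M₀ * (2 ^ (q + 2) * quadErr q (K * z))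
        + (smoothConst b d₁ d₂ M₀ * (2 ^ (q + 2) * quadErr q D) + d₁ * D) * (1 - freq τ T k))
      ≤ R (S.pool x τ T) := by
  have h1 := stdSimplex_le_one hs.freq_mem k
  have h2 := hs.freq_mem.1 k
  have h3 := abs_le.1 (A'.abs_sub_le H hs.pool_mem)
  have hc := smoothConst_nonneg H A'
  have h4 := mul_le_mul_of_nonneg_left (quadErr_pool_le H hs) hc
  have h5 := abs_le.1 (A'.lip _ (Or.inl (B.mix_mem_mixSet hs.freq_mem)))
  have h6 := mul_le_mul_of_nonneg_left (Arms.norm_mix_sub_le H.dist_le hs.freq_mem k) A'.d₁_nonneg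
  rw [fluct_add] at h3
  have h7 : (1 - freq τ T k) ^ 2 ≤ 1 - freq τ T k := by nlinarith
  have h8 : smoothConst b d₁ d₂ M₀ * (2 ^ (q + 2) * quadErr q D) * (1 - freq τ T k) ^ 2
      ≤ smoothConst b d₁ d₂ M₀ * (2 ^ (q + 2) * quadErr q D) * (1 - freq τ T k) := by
    have := quadErr_nonneg (q := q) H.D_nonneg
    gcongr
  linarith [h3.1, h5.1]

lemma Arms.map_mix_sub_le {κ : ℝ} (hκ : ∀ i, i ≠ k → A (B.F i - B.F k) ≤ -κ) {p : Fin K → ℝ}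
    (hp : p ∈ stdSimplex ℝ (Fin K)) : A (B.mix p - B.F k) ≤ -(κ * (1 - p k)) := by
  have h1 : B.mix p - B.F k = ∑ i ∈ Finset.univ.erase k, p i • (B.F i - B.F k) := by
    have : B.F k = ∑ i, p i • B.F k := by rw [← Finset.sum_smul, hp.2, one_smul]
    rw [Arms.mix]
    nth_rewrite 1 [this]
    rw [← Finset.sum_sub_distrib, ← Finset.add_sum_erase _ _ (Finset.mem_univ k)]
    simp [smul_sub]
  rw [h1, map_sum, ← sum_erase_eq hp, Finset.mul_sum, ← Finset.sum_neg_distrib]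
  refine Finset.sum_le_sum fun i hi => ?_
  rw [map_smul, smul_eq_mul]
  nlinarith [hκ i (Finset.ne_of_mem_erase hi), hp.1 i]

/-- If the linear term separates the optimal arm, then mixtures with a substantial weight of the
other arms are substantially worse than the optimal arm. -/
lemma SmoothAt.mix_le_of_separated (H : Landscape B R a b q δ D k)
    (A' : SmoothAt B R d₁ d₂ M₀ k A) {κ : ℝ}
    (hκ : ∀ i, i ≠ k → A (B.F i - B.F k) ≤ -κ) {l : ℝ} (hl0 : 0 < l)
    (hl : d₂ / 2 * D ^ 2 * l ≤ κ / 2) {p : Fin K → ℝ} (hp : p ∈ stdSimplex ℝ (Fin K))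
    (hlp : l ≤ 1 - p k) : R (B.mix p) ≤ R (B.F k) - min δ (κ * l / 2) := by
  have hpk : p k < 1 := by linarith
  have hp0 := hp.1 k
  set F' := B.mix (others p k) with hF'
  have ho := others_mem hp hpk
  have hF'm : F' ∈ B.mixSet := B.mix_mem_mixSet ho
  have h0 : others p k k = 0 := by simp [others]
  -- `G` lies on the segment from `B.F k` towards the other arms, at weight `l`. There the drift `-κ
  -- * l` still beats the quadratic term, so `G` is strictly worse than `B.F k`.
  set G := (1 - l) • B.F k + l • F' with hG
  have hGm : G ∈ B.mixSet :=
    B.convex_mixSet (B.F_mem_mixSet k) hF'm (by linarith) hl0.le (by ring)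
  have hGs : G - B.F k = l • (F' - B.F k) := by rw [hG, sub_smul, one_smul, smul_sub]; abel
  have hRG : R G ≤ R (B.F k) - κ * l / 2 := by
    have h1 := abs_le.1 (A'.quad G (Or.inl hGm))
    have h2 := Arms.map_mix_sub_le hκ ho
    have h3 := Arms.norm_mix_sub_le H.dist_le ho k
    rw [h0, sub_zero, mul_one] at h2 h3
    rw [hGs, map_smul, smul_eq_mul, norm_smul, Real.norm_of_nonneg hl0.le, mul_pow] at h1
    have h4 : ‖F' - B.F k‖ ^ 2 ≤ D ^ 2 := pow_le_pow_left₀ (norm_nonneg _) h3 2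
    have h5 := mul_le_mul_of_nonneg_left h4 (mul_nonneg A'.d₂_nonneg (sq_nonneg l))
    have h6 := mul_le_mul_of_nonneg_left h2 hl0.le
    have h7 := mul_le_mul_of_nonneg_right hl hl0.le
    nlinarith [h1.2]
  have hRF := H.mix_others_le hp hpk
  have hS := H.quasiconvex.convex
  -- As `p k ≤ 1 - l`, the mixture lies between `G` and `F'`, and quasiconvexity bounds it by the
  -- worse gap of the two. For `l = 1` the weight `p k` is zero and the mixture is `F'`.
  have hmix : B.mix p = (p k / (1 - l)) • G + (1 - p k / (1 - l)) • F' ∨ l = 1 := by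
    rcases eq_or_ne l 1 with h | h
    · exact Or.inr h
    left
    have h1 : 1 - l ≠ 0 := sub_ne_zero.2 h.symm
    rw [B.mix_eq_others hpk, ← hF', hG, smul_add, smul_smul, smul_smul, add_assoc, ← add_smul]
    congr 2
    · field_simp
    · field_simp; ring
  rcases hmix with h | h
  · have hl1 : 0 ≤ 1 - l := by linarith
    have h1 : p k / (1 - l) ≤ 1 := div_le_one_of_le₀ (by linarith) hl1
    have := H.quasiconvex.le_max' (Arms.mixSet_subset_distSet hS hGm)
      (Arms.mixSet_subset_distSet hS hF'm) (div_nonneg hp0 hl1) (sub_nonneg.2 h1) (by ring)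
    rw [← h] at this
    refine this.trans (max_le ?_ ?_)
    · linarith [min_le_right δ (κ * l / 2)]
    · linarith [min_le_left δ (κ * l / 2)]
  · have h1 : p k = 0 := by linarith
    rw [B.mix_eq_others hpk, h1, zero_smul, zero_add, sub_zero, one_smul]
    linarith [min_le_left δ (κ * l / 2)]

/-- Upper bound for the value of a sample if the linear term separates the optimal arm. -/
lemma SmoothAt.pool_le_of_separated (H : Landscape B R a b q δ D k)
    (A' : SmoothAt B R d₁ d₂ M₀ k A) (hA : ∀ i, i ≠ k → A (B.F i - B.F k) < 0) :
    ∃ c : ℝ, 0 ≤ c ∧ ∀ (x : Fin K → ℕ → ℝ) (τ : Fin K → ℕ) (T : ℕ) (z : ℝ), IsSample B x τ T z →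
      R (S.pool x τ T) ≤ R (B.F k) + S.fluct B A x τ T
        + smoothConst b d₁ d₂ M₀ * (2 ^ (q + 2) * quadErr q (K * z))
        + c * ((K * z) ^ (4 : ℝ) + (K * z) ^ (q + 4)) := by
  obtain ⟨κ, hκ0, hκ⟩ : ∃ κ : ℝ, 0 < κ ∧ ∀ i, i ≠ k → A (B.F i - B.F k) ≤ -κ := by
    rcases (Finset.univ.erase k).eq_empty_or_nonempty with h | h
    · refine ⟨1, one_pos, fun i hi => ?_⟩
      have : i ∈ Finset.univ.erase k := Finset.mem_erase.2 ⟨hi, Finset.mem_univ i⟩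
      simp [h] at this
    · obtain ⟨j, hj, hm⟩ := Finset.exists_max_image _ (fun i => A (B.F i - B.F k)) h
      refine ⟨-A (B.F j - B.F k), neg_pos.2 (hA j (Finset.ne_of_mem_erase hj)), fun i hi => ?_⟩
      rw [neg_neg]
      exact hm i (Finset.mem_erase.2 ⟨hi, Finset.mem_univ i⟩)
  have hb := H.stable.b_pos
  have hc := smoothConst_nonneg H A'
  have hQD := quadErr_nonneg (q := q) H.D_nonneg
  set c₁ := smoothConst b d₁ d₂ M₀ with hc₁
  -- With `c₂ * l = κ / 2`, the first summand lets the drift absorb the quadratic term near the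
  -- vertex, and the second meets the smallness condition of `mix_le_of_separated`; the `1` only
  -- ensures positivity.
  set c₂ := c₁ * (2 ^ (q + 2) * quadErr q D) + d₂ / 2 * D ^ 2 + 1 with hc₂
  have hd2 : 0 ≤ d₂ / 2 * D ^ 2 := by have := A'.d₂_nonneg; positivity
  have hc1' : 0 ≤ c₁ * (2 ^ (q + 2) * quadErr q D) := by positivity
  have hc₂0 : 0 < c₂ := by linarith
  set l := κ / (2 * c₂) with hl
  have hl0 : 0 < l := by positivity
  have hcl : c₂ * l = κ / 2 := by rw [hl]; field_simp
  set η := min δ (κ * l / 2) with hη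
  have hη0 : 0 < η := lt_min H.pos (by positivity)
  set s := min 1 (η / (2 * b + ‖A‖)) with hs'
  have hbA : 0 < 2 * b + ‖A‖ := by positivity
  have hs0 : 0 < s := lt_min one_pos (by positivity)
  refine ⟨(b + ‖A‖) * (s ^ (3 : ℝ))⁻¹ + b * (s ^ (4 : ℝ))⁻¹, by positivity, fun x τ T z hs => ?_⟩
  set h := (K : ℝ) * z with hh
  have hh0 : 0 ≤ h := hs.h_nonneg k
  have hQ := quadErr_nonneg (q := q) hh0
  have hW : |S.fluct B A x τ T| ≤ ‖A‖ * h :=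
    (A.le_opNorm _).trans (mul_le_mul_of_nonneg_left hs.norm_pool_sub_mix (norm_nonneg _))
  have hp1 := stdSimplex_le_one hs.freq_mem k
  have hpos4 : 0 ≤ h ^ (4 : ℝ) := by positivity
  have hposq : 0 ≤ h ^ (q + 4) := by positivity
  have hmain : 0 ≤ c₁ * (2 ^ (q + 2) * quadErr q h) := by positivity
  have hlast : 0 ≤ ((b + ‖A‖) * (s ^ (3 : ℝ))⁻¹ + b * (s ^ (4 : ℝ))⁻¹)
      * (h ^ (4 : ℝ) + h ^ (q + 4)) := by positivity
  -- Near the vertex the expansion is used. Away from it the loss `η` pays for the sampling error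
  -- and for inserting the fluctuation, which is at most `‖A‖ * h`, up to terms of order at least
  -- four.
  rcases le_or_gt (1 - freq τ T k) l with hle | hgt
  · have h1 := abs_le.1 (A'.abs_sub_le H hs.pool_mem)
    have h2 := mul_le_mul_of_nonneg_left (quadErr_pool_le H hs) hc
    have h3 := Arms.map_mix_sub_le hκ hs.freq_mem
    rw [fluct_add] at h1
    have h4 : c₁ * (2 ^ (q + 2) * quadErr q D) * (1 - freq τ T k) ≤ κ := by
      calc c₁ * (2 ^ (q + 2) * quadErr q D) * (1 - freq τ T k) ≤ c₂ * l :=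
            mul_le_mul (by linarith) hle (by linarith) hc₂0.le
        _ ≤ κ := by linarith
    have h5 := mul_le_mul_of_nonneg_right h4 (sub_nonneg.2 hp1)
    linarith [h1.2]
  · have h1 := A'.mix_le_of_separated H hκ hl0 (by nlinarith) hs.freq_mem hgt.le
    have h2 := abs_le.1 (H.abs_sub_le (B.mix_mem_mixSet hs.freq_mem) (Or.inr hs.pool_mem)
      hs.norm_pool_sub_mix)
    have h3 := abs_le.1 hW
    have h4 := sub_le_of_dominated hb (norm_nonneg A) H.stable.one_le_q hη0 hh0
    linarith [h2.2, h3.1]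

end Smooth

/-! ### The case in which the linear term does not separate the optimal arm -/

section Smooth

variable {L : Type*} [NormedAddCommGroup L] [NormedSpace ℝ L] {S : FunSpace L} {K : ℕ}
  {B : Arms S K} {R : L → ℝ} {a b q δ D : ℝ} {k : Fin K}
  {x : Fin K → ℕ → ℝ} {τ : Fin K → ℕ} {T : ℕ} {z : ℝ} {d₁ d₂ M₀ : ℝ} {A : L →L[ℝ] ℝ}

/-- Stability and smoothness control `R` only at mixtures of arms and at empirical distribution
functions. An arm perturbed by a point mass need be neither, so it is approached through samples. -/
lemma StronglyStable.exists_emp_tendsto (h : StronglyStable B R a b q) (i : Fin K) :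
    ∃ E : ℕ → L, (∀ n, E n ∈ S.empSet) ∧ Tendsto E atTop (nhds (B.F i)) := by
  choose y hy using fun n : ℕ => h.exists_emp_near i (n := n + 1) (by omega)
  refine ⟨fun n => S.emp (y n), fun n => ⟨n + 1, by omega, y n, rfl⟩, ?_⟩
  rw [tendsto_iff_norm_sub_tendsto_zero]
  refine squeeze_zero (fun _ => norm_nonneg _) hy ?_
  have h1 : Tendsto (fun n : ℕ => a * ((n + 1 : ℕ) : ℝ)) atTop atTop :=
    ((tendsto_natCast_atTop_atTop (R := ℝ)).comp (tendsto_add_atTop_nat 1)).const_mul_atTop h.a_pos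
  exact (Real.tendsto_sqrt_atTop.comp h1).inv_tendsto_atTop

/-- The first-order condition: an empirical distribution function that is a perturbation of a
suboptimal arm is not better to first order than the optimal arm. -/
lemma SmoothAt.map_perturb_nonpos (H : Landscape B R a b q δ D k)
    (A' : SmoothAt B R d₁ d₂ M₀ k A) {i : Fin K} (hi : i ≠ k) (y : ℝ) :
    ∃ N : ℕ, (N : ℝ) / (N + 1) * A (B.F i - B.F k)
      + 1 / (N + 1) * A (S.step y - B.F k) ≤ 0 := by
  have hb := H.stable.b_pos
  have hδ := H.pos
  set r := min 1 (δ / (4 * b)) with hr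
  have hr0 : 0 < r := lt_min one_pos (by positivity)
  -- With this `N` the point mass moves `B.F i` by at most `r / 2`; the other half of the safe
  -- radius is left for the approximation by `E'`.
  obtain ⟨N, hN⟩ := exists_nat_gt (‖S.step y - B.F i‖ / (r / 2))
  refine ⟨N, ?_⟩
  have hN1 : (0 : ℝ) < N + 1 := by positivity
  set θ : ℝ := 1 / (N + 1) with hθ
  have hθ0 : 0 < θ := by positivity
  have hNθ : (N : ℝ) / (N + 1) = 1 - θ := by rw [hθ]; field_simp; ring
  have hθy : θ * ‖S.step y - B.F i‖ ≤ r / 2 := by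
    rw [div_lt_iff₀ (by positivity)] at hN
    rw [hθ, one_div, inv_mul_le_iff₀ hN1]
    nlinarith
  obtain ⟨E, hE, hEt⟩ := H.stable.exists_emp_tendsto k
  obtain ⟨E', hE', hEt'⟩ := H.stable.exists_emp_tendsto i
  set Q : ℕ → L := fun n => ((N : ℝ) / (N + 1)) • E' n + ((1 : ℝ) / (N + 1)) • S.step y with hQ
  have hQm : ∀ n, Q n ∈ S.empSet := fun n =>
    FunSpace.mix_mem_empSet (hE' n) (S.step_mem_empSet y) N
  set ν := (1 - θ) • (B.F i - B.F k) + θ • (S.step y - B.F k) with hν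
  have hQt : Tendsto (fun n => Q n - B.F k) atTop (nhds ν) := by
    have h1 : ν = ((N : ℝ) / (N + 1)) • B.F i + ((1 : ℝ) / (N + 1)) • S.step y - B.F k := by
      rw [hν, hNθ, ← hθ]; simp only [smul_sub, sub_smul, one_smul]; abel
    rw [h1]
    exact ((hEt'.const_smul _).add tendsto_const_nhds).sub_const _
  have hQR : ∀ᶠ n in atTop, R (Q n) ≤ R (B.F k) := by
    have h1 : ∀ᶠ n in atTop, ‖E' n - B.F i‖ < r / 2 :=
      (tendsto_iff_norm_sub_tendsto_zero.1 hEt').eventually (gt_mem_nhds (by positivity))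
    filter_upwards [h1] with n hn
    have h2 : Q n - B.F i = (1 - θ) • (E' n - B.F i) + θ • (S.step y - B.F i) := by
      simp only [hQ]
      rw [hNθ, ← hθ]; simp only [smul_sub, sub_smul, one_smul]; abel
    have hθ1 : 0 ≤ 1 - θ := by rw [← hNθ]; positivity
    have h3 : ‖Q n - B.F i‖ ≤ r := by
      rw [h2]
      refine (norm_add_le _ _).trans ?_
      rw [norm_smul, norm_smul, Real.norm_of_nonneg hθ0.le, Real.norm_of_nonneg hθ1]
      nlinarith [norm_nonneg (E' n - B.F i)]
    have h4 := H.abs_sub_le (B.F_mem_mixSet i) (Or.inr (hQm n)) h3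
    have h5 := H.modulus_small hr0.le le_rfl
    have h6 := H.gap i hi
    linarith [(abs_le.1 (h4.trans h5)).2]
  have hER : Tendsto (fun n => R (B.F k) + b * (‖E n - B.F k‖ + ‖E n - B.F k‖ ^ q)) atTop
      (nhds (R (B.F k))) := by
    have h1 := tendsto_iff_norm_sub_tendsto_zero.1 hEt
    have h2 := h1.rpow_const (p := q) (Or.inr H.q_pos.le)
    rw [Real.zero_rpow H.q_pos.ne'] at h2
    simpa using ((h1.add h2).const_mul b).const_add (R (B.F k))
  have hS := H.quasiconvex.convex
  -- Move from `B.F k` a fraction `t = 1 / (m + 1)` in direction `ν`. Quasiconvexity keeps the value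
  -- at most `R (B.F k)` in the limit, so the expansion gives `t * A ν = O(t ^ 2)`; divide by `t`.
  have hbound : ∀ m : ℕ, A ν ≤ smoothConst b d₁ d₂ M₀ * quadErr q ‖ν‖ * (1 / ((m : ℝ) + 1)) := by
    intro m
    have hm1 : (0 : ℝ) < m + 1 := by positivity
    set t : ℝ := 1 / (m + 1) with ht
    have ht0 : 0 < t := by positivity
    have ht1 : t ≤ 1 := by rw [ht, div_le_one hm1]; linarith [(Nat.cast_nonneg m : (0 : ℝ) ≤ m)]
    have hmt : (m : ℝ) / (m + 1) = 1 - t := by rw [ht]; field_simp; ring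
    set G : ℕ → L := fun n => ((m : ℝ) / (m + 1)) • E n + ((1 : ℝ) / (m + 1)) • Q n with hG
    have hGm : ∀ n, G n ∈ S.empSet := fun n => FunSpace.mix_mem_empSet (hE n) (hQm n) m
    have hGt : Tendsto (fun n => G n - B.F k) atTop (nhds (t • ν)) := by
      have h1 : ∀ n, G n - B.F k = (1 - t) • (E n - B.F k) + t • (Q n - B.F k) := fun n => by
        simp only [hG]
        rw [hmt, ← ht]; simp only [smul_sub, sub_smul, one_smul]; abel
      simp only [h1]
      have h2 : Tendsto (fun n => E n - B.F k) atTop (nhds 0) := by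
        simpa using hEt.sub_const (B.F k)
      simpa using (h2.const_smul (1 - t)).add (hQt.const_smul t)
    have hlim : t * A ν ≤ smoothConst b d₁ d₂ M₀ * quadErr q ‖t • ν‖ := by
      have h1 : Tendsto (fun n => A (G n - B.F k)) atTop (nhds (A (t • ν))) :=
        (A.continuous.tendsto _).comp hGt
      have h2 : Tendsto (fun n => quadErr q ‖G n - B.F k‖) atTop (nhds (quadErr q ‖t • ν‖)) := by
        unfold quadErr
        exact (hGt.norm.pow 2).add (hGt.norm.rpow_const (Or.inr (by linarith [H.q_pos])))
      rw [map_smul, smul_eq_mul] at h1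
      have h3 := (hER.sub_const (R (B.F k))).add (h2.const_mul (smoothConst b d₁ d₂ M₀))
      rw [sub_self, zero_add] at h3
      refine le_of_tendsto_of_tendsto h1 h3 ?_
      filter_upwards [hQR] with n hn
      have h4 := abs_le.1 (A'.abs_sub_le H (hGm n))
      have h5 := abs_le.1 (H.abs_sub_le (B.F_mem_mixSet k) (Or.inr (hE n)) le_rfl)
      have h6 : R (G n) ≤ max (R (E n)) (R (Q n)) := by
        simp only [hG]
        exact H.quasiconvex.le_max' (FunSpace.empSet_subset_distSet hS (hE n))
          (FunSpace.empSet_subset_distSet hS (hQm n)) (by positivity) (by positivity)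
          (by field_simp)
      have h7 : 0 ≤ b * (‖E n - B.F k‖ + ‖E n - B.F k‖ ^ q) := by positivity
      have h8 : R (G n) ≤ R (B.F k) + b * (‖E n - B.F k‖ + ‖E n - B.F k‖ ^ q) :=
        h6.trans (max_le (by linarith [h5.2]) (by linarith))
      linarith [h4.1]
    have hq2 : quadErr q ‖t • ν‖ ≤ quadErr q ‖ν‖ * t ^ 2 := by
      rw [norm_smul, Real.norm_of_nonneg ht0.le, mul_comm]
      exact quadErr_mul_le_sq H.q_pos (norm_nonneg _) ht0.le ht1
    have h1 := hlim.trans (mul_le_mul_of_nonneg_left hq2 (smoothConst_nonneg H A'))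
    have h2 : t * A ν ≤ t * (smoothConst b d₁ d₂ M₀ * quadErr q ‖ν‖ * t) := by
      refine h1.trans (le_of_eq ?_); ring
    exact le_of_mul_le_mul_left h2 ht0
  have hfin : A ν ≤ 0 := by
    have h1 := (tendsto_one_div_add_atTop_nhds_zero_nat (𝕜 := ℝ)).const_mul
      (smoothConst b d₁ d₂ M₀ * quadErr q ‖ν‖)
    rw [mul_zero] at h1
    exact ge_of_tendsto' h1 hbound
  rw [hNθ]
  simpa [hν] using hfin

/-- If the linear term does not separate the optimal arm from some other arm, then it is
nonpositive at all empirical distribution functions. -/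
lemma SmoothAt.map_emp_nonpos (H : Landscape B R a b q δ D k)
    (A' : SmoothAt B R d₁ d₂ M₀ k A) {i : Fin K} (hi : i ≠ k) (hAi : 0 ≤ A (B.F i - B.F k)) {G : L}
    (hG : G ∈ S.empSet) : A (G - B.F k) ≤ 0 := by
  -- The contribution of arm `i` to the perturbation is nonnegative, so the point mass has to
  -- contribute a nonpositive amount.
  have hstep : ∀ y, A (S.step y - B.F k) ≤ 0 := fun y => by
    obtain ⟨N, hN⟩ := A'.map_perturb_nonpos H hi y
    have h1 : 0 ≤ (N : ℝ) / (N + 1) * A (B.F i - B.F k) := by positivity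
    by_contra! hc
    have h2 : 0 < 1 / ((N : ℝ) + 1) * A (S.step y - B.F k) := by positivity
    linarith
  obtain ⟨t, ht, y, rfl⟩ := hG
  have ht0 : (t : ℝ) ≠ 0 := by positivity
  have h1 : S.emp y - B.F k = (t : ℝ)⁻¹ • ∑ s, (S.step (y s) - B.F k) := by
    rw [Finset.sum_sub_distrib, smul_sub, FunSpace.emp, Finset.sum_const, Finset.card_univ,
      Fintype.card_fin, ← Nat.cast_smul_eq_nsmul ℝ, smul_smul, inv_mul_cancel₀ ht0, one_smul]
  rw [h1, map_smul, map_sum, smul_eq_mul]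
  exact mul_nonpos_of_nonneg_of_nonpos (by positivity) (Finset.sum_nonpos fun s _ => hstep _)

/-- The radius within which the value changes by less than half of the gaps. -/
noncomputable def safeRadius (b δ : ℝ) : ℝ := min 1 (δ / (4 * b))

/-- The frequency of the optimal arm below which mixtures are clearly suboptimal. -/
noncomputable def safeFreq (b δ D : ℝ) : ℝ := min (1 / 2) (safeRadius b δ / (D + 1))

/-- The constant in the upper bound for the value if the linear term does not separate. -/
noncomputable def flatConst (b q δ D d₁ d₂ M₀ : ℝ) : ℝ :=
  b * ((safeRadius b δ)⁻¹ + (safeRadius b δ ^ 2)⁻¹)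
    + smoothConst b d₁ d₂ M₀ * quadErr q (1 + D / safeRadius b δ)
    + smoothConst b d₁ d₂ M₀ * quadErr q (safeFreq b δ D)⁻¹

lemma SmoothAt.pool_le_of_not_separated (H : Landscape B R a b q δ D k)
    (A' : SmoothAt B R d₁ d₂ M₀ k A) {i : Fin K} (hi : i ≠ k) (hAi : 0 ≤ A (B.F i - B.F k))
    (hs : IsSample B x τ T z) :
    R (S.pool x τ T) ≤ R (B.F k) + flatConst b q δ D d₁ d₂ M₀ * quadErr q (K * z) := by
  have hb := H.stable.b_pos
  have hδ := H.pos
  have hD := H.D_nonneg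
  have hq := H.q_pos
  have hT := hs.pos
  set r := safeRadius b δ with hr
  have hr0 : 0 < r := lt_min one_pos (by positivity)
  set η := safeFreq b δ D with hη
  have hη0 : 0 < η := lt_min (by norm_num) (by positivity)
  have hη1 : η < 1 := (min_le_left _ _).trans_lt (by norm_num)
  set h := (K : ℝ) * z with hh
  have hh0 : 0 ≤ h := hs.h_nonneg k
  have hQ := quadErr_nonneg (q := q) hh0
  have hc := smoothConst_nonneg H A'
  set c₁ := smoothConst b d₁ d₂ M₀ with hc₁
  have hp := hs.freq_mem
  have hp0 := hp.1 k
  have hp1 := stdSimplex_le_one hp k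
  have t1 : 0 ≤ b * (r⁻¹ + (r ^ 2)⁻¹) * quadErr q h := by positivity
  have t2 : 0 ≤ c₁ * quadErr q (1 + D / r) * quadErr q h := by
    have := quadErr_nonneg (q := q) (n := 1 + D / r) (by positivity); positivity
  have t3 : 0 ≤ c₁ * quadErr q η⁻¹ * quadErr q h := by
    have := quadErr_nonneg (q := q) (n := η⁻¹) (by positivity); positivity
  rw [flatConst, add_mul, add_mul]
  -- Here the sign of `A` removes the linear term, leaving a one-sided quadratic bound for samples
  -- within `c * h` of `B.F k`.
  have hE : ∀ (G : L) (c : ℝ), G ∈ S.empSet → 0 ≤ c → ‖G - B.F k‖ ≤ c * h →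
      R G ≤ R (B.F k) + c₁ * quadErr q c * quadErr q h := fun G c hG hc0 hGc => by
    have h1 := abs_le.1 (A'.abs_sub_le H hG)
    have h2 := (quadErr_mono hq (norm_nonneg _) hGc).trans (quadErr_mul hc0 hh0)
    have h3 := mul_le_mul_of_nonneg_left h2 hc
    have h4 := A'.map_emp_nonpos H hi hAi hG
    rw [← mul_assoc] at h3
    linarith [h1.2]
  -- If arm `k` is rare, the mixture is within `η * D ≤ r` of a mixture of the other arms and is
  -- still worse by `δ / 2`; a sampling error up to `r` is then harmless.
  rcases lt_or_ge (freq τ T k) η with hlt | hge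
  · have hpk : freq τ T k < 1 := hlt.trans hη1
    have ho := others_mem hp hpk
    have h1 : B.mix (freq τ T) - B.mix (others (freq τ T) k)
        = freq τ T k • (B.F k - B.mix (others (freq τ T) k)) := by
      rw [B.mix_eq_others hpk, sub_smul, one_smul, smul_sub]; abel
    have h2 : ‖B.mix (freq τ T) - B.mix (others (freq τ T) k)‖ ≤ r := by
      have h3 := Arms.norm_mix_sub_le H.dist_le ho k
      have h4 : others (freq τ T) k k = 0 := by simp [others]
      rw [h4, sub_zero, mul_one] at h3
      rw [h1, norm_smul, Real.norm_of_nonneg hp0, norm_sub_rev]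
      have h5 : η ≤ r / (D + 1) := min_le_right _ _
      rw [le_div_iff₀ (by positivity)] at h5
      calc freq τ T k * ‖B.mix (others (freq τ T) k) - B.F k‖ ≤ η * D :=
            mul_le_mul hlt.le h3 (norm_nonneg _) hη0.le
        _ ≤ r := by linarith
    have h3 := abs_le.1 ((H.abs_sub_le (B.mix_mem_mixSet ho) (Or.inl (B.mix_mem_mixSet hp)) h2).trans
      (H.modulus_small hr0.le le_rfl))
    have h4 := H.mix_others_le hp hpk
    have h5 := abs_le.1 (H.abs_sub_le (B.mix_mem_mixSet hp) (Or.inr hs.pool_mem)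
      hs.norm_pool_sub_mix)
    rcases le_or_gt h r with hhr | hhr
    · have h6 := H.modulus_small hh0 hhr
      linarith [h3.2, h5.2]
    · obtain ⟨h6, h7⟩ := linear_le_quadErr (q := q) hr0 hhr.le
      have h8 := mul_le_mul_of_nonneg_left (add_le_add h6 h7) hb.le
      have h9 : b * (r⁻¹ * quadErr q h + (r ^ 2)⁻¹ * quadErr q h)
        = b * (r⁻¹ + (r ^ 2)⁻¹) * quadErr q h := by ring
      linarith [h3.2, h5.2]
  -- If the other arms have weight at most `h / r`, the whole pool is within a multiple of `h` of
  -- `B.F k`.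
  rcases le_or_gt (1 - freq τ T k) (h / r) with hle | hgt
  · have h1 := hE (S.pool x τ T) (1 + D / r) hs.pool_mem (by positivity) <| by
      refine (H.norm_pool_sub_le hs).trans ?_
      have := mul_le_mul_of_nonneg_left hle hD
      have h2 : (1 + D / r) * h = h + D * (h / r) := by ring
      linarith
    linarith
  -- Otherwise both parts of the pool are substantial. The sample `G` of the other arms is within
  -- `r` of their mixture, hence not better than arm `k`; the sample `P` of arm `k` is within `η⁻¹ *
  -- h` of `B.F k`. Quasiconvexity bounds the pool by the larger of the two values.
  · have hl0 : 0 < 1 - freq τ T k := lt_of_le_of_lt (by positivity) hgt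
    have hpk : freq τ T k < 1 := by linarith
    have hτ0 : (0 : ℝ) < τ k := by
      have : 0 < freq τ T k := hη0.trans_le hge
      rw [freq] at this
      by_contra! hc
      linarith [div_nonpos_of_nonpos_of_nonneg hc hT.le]
    have hτ1 : 1 ≤ τ k := by exact_mod_cast hτ0
    set m := ∑ j ∈ Finset.univ.erase k, τ j with hm
    have hmT : (m : ℝ) / T = 1 - freq τ T k := by
      rw [← sum_erase_eq hp, hm]; push_cast; simp only [freq]; rw [Finset.sum_div]
    have hm0 : (0 : ℝ) < m := by
      have : 0 < (m : ℝ) / T := by rw [hmT]; exact hl0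
      by_contra! hc
      linarith [div_nonpos_of_nonpos_of_nonneg hc hT.le]
    set G := (m : ℝ)⁻¹ • ∑ j ∈ Finset.univ.erase k, S.esum (x j) (τ j) with hG
    set P := (τ k : ℝ)⁻¹ • S.esum (x k) (τ k) with hP
    have hGm : G ∈ S.empSet :=
      (FunSpace.IsSum.sum _ fun j _ => FunSpace.isSum_esum (x j) (τ j)).mem_empSet
        (by exact_mod_cast hm0)
    have hPm : P ∈ S.empSet := (FunSpace.isSum_esum (x k) (τ k)).mem_empSet hτ1
    have hsplit : S.pool x τ T = freq τ T k • P + (1 - freq τ T k) • G := by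
      rw [FunSpace.pool, ← Finset.add_sum_erase _ _ (Finset.mem_univ k), smul_add, hP, hG, ← hmT,
        smul_smul, smul_smul, freq]
      congr 2 <;> field_simp
    have ho := others_mem hp hpk
    have hGF : (1 - freq τ T k) • (G - B.mix (others (freq τ T) k))
        = (T : ℝ)⁻¹ • ∑ j ∈ Finset.univ.erase k, (S.esum (x j) (τ j) - (τ j : ℝ) • B.F j) := by
      have h1 : (1 - freq τ T k) • B.mix (others (freq τ T) k)
          = (T : ℝ)⁻¹ • ∑ j ∈ Finset.univ.erase k, (τ j : ℝ) • B.F j := by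
        have h2 := B.mix_eq_others hpk
        have h3 : B.mix (freq τ T) = freq τ T k • B.F k
            + ∑ j ∈ Finset.univ.erase k, freq τ T j • B.F j := by
          rw [Arms.mix, Finset.add_sum_erase _ (fun j => freq τ T j • B.F j) (Finset.mem_univ k)]
        rw [h3] at h2
        rw [← add_left_cancel h2, Finset.smul_sum]
        refine Finset.sum_congr rfl fun j _ => ?_
        rw [smul_smul, freq, div_eq_inv_mul]
      have h4 : (1 - freq τ T k) • G
          = (T : ℝ)⁻¹ • ∑ j ∈ Finset.univ.erase k, S.esum (x j) (τ j) := by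
        rw [hG, ← hmT, smul_smul]; congr 1; field_simp
      rw [smul_sub, h1, h4, Finset.sum_sub_distrib, smul_sub]
    have hGn : ‖G - B.mix (others (freq τ T) k)‖ ≤ r := by
      have h1 : (1 - freq τ T k) * ‖G - B.mix (others (freq τ T) k)‖ ≤ h := by
        have h2 := congrArg norm hGF
        rw [norm_smul, norm_smul, Real.norm_of_nonneg hl0.le, norm_inv, Real.norm_natCast] at h2
        rw [h2, inv_mul_le_iff₀ hT]
        have h3 : ‖∑ j ∈ Finset.univ.erase k, (S.esum (x j) (τ j) - (τ j : ℝ) • B.F j)‖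
            ≤ ∑ _j ∈ Finset.univ.erase k, (T : ℝ) * z := norm_sum_le_of_le _ fun j _ => hs.dev j
        refine h3.trans ?_
        have hz := hs.z_nonneg k
        refine (Finset.sum_le_univ_sum_of_nonneg fun _ => by positivity).trans (le_of_eq ?_)
        rw [Finset.sum_const, Finset.card_univ, Fintype.card_fin, nsmul_eq_mul, hh]; ring
      rw [div_lt_iff₀ hr0] at hgt
      by_contra! hc
      nlinarith
    have hRG : R G ≤ R (B.F k) := by
      have h1 := abs_le.1 ((H.abs_sub_le (B.mix_mem_mixSet ho) (Or.inr hGm) hGn).trans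
        (H.modulus_small hr0.le le_rfl))
      linarith [h1.2, H.mix_others_le hp hpk]
    have hRP := hE P η⁻¹ hPm (by positivity) <| by
      have h1 : (τ k : ℝ) * ‖P - B.F k‖ ≤ T * z := by
        refine le_trans (le_of_eq ?_) (hs.dev k)
        rw [← norm_smul_of_nonneg hτ0.le, hP, smul_sub, smul_smul, mul_inv_cancel₀ hτ0.ne',
          one_smul]
      have h2 : η * T ≤ τ k := by
        rw [freq, le_div_iff₀ hT] at hge; exact hge
      rw [le_inv_mul_iff₀ hη0]
      have h3 : η * T * ‖P - B.F k‖ ≤ T * z :=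
        (mul_le_mul_of_nonneg_right h2 (norm_nonneg _)).trans h1
      have h4 : η * ‖P - B.F k‖ ≤ z := le_of_mul_le_mul_left (by linarith) hT
      exact h4.trans (hs.z_le k)
    have hS := H.quasiconvex.convex
    have := H.quasiconvex.le_max' (FunSpace.empSet_subset_distSet hS hPm)
      (FunSpace.empSet_subset_distSet hS hGm) hp0 hl0.le (by ring)
    rw [← hsplit] at this
    exact this.trans (max_le (by linarith) (by linarith))

end Smooth

/-! ### Bookkeeping and measurability of policies -/

section Policy

variable {K : ℕ} {𝕍 : Type*} [MeasurableSpace 𝕍] (π : Policy K 𝕍) (v : 𝕍) (x : Fin K → ℕ → ℝ)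

lemma Policy.hist_succ (t : ℕ) : π.hist v x (t + 1) =
    Fin.snoc (α := fun _ => Fin K × ℝ) (π.hist v x t)
      (π.action v x t, x (π.action v x t) (π.pulls v x t (π.action v x t))) := rfl

lemma Policy.pulls_eq_sum (t : ℕ) (i : Fin K) :
    π.pulls v x t i = ∑ s : Fin t, if (π.hist v x t s).1 = i then 1 else 0 := by
  rw [Policy.pulls, Finset.card_filter]

lemma Policy.pulls_zero (i : Fin K) : π.pulls v x 0 i = 0 := by
  simp [Policy.pulls]

lemma Policy.pulls_succ (t : ℕ) (i : Fin K) :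
    π.pulls v x (t + 1) i = π.pulls v x t i + if π.action v x t = i then 1 else 0 := by
  rw [Policy.pulls_eq_sum, Policy.pulls_eq_sum, Fin.sum_univ_castSucc, Policy.hist_succ]
  simp

lemma Policy.pulls_mono (i : Fin K) : Monotone fun t => π.pulls v x t i :=
  monotone_nat_of_le_succ fun t => by rw [Policy.pulls_succ]; omega

lemma Policy.pulls_le (t : ℕ) (i : Fin K) : π.pulls v x t i ≤ t := by
  rw [Policy.pulls]
  exact (Finset.card_filter_le _ _).trans (by simp)

lemma Policy.sum_pulls (t : ℕ) : ∑ i, π.pulls v x t i = t := by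
  induction t with
  | zero => simp [Policy.pulls_zero]
  | succ t ih => simp [Policy.pulls_succ, Finset.sum_add_distrib, ih]

/-- Rewards of an arm are consumed in order, so a sum along the history regroups into initial
segments whose lengths are the pull counts. All dependence on the policy is thereby moved into these
counts. -/
lemma Policy.sum_hist {E : Type*} [AddCommMonoid E] (f : Fin K → ℝ → E) (t : ℕ) :
    ∑ s, f (π.hist v x t s).1 (π.hist v x t s).2
      = ∑ i, ∑ n ∈ Finset.range (π.pulls v x t i), f i (x i n) := by
  induction t with
  | zero => simp [Policy.pulls_zero]
  | succ t ih =>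
    rw [Fin.sum_univ_castSucc, Policy.hist_succ]
    simp only [Fin.snoc_castSucc, Fin.snoc_last]
    rw [ih]
    have h : ∀ i, ∑ n ∈ Finset.range (π.pulls v x (t + 1) i), f i (x i n)
        = ∑ n ∈ Finset.range (π.pulls v x t i), f i (x i n)
          + if π.action v x t = i then f i (x i (π.pulls v x t i)) else 0 := fun i => by
      rw [Policy.pulls_succ]
      split_ifs
      · rw [Finset.sum_range_succ]
      · simp
    simp only [h, Finset.sum_add_distrib]
    simp

lemma Policy.emp_hist {L : Type*} [NormedAddCommGroup L] [NormedSpace ℝ L] (S : FunSpace L)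
    (T : ℕ) : S.emp (fun s : Fin T => (π.hist v x T s).2)
      = S.pool x (fun i => π.pulls v x T i) T := by
  rw [FunSpace.emp, FunSpace.pool, π.sum_hist v x (fun _ r => S.step r)]
  rfl

/-- As long as a reward has not been received, it does not influence the history. -/
lemma Policy.hist_congr {x x' : Fin K → ℕ → ℝ} {i : Fin K} {n : ℕ}
    (h : ∀ j m, (j, m) ≠ (i, n) → x j m = x' j m) (t : ℕ) (hn : π.pulls v x t i ≤ n) :
    π.hist v x t = π.hist v x' t := by
  induction t with
  | zero => rfl
  | succ t ih =>
    have h1 := ih ((π.pulls_mono v x i (Nat.le_succ t)).trans hn)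
    have h2 : π.action v x t = π.action v x' t := by rw [Policy.action, Policy.action, h1]
    have h3 : ∀ j, π.pulls v x t j = π.pulls v x' t j := fun j => by
      rw [Policy.pulls, Policy.pulls, h1]
    rw [Policy.hist_succ, Policy.hist_succ, ← h1, ← h2, ← h3]
    congr 2
    refine h _ _ fun hc => ?_
    rw [Prod.mk.injEq] at hc
    rw [Policy.pulls_succ, if_pos hc.1] at hn
    have := hc.2
    rw [hc.1] at this
    omega

/-- Not having received a reward is an event determined by the randomization and the other rewards,
which makes it independent of that reward. -/
lemma Policy.pulls_le_congr {x x' : Fin K → ℕ → ℝ} {i : Fin K} {n : ℕ}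
    (h : ∀ j m, (j, m) ≠ (i, n) → x j m = x' j m) (t : ℕ) :
    π.pulls v x t i ≤ n ↔ π.pulls v x' t i ≤ n := by
  constructor <;> intro hn
  · rwa [Policy.pulls, ← π.hist_congr v h t hn]
  · rwa [Policy.pulls, ← π.hist_congr v (fun j m hjm => (h j m hjm).symm) t hn]

lemma measurable_eval_discrete :
    Measurable fun p : Fin K × ℕ × (Fin K → ℕ → ℝ) => p.2.2 p.1 p.2.1 := by
  refine measurable_from_prod_countable_right fun i => ?_
  refine measurable_from_prod_countable_right fun n => ?_
  exact (measurable_pi_apply n).comp (measurable_pi_apply i)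

lemma measurable_count (t : ℕ) (i : Fin K) :
    Measurable fun h : Fin t → Fin K × ℝ => (Finset.univ.filter fun s => (h s).1 = i).card := by
  simp only [Finset.card_filter]
  refine Finset.measurable_sum _ fun s _ => Measurable.ite ?_ measurable_const measurable_const
  exact (measurable_fst.comp (measurable_pi_apply s)) (measurableSet_singleton i)

lemma Policy.measurable_hist (t : ℕ) :
    Measurable fun p : 𝕍 × (Fin K → ℕ → ℝ) => π.hist p.1 p.2 t := by
  induction t with
  | zero => exact measurable_pi_iff.2 fun s => s.elim0
  | succ t ih =>
    have hact : Measurable fun p : 𝕍 × (Fin K → ℕ → ℝ) => π.action p.1 p.2 t :=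
      (π.measurable_act t).comp (measurable_fst.prodMk ih)
    have hcnt : Measurable fun p : 𝕍 × (Fin K → ℕ → ℝ) =>
        π.pulls p.1 p.2 t (π.action p.1 p.2 t) := by
      have h1 : Measurable fun p : Fin K × (Fin t → Fin K × ℝ) =>
          (Finset.univ.filter fun s => (p.2 s).1 = p.1).card :=
        measurable_from_prod_countable_right fun i => measurable_count t i
      exact h1.comp (hact.prodMk ih)
    have hrew := measurable_eval_discrete.comp (hact.prodMk (hcnt.prodMk measurable_snd))
    refine measurable_pi_iff.2 fun s => ?_
    simp only [Policy.hist_succ]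
    refine Fin.lastCases ?_ (fun s => ?_) s
    · simp only [Fin.snoc_last]
      exact hact.prodMk hrew
    · simp only [Fin.snoc_castSucc]
      exact (measurable_pi_apply s).comp ih

lemma Policy.measurable_pulls (t : ℕ) (i : Fin K) :
    Measurable fun p : 𝕍 × (Fin K → ℕ → ℝ) => π.pulls p.1 p.2 t i :=
  (measurable_count t i).comp (π.measurable_hist t)

end Policy

/-! ### Independence and a Wald identity -/

section Model

variable {K : ℕ} {𝕍 : Type*} [MeasurableSpace 𝕍] {L : Type*} [NormedAddCommGroup L]
  [NormedSpace ℝ L] {S : FunSpace L} {B : Arms S K} {R : L → ℝ} {Ω : Type*} [MeasurableSpace Ω]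
  {μ : Measure Ω} {V : Ω → 𝕍} {X : Fin K → ℕ → Ω → ℝ}

lemma IsModel.measurable_joint (hM : IsModel B μ V X) :
    Measurable fun ω => (V ω, fun i n => X i n ω) :=
  hM.measurable_V.prodMk
    (measurable_pi_iff.2 fun i => measurable_pi_iff.2 fun n => hM.measurable_X i n)

lemma IsModel.measurable_perf (hM : IsModel B μ V X) (hR : MeasurableEDPM B R) (π : Policy K 𝕍)
    (T : ℕ) : Measurable (perf S R V X π T) := by
  refine (hR.measurable_value T).comp (measurable_pi_iff.2 fun s => ?_)
  exact (measurable_snd.comp ((measurable_pi_apply s).comp (π.measurable_hist T))).comp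
    hM.measurable_joint

/-- The joint law of the first `n` rewards of an arm. -/
lemma IsModel.map_rewards (hM : IsModel B μ V X) (i : Fin K) (n : ℕ) :
    μ.map (fun ω (s : Fin n) => X i s ω) = Measure.pi fun _ : Fin n => B.law i := by
  have := hM.isProb
  have h1 : iIndepFun (fun (s : Fin n) ω => X i s ω) μ :=
    hM.indep_X.precomp (g := fun s : Fin n => (i, (s : ℕ))) fun s s' h => by
      simpa [Fin.ext_iff] using h
  have h2 := iIndepFun.map_fun_eq_pi_map (f := fun (s : Fin n) ω => X i s ω)
    (fun s => (hM.measurable_X i s).aemeasurable) h1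
  rw [h2]
  congr 1
  exact funext fun s => hM.law_X i s

/-- A single reward is independent of the other rewards. -/
lemma IsModel.indep_single (hM : IsModel B μ V X) (c : Fin K × ℕ) :
    IndepFun (X c.1 c.2) (fun ω (c' : {c' // c' ≠ c}) => X c'.1.1 c'.1.2 ω) μ := by
  have h1 := indep_iSup_of_disjoint
    (fun c : Fin K × ℕ => (hM.measurable_X c.1 c.2).comap_le) hM.indep_X.iIndep
    (S := {c}) (T := {c}ᶜ) disjoint_compl_right
  rw [IndepFun_iff_Indep]
  refine indep_of_indep_of_le_left (indep_of_indep_of_le_right h1 ?_) ?_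
  · refine Measurable.comap_le ?_
    refine @measurable_pi_lambda _ _ _ (_) _ _ fun c' => ?_
    refine Measurable.mono (comap_measurable _) ?_ le_rfl
    exact le_iSup₂ (f := fun (c : Fin K × ℕ) (_ : c ∈ ({c' | c' ≠ _} : Set (Fin K × ℕ))) =>
      MeasurableSpace.comap (fun ω => X c.1 c.2 ω) inferInstance) c'.1 c'.2
  · simp

/-- Wald's identity for a single reward: the centred value of a reward has expectation zero on the
event that the reward is received. -/
lemma IsModel.integral_received (hM : IsModel B μ V X) (π : Policy K 𝕍) (T : ℕ) (i : Fin K) (n : ℕ)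
    {f : ℝ → ℝ} (hf : Measurable f) (hfi : Integrable f (B.law i)) (hf0 : ∫ y, f y ∂B.law i = 0) :
    Integrable (fun ω => if n < π.pulls (V ω) (fun i n => X i n ω) T i then f (X i n ω) else 0) μ ∧
    ∫ ω, (if n < π.pulls (V ω) (fun i n => X i n ω) T i then f (X i n ω) else 0) ∂μ = 0 := by
  have hP := hM.isProb
  have hX := hM.measurable_X i n
  have hint : Integrable (fun ω => f (X i n ω)) μ := by
    have h1 := hfi
    rw [← hM.law_X i n] at h1
    exact (integrable_map_measure hf.aestronglyMeasurable hX.aemeasurable).1 h1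
  have hzero : ∫ ω, f (X i n ω) ∂μ = 0 := by
    rw [← hf0, ← hM.law_X i n, integral_map hX.aemeasurable hf.aestronglyMeasurable]
  set U : Ω → Fin K × ℕ → ℝ := fun ω c => X c.1 c.2 ω with hU
  have hUm : Measurable U := measurable_pi_iff.2 fun c => hM.measurable_X c.1 c.2
  have hcurry : Measurable fun u : Fin K × ℕ → ℝ => (fun i n => u (i, n) : Fin K → ℕ → ℝ) :=
    measurable_pi_iff.2 fun i => measurable_pi_iff.2 fun n => measurable_pi_apply (i, n)
  -- The event that the reward is not received is used, since it does not involve `X i n`; the claim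
  -- follows by subtraction from the full centred integral.
  set E : Set (𝕍 × (Fin K × ℕ → ℝ)) := {p | π.pulls p.1 (fun i n => p.2 (i, n)) T i ≤ n} with hE
  have hEm : MeasurableSet E := by
    have h1 : Measurable fun p : 𝕍 × (Fin K × ℕ → ℝ) => π.pulls p.1 (fun i n => p.2 (i, n)) T i :=
      (π.measurable_pulls T i).comp (measurable_fst.prodMk (hcurry.comp measurable_snd))
    exact h1 measurableSet_Iic
  set g : 𝕍 × (Fin K × ℕ → ℝ) → ℝ := E.indicator fun p => f (p.2 (i, n)) with hg
  have hgm : Measurable g :=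
    (hf.comp ((measurable_pi_apply (i, n)).comp measurable_snd)).indicator hEm
  have hpair : Measurable fun ω => (V ω, U ω) := hM.measurable_V.prodMk hUm
  have hgint : Integrable (fun ω => g (V ω, U ω)) μ := by
    refine hint.mono (hgm.comp hpair).aestronglyMeasurable (ae_of_all _ fun ω => ?_)
    exact norm_indicator_le_norm_self _ _
  have hmap : μ.map (fun ω => (V ω, U ω)) = (μ.map V).prod (μ.map U) :=
    (indepFun_iff_map_prod_eq_prod_map_map hM.measurable_V.aemeasurable hUm.aemeasurable).1
      hM.indep_V
  have hPV := Measure.isProbabilityMeasure_map (μ := μ) hM.measurable_V.aemeasurable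
  have hPU := Measure.isProbabilityMeasure_map (μ := μ) hUm.aemeasurable
  have hinner : ∀ v, ∫ u, g (v, u) ∂μ.map U = 0 := by
    intro v
    have hgv : Measurable fun u => g (v, u) := hgm.comp measurable_prodMk_left
    rw [integral_map hUm.aemeasurable hgv.aestronglyMeasurable]
    -- The missing reward is filled in by `0`; by `pulls_le_congr` this does not change the event.
    set ext : ({c' // c' ≠ (i, n)} → ℝ) → Fin K → ℕ → ℝ :=
      fun w j m => if h : (j, m) ≠ (i, n) then w ⟨(j, m), h⟩ else 0 with hext
    have hextm : Measurable ext := by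
      refine measurable_pi_iff.2 fun j => measurable_pi_iff.2 fun m => ?_
      by_cases h : (j, m) ≠ (i, n)
      · simp only [hext, dif_pos h]
        exact measurable_pi_apply _
      · simp only [hext, dif_neg h]
        exact measurable_const
    set e : ({c' // c' ≠ (i, n)} → ℝ) → ℝ :=
      {w | π.pulls v (ext w) T i ≤ n}.indicator fun _ => 1 with he
    have hem : Measurable e := by
      refine measurable_const.indicator ?_
      exact ((π.measurable_pulls T i).comp (measurable_prodMk_left.comp hextm)) measurableSet_Iic
    have hprod : ∀ ω, g (v, U ω)
        = f (X i n ω) * e (fun c' : {c' // c' ≠ (i, n)} => X c'.1.1 c'.1.2 ω) := by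
      intro ω
      have h1 : π.pulls v (fun i n => X i n ω) T i ≤ n ↔
          π.pulls v (ext fun c' : {c' // c' ≠ (i, n)} => X c'.1.1 c'.1.2 ω) T i ≤ n :=
        π.pulls_le_congr v (fun j m hjm => by simp only [hext, dif_pos hjm]) T
      by_cases h : π.pulls v (fun i n => X i n ω) T i ≤ n
      · have h2 := h1.1 h
        rw [hg, he, Set.indicator_of_mem (by exact h), Set.indicator_of_mem (by exact h2), mul_one]
      · have h2 := mt h1.2 h
        rw [hg, he, Set.indicator_of_notMem (by exact h), Set.indicator_of_notMem (by exact h2),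
          mul_zero]
    simp only [hprod]
    have hind := (hM.indep_single (i, n)).comp hf hem
    have := hind.integral_fun_mul_eq_mul_integral
      (hint.aestronglyMeasurable) (hem.comp (measurable_pi_iff.2 fun c' =>
        hM.measurable_X c'.1.1 c'.1.2)).aestronglyMeasurable
    simp only [Function.comp_def] at this
    rw [this, hzero, zero_mul]
  have hg0 : ∫ ω, g (V ω, U ω) ∂μ = 0 := by
    have h1 : ∫ ω, g (V ω, U ω) ∂μ = ∫ p, g p ∂μ.map fun ω => (V ω, U ω) :=
      (integral_map hpair.aemeasurable hgm.aestronglyMeasurable).symm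
    have h2 : Integrable g ((μ.map V).prod (μ.map U)) := by
      rw [← hmap]
      exact (integrable_map_measure hgm.aestronglyMeasurable hpair.aemeasurable).2 hgint
    rw [h1, hmap, integral_prod _ h2]
    simp [hinner]
  have heq : (fun ω => if n < π.pulls (V ω) (fun i n => X i n ω) T i then f (X i n ω) else 0)
      = fun ω => f (X i n ω) - g (V ω, U ω) := by
    funext ω
    by_cases h : π.pulls (V ω) (fun i n => X i n ω) T i ≤ n
    · rw [if_neg (not_lt.2 h), hg, Set.indicator_of_mem (by exact h), sub_self]
    · rw [if_pos (not_le.1 h), hg, Set.indicator_of_notMem (by exact h), sub_zero]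
  rw [heq]
  exact ⟨hint.sub hgint, by rw [integral_sub hint hgint, hzero, hg0, sub_zero]⟩

end Model

/-! ### Exponential and logarithmic moments -/

section Moments

variable {Ω : Type*} [MeasurableSpace Ω] {μ : Measure Ω}

/-- The bound for the exponential moment of a variable with subgaussian tails. -/
noncomputable def expConst : ℝ := 2 * Real.exp (1 / 2) * (1 - Real.exp (-(1 / 2)))⁻¹

lemma exp_neg_half_lt_one : Real.exp (-(1 / 2)) < 1 := by
  simp

lemma two_le_expConst : 2 ≤ expConst := by
  have h1 : 1 ≤ Real.exp (1 / 2) := Real.one_le_exp (by norm_num)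
  have h2 : 1 ≤ (1 - Real.exp (-(1 / 2)))⁻¹ := by
    rw [one_le_inv₀ (by linarith [exp_neg_half_lt_one])]
    linarith [Real.exp_pos (-(1 / 2))]
  unfold expConst
  nlinarith

/-- Slicing by the integer part `k` of `N ^ 2`, the integrand is at most `exp ((k + 1) / 2)` on an
event of probability at most `2 * exp (-k)`; the result is a geometric series of ratio `exp (-1 /
2)`. -/
lemma lintegral_exp_sq_le [IsProbabilityMeasure μ] {N : Ω → ℝ} (hN : Measurable N)
    (hN0 : ∀ ω, 0 ≤ N ω)
    (htail : ∀ y : ℝ, 0 < y → μ.real {ω | y ≤ N ω} ≤ 2 * Real.exp (-y ^ 2)) :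
    ∫⁻ ω, ENNReal.ofReal (Real.exp (N ω ^ 2 / 2)) ∂μ ≤ ENNReal.ofReal expConst := by
  set s : ℕ → Set Ω := fun k => {ω | Real.sqrt k ≤ N ω} with hs
  have hsm : ∀ k, MeasurableSet (s k) := fun k => measurableSet_le measurable_const hN
  have hpt : ∀ ω, ENNReal.ofReal (Real.exp (N ω ^ 2 / 2)) ≤
      ∑' k : ℕ, (s k).indicator (fun _ => ENNReal.ofReal (Real.exp (((k : ℝ) + 1) / 2))) ω := by
    intro ω
    refine le_trans ?_ (ENNReal.le_tsum ⌊N ω ^ 2⌋₊)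
    have hmem : ω ∈ s ⌊N ω ^ 2⌋₊ :=
      Real.sqrt_le_iff.2 ⟨hN0 ω, Nat.floor_le (sq_nonneg _)⟩
    rw [Set.indicator_of_mem hmem]
    apply ENNReal.ofReal_le_ofReal
    apply Real.exp_le_exp.2
    linarith [Nat.lt_floor_add_one (N ω ^ 2)]
  have hprob : ∀ k : ℕ, μ (s k) ≤ ENNReal.ofReal (2 * Real.exp (-(k : ℝ))) := by
    intro k
    rw [← ofReal_measureReal]
    apply ENNReal.ofReal_le_ofReal
    rcases Nat.eq_zero_or_pos k with rfl | hk
    · simp only [Nat.cast_zero, neg_zero, Real.exp_zero]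
      linarith [measureReal_le_one (μ := μ) (s := s 0)]
    · have h1 : (0 : ℝ) < k := by exact_mod_cast hk
      have := htail (Real.sqrt k) (Real.sqrt_pos.2 h1)
      rwa [Real.sq_sqrt h1.le] at this
  calc ∫⁻ ω, ENNReal.ofReal (Real.exp (N ω ^ 2 / 2)) ∂μ
      ≤ ∫⁻ ω, ∑' k : ℕ, (s k).indicator
          (fun _ => ENNReal.ofReal (Real.exp (((k : ℝ) + 1) / 2))) ω ∂μ := lintegral_mono hpt
    _ = ∑' k : ℕ, ENNReal.ofReal (Real.exp (((k : ℝ) + 1) / 2)) * μ (s k) := by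
        rw [lintegral_tsum fun k => (measurable_const.indicator (hsm k)).aemeasurable]
        exact tsum_congr fun k => lintegral_indicator_const (hsm k) _
    _ ≤ ∑' k : ℕ, ENNReal.ofReal (2 * Real.exp (1 / 2) * Real.exp (-(1 / 2)) ^ k) := by
        refine ENNReal.tsum_le_tsum fun k => ?_
        refine (mul_le_mul_right (hprob k) _).trans ?_
        rw [← ENNReal.ofReal_mul (Real.exp_pos _).le]
        apply ENNReal.ofReal_le_ofReal
        apply le_of_eq
        rw [← Real.exp_nat_mul, mul_left_comm, ← Real.exp_add, mul_assoc, ← Real.exp_add]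
        congr 2; ring
    _ = ENNReal.ofReal expConst := by
        have hg := summable_geometric_of_lt_one (Real.exp_pos (-(1 / 2))).le exp_neg_half_lt_one
        rw [← ENNReal.ofReal_tsum_of_nonneg (fun k => by positivity) (hg.mul_left _), tsum_mul_left,
          tsum_geometric_of_lt_one (Real.exp_pos _).le exp_neg_half_lt_one, expConst]

lemma rpow_le_exp_half {y p : ℝ} (hy : 0 ≤ y) (hp : 0 < p) :
    y ^ p ≤ (2 * p) ^ p * Real.exp (y / 2) := by
  have h1 : y / (2 * p) ≤ Real.exp (y / (2 * p)) := by
    linarith [Real.add_one_le_exp (y / (2 * p))]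
  have h2 := Real.rpow_le_rpow (by positivity) h1 hp.le
  rw [← Real.exp_mul, Real.div_rpow hy (by positivity), div_le_iff₀ (by positivity)] at h2
  have h3 : y / (2 * p) * p = y / 2 := by field_simp
  rw [h3] at h2
  linarith

/-- Moments of the logarithm of a variable with a bound for its expectation. -/
lemma integral_log_rpow_le [IsProbabilityMeasure μ] {M : Ω → ℝ} (hM : Measurable M)
    (hM1 : ∀ ω, 1 ≤ M ω) {b : ℝ} (hb : 1 ≤ b)
    (hMb : ∫⁻ ω, ENNReal.ofReal (M ω) ∂μ ≤ ENNReal.ofReal b) {p : ℝ} (hp : 0 < p) :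
    Integrable (fun ω => Real.log (M ω) ^ p) μ ∧
    ∫ ω, Real.log (M ω) ^ p ∂μ ≤ (2 * Real.log b) ^ p + (2 * p) ^ p := by
  have hlb := Real.log_nonneg hb
  have hb0 : 0 < b := by linarith
  have hMi : Integrable M μ := by
    refine ⟨hM.aestronglyMeasurable, ?_⟩
    rw [hasFiniteIntegral_iff_ofReal (ae_of_all _ fun ω => zero_le_one.trans (hM1 ω))]
    exact hMb.trans_lt ENNReal.ofReal_lt_top
  have hMI : ∫ ω, M ω ∂μ ≤ b := by
    rw [integral_eq_lintegral_of_nonneg_ae (ae_of_all _ fun ω => by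
      simpa using zero_le_one.trans (hM1 ω)) hM.aestronglyMeasurable]
    exact ENNReal.toReal_le_of_le_ofReal hb0.le hMb
  have hpt : ∀ ω, Real.log (M ω) ^ p ≤ (2 * Real.log b) ^ p + (2 * p) ^ p / b * M ω := by
    intro ω
    have hM0 : 0 < M ω := by linarith [hM1 ω]
    have hl := Real.log_nonneg (hM1 ω)
    -- Above the threshold `exp (log M / 2) ≤ M / b`, and `M / b` has mean at most one.
    rcases le_or_gt (Real.log (M ω)) (2 * Real.log b) with h | h
    · have := Real.rpow_le_rpow hl h hp.le
      have h2 : 0 ≤ (2 * p) ^ p / b * M ω := by positivity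
      linarith
    · have h1 := rpow_le_exp_half hl hp
      have h2 : Real.exp (Real.log (M ω) / 2) ≤ M ω / b := by
        rw [le_div_iff₀ hb0]
        calc Real.exp (Real.log (M ω) / 2) * b
            = Real.exp (Real.log (M ω) / 2 + Real.log b) := by rw [Real.exp_add, Real.exp_log hb0]
          _ ≤ Real.exp (Real.log (M ω)) := Real.exp_le_exp.2 (by linarith)
          _ = M ω := Real.exp_log hM0
      have h3 := mul_le_mul_of_nonneg_left h2 (by positivity : 0 ≤ (2 * p) ^ p)
      have h4 : 0 ≤ (2 * Real.log b) ^ p := by positivity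
      have h5 : (2 * p) ^ p / b * M ω = (2 * p) ^ p * (M ω / b) := by ring
      linarith
  have hdom : Integrable (fun ω => (2 * Real.log b) ^ p + (2 * p) ^ p / b * M ω) μ :=
    (integrable_const _).add (hMi.const_mul _)
  have hint : Integrable (fun ω => Real.log (M ω) ^ p) μ := by
    refine hdom.mono' ((Real.measurable_log.comp hM).pow_const p).aestronglyMeasurable
      (ae_of_all _ fun ω => ?_)
    rw [Real.norm_of_nonneg (Real.rpow_nonneg (Real.log_nonneg (hM1 ω)) p)]
    exact hpt ω
  refine ⟨hint, (integral_mono hint hdom hpt).trans ?_⟩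
  rw [integral_add (integrable_const _) (hMi.const_mul _), integral_const_mul]
  simp only [integral_const, probReal_univ, smul_eq_mul, one_mul]
  have h1 : (2 * p) ^ p / b * ∫ ω, M ω ∂μ ≤ (2 * p) ^ p / b * b :=
    mul_le_mul_of_nonneg_left hMI (by positivity)
  rw [div_mul_cancel₀ _ hb0.ne'] at h1
  linarith

end Moments

/-! ### Uniform deviation bound up to the horizon -/

section Deviation

variable {K : ℕ} {𝕍 : Type*} [MeasurableSpace 𝕍] {L : Type*} [NormedAddCommGroup L]
  [NormedSpace ℝ L] {S : FunSpace L} {B : Arms S K} {R : L → ℝ} {Ω : Type*} [MeasurableSpace Ω]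
  {μ : Measure Ω} {V : Ω → 𝕍} {X : Fin K → ℕ → Ω → ℝ} {a b q : ℝ}

/-- The distance of the empirical distribution function of the first `n` rewards of arm `i` from
the distribution function of the arm. -/
noncomputable def Arms.dev (B : Arms S K) (X : Fin K → ℕ → Ω → ℝ) (i : Fin K) (n : ℕ) (ω : Ω) : ℝ :=
  ‖S.emp (fun s : Fin n => X i s ω) - B.F i‖

lemma IsModel.measurable_rewards (hM : IsModel B μ V X) (i : Fin K) (n : ℕ) :
    Measurable fun ω (s : Fin n) => X i s ω :=
  measurable_pi_iff.2 fun s => hM.measurable_X i s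

lemma IsModel.measurable_dev (hM : IsModel B μ V X) (hR : MeasurableEDPM B R) (i : Fin K) (n : ℕ) :
    Measurable (B.dev X i n) :=
  (hR.measurable_dist n i).comp (hM.measurable_rewards i n)

lemma IsModel.dev_tail (hM : IsModel B μ V X) (hR : MeasurableEDPM B R)
    (hst : StronglyStable B R a b q) (i : Fin K) {n : ℕ} (hn : 1 ≤ n) {y : ℝ} (hy : 0 < y) :
    μ.real {ω | y ≤ B.dev X i n ω} ≤ 2 * Real.exp (-(a * n * y ^ 2)) := by
  refine le_trans (le_of_eq ?_) (hst.concentration i y hy n hn)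
  rw [← hM.map_rewards i n, measureReal_def, measureReal_def,
    Measure.map_apply (hM.measurable_rewards i n)
      (measurableSet_le measurable_const (hR.measurable_dist n i))]
  rfl

lemma IsModel.lintegral_exp_dev_le (hM : IsModel B μ V X) (hR : MeasurableEDPM B R)
    (hst : StronglyStable B R a b q) (i : Fin K) {n : ℕ} (hn : 1 ≤ n) :
    ∫⁻ ω, ENNReal.ofReal (Real.exp ((Real.sqrt (a * n) * B.dev X i n ω) ^ 2 / 2)) ∂μ
      ≤ ENNReal.ofReal expConst := by
  have := hM.isProb
  have ha := hst.a_pos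
  have hn0 : (0 : ℝ) < n := by positivity
  have hsq : 0 < Real.sqrt (a * n) := by positivity
  refine lintegral_exp_sq_le ((hM.measurable_dev hR i n).const_mul _)
    (fun ω => mul_nonneg hsq.le (norm_nonneg _)) fun y hy => ?_
  have := hM.dev_tail hR hst i hn (y := y / Real.sqrt (a * n)) (by positivity)
  rw [div_pow, Real.sq_sqrt (by positivity), mul_div_cancel₀ _ (by positivity)] at this
  simp only [div_le_iff₀' hsq] at this
  exact this

/-- The inequality `y ≤ exp (y ^ 2 / 2)` reduces the mean deviation to the exponential moment. -/
lemma IsModel.integral_dev_le (hM : IsModel B μ V X) (hR : MeasurableEDPM B R)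
    (hst : StronglyStable B R a b q) (i : Fin K) {n : ℕ} (hn : 1 ≤ n) :
    Integrable (B.dev X i n) μ ∧
      ∫ ω, B.dev X i n ω ∂μ ≤ expConst * (Real.sqrt (a * n))⁻¹ := by
  have ha := hst.a_pos
  have hn0 : (0 : ℝ) < n := by positivity
  have hsq : 0 < Real.sqrt (a * n) := by positivity
  have hm := hM.measurable_dev hR i n
  have hd0 : ∀ ω, 0 ≤ B.dev X i n ω := fun ω => norm_nonneg _
  have h1 : ∫⁻ ω, ENNReal.ofReal (Real.sqrt (a * n) * B.dev X i n ω) ∂μ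
      ≤ ENNReal.ofReal expConst := by
    refine (lintegral_mono fun ω => ENNReal.ofReal_le_ofReal ?_).trans
      (hM.lintegral_exp_dev_le hR hst i hn)
    have := Real.add_one_le_exp ((Real.sqrt (a * n) * B.dev X i n ω) ^ 2 / 2)
    nlinarith [sq_nonneg (Real.sqrt (a * n) * B.dev X i n ω - 1)]
  have hint : Integrable (fun ω => Real.sqrt (a * n) * B.dev X i n ω) μ := by
    refine ⟨(hm.const_mul _).aestronglyMeasurable, ?_⟩
    rw [hasFiniteIntegral_iff_ofReal (ae_of_all _ fun ω => mul_nonneg hsq.le (hd0 ω))]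
    exact h1.trans_lt ENNReal.ofReal_lt_top
  have h2 : ∫ ω, Real.sqrt (a * n) * B.dev X i n ω ∂μ ≤ expConst := by
    rw [integral_eq_lintegral_of_nonneg_ae (ae_of_all _ fun ω => mul_nonneg hsq.le (hd0 ω))
      (hm.const_mul _).aestronglyMeasurable]
    exact ENNReal.toReal_le_of_le_ofReal (by linarith [two_le_expConst]) h1
  constructor
  · refine (hint.const_mul (Real.sqrt (a * n))⁻¹).congr (ae_of_all _ fun ω => ?_)
    exact inv_mul_cancel_left₀ hsq.ne' _
  · rw [integral_const_mul] at h2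
    rw [← div_eq_mul_inv, le_div_iff₀ hsq]
    linarith

lemma mul_dev_eq {Ω : Type*} {X : Fin K → ℕ → Ω → ℝ} (i : Fin K) {n : ℕ} (ω : Ω) :
    ‖S.esum (fun n => X i n ω) n - (n : ℝ) • B.F i‖ = n * B.dev X i n ω := by
  rcases Nat.eq_zero_or_pos n with rfl | hn
  · simp [FunSpace.esum]
  · have hn0 : (0 : ℝ) < n := by exact_mod_cast hn
    rw [Arms.dev, S.emp_eq_esum fun n => X i n ω, ← norm_smul_of_nonneg hn0.le, smul_sub, smul_smul,
      mul_inv_cancel₀ hn0.ne', one_smul]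

/-- The constant in the moment bounds. -/
noncomputable def momConst (a r : ℝ) : ℝ :=
  (2 / a) ^ (r / 2) *
    ((2 * Real.log expConst / Real.log 2 + 2) ^ (r / 2) + (r / Real.log 2) ^ (r / 2))

/-- A common bound for the deviations of all empirical distribution functions up to the horizon,
with bounds for its moments. -/
lemma IsModel.exists_deviation (hM : IsModel B μ V X) (hR : MeasurableEDPM B R)
    (hst : StronglyStable B R a b q) (hK : 1 ≤ K) {T : ℕ} (hT : 1 ≤ T) :
    ∃ z : Ω → ℝ, (∀ ω, 0 ≤ z ω) ∧
      (∀ ω i s, s ≤ T → ‖S.esum (fun n => X i n ω) s - (s : ℝ) • B.F i‖ ≤ T * z ω) ∧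
      (∀ r : ℝ, 0 < r → Integrable (fun ω => (K * z ω) ^ r) μ) ∧
      (2 ≤ K → ∀ r : ℝ, 0 < r → ∫ ω, (K * z ω) ^ r ∂μ
        ≤ momConst a r * ((K : ℝ) ^ 2 * Real.log (K * T) / T) ^ (r / 2)) := by
  have := hM.isProb
  have ha := hst.a_pos
  have hT0 : (0 : ℝ) < T := by positivity
  have hK0 : (0 : ℝ) < K := by positivity
  have hT1 : (1 : ℝ) ≤ T := by exact_mod_cast hT
  have hK1 : (1 : ℝ) ≤ K := by exact_mod_cast hK
  have hc := two_le_expConst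
  set e : Fin K → ℕ → Ω → ℝ := fun i n ω =>
    Real.exp ((Real.sqrt (a * n) * B.dev X i n ω) ^ 2 / 2) with he
  have hem : ∀ i n, Measurable (e i n) := fun i n =>
    Real.measurable_exp.comp ((((hM.measurable_dev hR i n).const_mul _).pow_const 2).div_const 2)
  -- All sample sizes are summed because pull counts are random and depend on the rewards. The mean
  -- is at most `expConst * (K * T)`, the origin of `log (K * T)`.
  set M : Ω → ℝ := fun ω => ∑ i, ∑ n ∈ Finset.Icc 1 T, e i n ω with hMdef
  have hMm : Measurable M :=
    Finset.measurable_sum _ fun i _ => Finset.measurable_sum _ fun n _ => hem i n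
  have heM : ∀ i n ω, 1 ≤ n → n ≤ T → e i n ω ≤ M ω := fun i n ω h1 h2 => by
    refine le_trans ?_ (Finset.single_le_sum (f := fun i => ∑ n ∈ Finset.Icc 1 T, e i n ω)
      (fun j _ => Finset.sum_nonneg fun m _ => (Real.exp_pos _).le) (Finset.mem_univ i))
    exact Finset.single_le_sum (f := fun n => e i n ω) (fun m _ => (Real.exp_pos _).le)
      (Finset.mem_Icc.2 ⟨h1, h2⟩)
  have hM1 : ∀ ω, 1 ≤ M ω := fun ω =>
    (Real.one_le_exp (by positivity)).trans (heM ⟨0, hK⟩ 1 ω le_rfl hT)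
  set b' : ℝ := expConst * (K * T) with hb'
  have hKT : 1 ≤ (K : ℝ) * T := one_le_mul_of_one_le_of_one_le hK1 hT1
  have hb1 : 1 ≤ b' := by nlinarith
  have hMb : ∫⁻ ω, ENNReal.ofReal (M ω) ∂μ ≤ ENNReal.ofReal b' := by
    have h1 : ∀ ω, ENNReal.ofReal (M ω)
        = ∑ i, ∑ n ∈ Finset.Icc 1 T, ENNReal.ofReal (e i n ω) := fun ω => by
      rw [hMdef]
      simp only
      rw [ENNReal.ofReal_sum_of_nonneg fun i _ => Finset.sum_nonneg fun m _ => (Real.exp_pos _).le]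
      exact Finset.sum_congr rfl fun i _ =>
        ENNReal.ofReal_sum_of_nonneg fun m _ => (Real.exp_pos _).le
    simp only [h1]
    rw [lintegral_finsetSum _ fun i _ => Finset.measurable_sum _ fun n _ => (hem i n).ennreal_ofReal]
    have h2 : ∀ i : Fin K, ∫⁻ ω, ∑ n ∈ Finset.Icc 1 T, ENNReal.ofReal (e i n ω) ∂μ
        ≤ ∑ _n ∈ Finset.Icc 1 T, ENNReal.ofReal expConst := fun i => by
      rw [lintegral_finsetSum _ fun n _ => (hem i n).ennreal_ofReal]
      exact Finset.sum_le_sum fun n hn =>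
        hM.lintegral_exp_dev_le hR hst i (Finset.mem_Icc.1 hn).1
    refine (Finset.sum_le_sum fun i _ => h2 i).trans (le_of_eq ?_)
    simp only [Finset.sum_const, Nat.card_Icc, Finset.card_univ, Fintype.card_fin, nsmul_eq_mul,
      Nat.add_sub_cancel]
    rw [hb', ENNReal.ofReal_mul (by linarith), ENNReal.ofReal_mul hK0.le, ENNReal.ofReal_natCast,
      ENNReal.ofReal_natCast]
    ring
  set z : Ω → ℝ := fun ω => Real.sqrt (2 * Real.log (M ω) / (a * T)) with hz
  have hz0 : ∀ ω, 0 ≤ z ω := fun ω => Real.sqrt_nonneg _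
  have hl0 : ∀ ω, 0 ≤ Real.log (M ω) := fun ω => Real.log_nonneg (hM1 ω)
  have hzr : ∀ (r : ℝ) ω, (K * z ω) ^ r
      = (K : ℝ) ^ r * (2 / (a * T)) ^ (r / 2) * Real.log (M ω) ^ (r / 2) := fun r ω => by
    have h1 : 2 * Real.log (M ω) / (a * T) = 2 / (a * T) * Real.log (M ω) := by ring
    rw [Real.mul_rpow hK0.le (hz0 ω), hz]
    simp only
    rw [Real.sqrt_eq_rpow, ← Real.rpow_mul (by have := hl0 ω; positivity), h1,
      Real.mul_rpow (by positivity) (hl0 ω), mul_assoc]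
    congr 3 <;> ring
  refine ⟨z, hz0, fun ω i s hs => ?_, fun r hr => ?_, fun hK2 r hr => ?_⟩
  · rw [mul_dev_eq]
    rcases Nat.eq_zero_or_pos s with rfl | hs1
    · simpa using mul_nonneg hT0.le (hz0 ω)
    have hs0 : (0 : ℝ) < s := by exact_mod_cast hs1
    have hsT : (s : ℝ) ≤ T := by exact_mod_cast hs
    have h1 : (Real.sqrt (a * s) * B.dev X i s ω) ^ 2 / 2 ≤ Real.log (M ω) := by
      rw [Real.le_log_iff_exp_le (by linarith [hM1 ω])]
      exact heM i s ω hs1 hs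
    rw [mul_pow, Real.sq_sqrt (by positivity)] at h1
    have h2 : s * B.dev X i s ω / T ≤ z ω := by
      refine Real.le_sqrt_of_sq_le ?_
      rw [div_pow, div_le_div_iff₀ (by positivity) (by positivity)]
      have h3 : a * (s : ℝ) ^ 2 * B.dev X i s ω ^ 2 ≤ T * (2 * Real.log (M ω)) := by
        calc a * (s : ℝ) ^ 2 * B.dev X i s ω ^ 2 = s * (a * s * B.dev X i s ω ^ 2) := by ring
          _ ≤ T * (2 * Real.log (M ω)) :=
            mul_le_mul hsT (by linarith) (by positivity) hT0.le
      have h4 := mul_le_mul_of_nonneg_right h3 hT0.le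
      linarith
    rw [div_le_iff₀ hT0] at h2
    linarith
  · simp only [hzr]
    exact (integral_log_rpow_le hMm hM1 hb1 hMb (half_pos hr)).1.const_mul _
  · have hp : 0 < r / 2 := half_pos hr
    simp only [hzr]
    rw [integral_const_mul]
    have h1 := (integral_log_rpow_le hMm hM1 hb1 hMb hp).2
    set l := Real.log (K * T) with hl
    -- Only here is `K ≥ 2` needed: it keeps `l` away from zero, so that additive constants become
    -- multiples of `l`.
    have hl2 : Real.log 2 ≤ l := by
      have : (2 : ℝ) ≤ K := by exact_mod_cast hK2
      exact Real.log_le_log (by norm_num) (by nlinarith)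
    have hlog2 : 0 < Real.log 2 := Real.log_pos (by norm_num)
    have hlp : 0 < l := hlog2.trans_le hl2
    have hce : 0 ≤ Real.log expConst := Real.log_nonneg (by linarith)
    have h2 : 2 * Real.log b' ≤ (2 * Real.log expConst / Real.log 2 + 2) * l := by
      rw [hb', Real.log_mul (by positivity) (by positivity), ← hl]
      have : 2 * Real.log expConst ≤ 2 * Real.log expConst / Real.log 2 * l := by
        rw [div_mul_eq_mul_div, le_div_iff₀ hlog2]
        exact mul_le_mul_of_nonneg_left hl2 (by positivity)
      linarith
    have h3 : 2 * (r / 2) ≤ r / Real.log 2 * l := by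
      rw [div_mul_eq_mul_div, le_div_iff₀ hlog2]
      nlinarith
    have h4 : (2 * Real.log b') ^ (r / 2)
        ≤ (2 * Real.log expConst / Real.log 2 + 2) ^ (r / 2) * l ^ (r / 2) := by
      rw [← Real.mul_rpow (by positivity) hlp.le]
      exact Real.rpow_le_rpow (by have := Real.log_nonneg hb1; positivity) h2 hp.le
    have h5 : (2 * (r / 2)) ^ (r / 2) ≤ (r / Real.log 2) ^ (r / 2) * l ^ (r / 2) := by
      rw [← Real.mul_rpow (by positivity) hlp.le]
      exact Real.rpow_le_rpow (by positivity) h3 hp.le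
    have h6 : ((K : ℝ) ^ 2 * l / T) ^ (r / 2)
        = (K : ℝ) ^ r * (1 / T) ^ (r / 2) * l ^ (r / 2) := by
      have : (K : ℝ) ^ 2 * l / T = (K : ℝ) ^ (2 : ℝ) * (1 / T) * l := by
        rw [Real.rpow_two]; ring
      rw [this, Real.mul_rpow (by positivity) hlp.le, Real.mul_rpow (by positivity) (by positivity),
        ← Real.rpow_mul hK0.le]
      congr 3; ring
    have h7 : (2 / (a * T)) ^ (r / 2) = (2 / a) ^ (r / 2) * (1 / T) ^ (r / 2) := by
      rw [← Real.mul_rpow (by positivity) (by positivity)]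
      congr 1; field_simp
    rw [h6, h7, momConst]
    calc (K : ℝ) ^ r * ((2 / a) ^ (r / 2) * (1 / T) ^ (r / 2)) * ∫ ω, Real.log (M ω) ^ (r / 2) ∂μ
        ≤ (K : ℝ) ^ r * ((2 / a) ^ (r / 2) * (1 / T) ^ (r / 2)) *
          ((2 * Real.log expConst / Real.log 2 + 2) ^ (r / 2) * l ^ (r / 2)
            + (r / Real.log 2) ^ (r / 2) * l ^ (r / 2)) := by
          refine mul_le_mul_of_nonneg_left ?_ (by positivity)
          linarith
      _ = _ := by ring

end Deviation

/-! ### The linear term: measurability, centring and fluctuations -/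

section Linear

variable {K : ℕ} {𝕍 : Type*} [MeasurableSpace 𝕍] {L : Type*} [NormedAddCommGroup L]
  [NormedSpace ℝ L] {S : FunSpace L} {B : Arms S K} {R : L → ℝ} {Ω : Type*} [MeasurableSpace Ω]
  {μ : Measure Ω} {V : Ω → 𝕍} {X : Fin K → ℕ → Ω → ℝ} {a b q δ D d₁ d₂ M₀ : ℝ} {k : Fin K}
  {A : L →L[ℝ] ℝ}

lemma FunSpace.emp_append_const (S : FunSpace L) {m : ℕ} (hm : 1 ≤ m) (y : Fin (m ^ 2) → ℝ)
    (x : ℝ) : S.emp (Fin.append y fun _ : Fin m => x)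
      = ((m : ℝ) / (m + 1)) • S.emp y + ((1 : ℝ) / (m + 1)) • S.step x := by
  have hm0 : (m : ℝ) ≠ 0 := by positivity
  have hm1 : (m : ℝ) + 1 ≠ 0 := by positivity
  have h2 : ((m ^ 2 + m : ℕ) : ℝ) = m * (m + 1) := by push_cast; ring
  simp only [FunSpace.emp, Fin.sum_univ_add, Fin.append_left, Fin.append_right, Finset.sum_const,
    Finset.card_univ, Fintype.card_fin]
  rw [← Nat.cast_smul_eq_nsmul ℝ, smul_add, smul_smul, smul_smul, h2]
  congr 2
  · push_cast; field_simp
  · field_simp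

/-- The linear term is measurable at step functions: it is a limit of difference quotients of the
performance measure at empirical distribution functions. -/
lemma SmoothAt.measurable_map_step (H : Landscape B R a b q δ D k)
    (A' : SmoothAt B R d₁ d₂ M₀ k A) (hR : MeasurableEDPM B R) :
    Measurable fun x => A (S.step x - B.F k) := by
  have ha := H.stable.a_pos
  choose y hy using fun n : ℕ => H.stable.exists_emp_near k (n := (n + 1) ^ 2)
    (Nat.one_le_pow _ _ (Nat.succ_pos n))
  -- A sample of size `m ^ 2`, `m = n + 1`, approximates `B.F k` to order `1 / m`, the same order as
  -- the weight of the `m` added copies of `x`. The quadratic error is `O(m⁻²)` and disappears after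
  -- multiplication by `m + 1`.
  set G : ℕ → ℝ → L := fun n x => S.emp (Fin.append (y n) fun _ : Fin (n + 1) => x) with hG
  have hGm : ∀ n, Measurable fun x => R (G n x) := fun n => by
    refine (hR.measurable_value ((n + 1) ^ 2 + (n + 1))).comp (measurable_pi_iff.2 fun s => ?_)
    refine Fin.addCases (fun s => ?_) (fun s => ?_) s
    · simp only [Fin.append_left]; exact measurable_const
    · simp only [Fin.append_right]; exact measurable_id
  refine measurable_of_tendsto_metrizable (f := fun (n : ℕ) x =>
    ((n : ℝ) + 2) * (R (G n x) - R (B.F k)) - ((n : ℝ) + 1) * A (S.emp (y n) - B.F k))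
    (fun n => (((hGm n).sub_const _).const_mul _).sub_const _) ?_
  rw [tendsto_pi_nhds]
  intro x
  set w := (Real.sqrt a)⁻¹ + ‖S.step x - B.F k‖ with hw
  have hw0 : 0 ≤ w := by positivity
  have hc := smoothConst_nonneg H A'
  rw [tendsto_iff_norm_sub_tendsto_zero]
  have hlim : Tendsto (fun n : ℕ => smoothConst b d₁ d₂ M₀ * quadErr q w * (1 / ((n : ℝ) + 1)))
      atTop (nhds 0) := by
    have h1 := (tendsto_one_div_add_atTop_nhds_zero_nat (𝕜 := ℝ)).const_mul
      (smoothConst b d₁ d₂ M₀ * quadErr q w)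
    rwa [mul_zero] at h1
  refine squeeze_zero (fun _ => norm_nonneg _) (fun n => ?_) hlim
  have hn2 : (0 : ℝ) < n + 2 := by positivity
  have hn1 : (0 : ℝ) < n + 1 := by positivity
  have hGe : G n x - B.F k = ((n : ℝ) + 2)⁻¹ • (((n : ℝ) + 1) • (S.emp (y n) - B.F k)
      + (S.step x - B.F k)) := by
    simp only [hG]
    rw [S.emp_append_const (Nat.succ_le_succ (Nat.zero_le n))]
    push_cast
    have h1 : (n : ℝ) + 1 + 1 = n + 2 := by ring
    have h2 : B.F k = ((n : ℝ) + 2)⁻¹ • (((n : ℝ) + 1) • B.F k + B.F k) := by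
      have h3 : ((n : ℝ) + 1) • B.F k + B.F k = ((n : ℝ) + 2) • B.F k := by
        rw [← h1, add_smul ((n : ℝ) + 1) 1, one_smul]
      rw [h3, smul_smul, inv_mul_cancel₀ hn2.ne', one_smul]
    nth_rewrite 1 [h2]
    rw [h1, div_eq_inv_mul, div_eq_inv_mul, mul_one, ← smul_smul, ← smul_add, ← smul_sub]
    congr 1
    rw [smul_sub]; abel
  have hGn : ‖G n x - B.F k‖ ≤ w * ((n : ℝ) + 2)⁻¹ := by
    rw [hGe, norm_smul, norm_inv, Real.norm_of_nonneg hn2.le, mul_comm]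
    refine mul_le_mul_of_nonneg_right ((norm_add_le _ _).trans ?_) (by positivity)
    rw [norm_smul, Real.norm_of_nonneg hn1.le]
    have h1 := hy n
    push_cast at h1
    rw [Real.sqrt_mul ha.le, Real.sqrt_sq hn1.le, mul_inv] at h1
    have h2 := mul_le_mul_of_nonneg_left h1 hn1.le
    rw [mul_left_comm, mul_inv_cancel₀ hn1.ne', mul_one] at h2
    linarith
  have hmem : G n x ∈ S.empSet := ⟨(n + 1) ^ 2 + (n + 1), by omega, _, rfl⟩
  have h1 := A'.abs_sub_le H hmem
  have ht1 : ((n : ℝ) + 2)⁻¹ ≤ 1 := inv_le_one_of_one_le₀ (by linarith)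
  have h2 := (quadErr_mono H.q_pos (norm_nonneg _) hGn).trans
    (quadErr_mul_le_sq H.q_pos hw0 (by positivity) ht1)
  have h3 : ((n : ℝ) + 2) * (R (G n x) - R (B.F k)) - (n + 1) * A (S.emp (y n) - B.F k)
      - A (S.step x - B.F k)
      = ((n : ℝ) + 2) * (R (G n x) - R (B.F k) - A (G n x - B.F k)) := by
    have h4 : ((n : ℝ) + 2) * A (G n x - B.F k)
        = (n + 1) * A (S.emp (y n) - B.F k) + A (S.step x - B.F k) := by
      rw [hGe, map_smul, map_add, map_smul, smul_eq_mul, smul_eq_mul, mul_inv_cancel_left₀ hn2.ne']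
    rw [mul_sub _ (R (G n x) - R (B.F k)), h4]; ring
  rw [h3, norm_mul, Real.norm_of_nonneg hn2.le, Real.norm_eq_abs]
  have hQ := quadErr_nonneg (q := q) hw0
  calc ((n : ℝ) + 2) * |R (G n x) - R (B.F k) - A (G n x - B.F k)|
      ≤ (n + 2) * (smoothConst b d₁ d₂ M₀ * (quadErr q w * ((n : ℝ) + 2)⁻¹ ^ 2)) :=
        mul_le_mul_of_nonneg_left (h1.trans (mul_le_mul_of_nonneg_left h2 hc)) hn2.le
    _ = smoothConst b d₁ d₂ M₀ * quadErr q w * ((n : ℝ) + 2)⁻¹ := by field_simp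
    _ ≤ smoothConst b d₁ d₂ M₀ * quadErr q w * (1 / ((n : ℝ) + 1)) := by
        refine mul_le_mul_of_nonneg_left ?_ (by positivity)
        rw [one_div]
        exact inv_anti₀ hn1 (by linarith)

lemma IsModel.integrable_map_step (hM : IsModel B μ V X) (hR : MeasurableEDPM B R)
    (hst : StronglyStable B R a b q) (i : Fin K) (hA : Measurable fun x => A (S.step x - B.F i)) :
    Integrable (fun x => A (S.step x - B.F i)) (B.law i) := by
  rw [← hM.law_X i 0]
  refine (integrable_map_measure hA.aestronglyMeasurable (hM.measurable_X i 0).aemeasurable).2 ?_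
  refine ((hM.integral_dev_le hR hst i le_rfl).1.const_mul ‖A‖).mono'
    (hA.comp (hM.measurable_X i 0)).aestronglyMeasurable (ae_of_all _ fun ω => ?_)
  have h1 : B.dev X i 1 ω = ‖S.step (X i 0 ω) - B.F i‖ := by simp [Arms.dev, FunSpace.emp]
  rw [h1]
  exact A.le_opNorm _

/-- By concentration, the linear term is centred at the distribution function of an arm. -/
lemma IsModel.integral_map_step (hM : IsModel B μ V X) (hR : MeasurableEDPM B R)
    (hst : StronglyStable B R a b q) (i : Fin K) (hA : Measurable fun x => A (S.step x - B.F i)) :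
    ∫ x, A (S.step x - B.F i) ∂B.law i = 0 := by
  have ha := hst.a_pos
  have hfi := hM.integrable_map_step hR hst i hA
  set c := ∫ x, A (S.step x - B.F i) ∂B.law i with hc
  have hXi : ∀ s, Integrable (fun ω => A (S.step (X i s ω) - B.F i)) μ ∧
      ∫ ω, A (S.step (X i s ω) - B.F i) ∂μ = c := fun s => by
    have h1 := hfi
    rw [← hM.law_X i s] at h1
    refine ⟨(integrable_map_measure hA.aestronglyMeasurable
      (hM.measurable_X i s).aemeasurable).1 h1, ?_⟩
    rw [hc, ← hM.law_X i s,
      integral_map (hM.measurable_X i s).aemeasurable hA.aestronglyMeasurable]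
  -- The mean of `A` at the centred empirical distribution function is `c` for every sample size,
  -- whereas concentration makes it tend to zero. No integral with values in `L` is needed.
  have hbound : ∀ n : ℕ, |c| ≤ ‖A‖ * (expConst * (Real.sqrt (a * (n + 1 : ℕ)))⁻¹) := by
    intro n
    have hn : 1 ≤ n + 1 := by omega
    obtain ⟨hdi, hdI⟩ := hM.integral_dev_le hR hst i hn
    have hn0 : ((n + 1 : ℕ) : ℝ) ≠ 0 := by positivity
    have h1 : ∀ ω, A (S.emp (fun s : Fin (n + 1) => X i s ω) - B.F i)
        = ((n + 1 : ℕ) : ℝ)⁻¹ * ∑ s : Fin (n + 1), A (S.step (X i s ω) - B.F i) := fun ω => by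
      rw [← map_sum, ← smul_eq_mul, ← map_smul]
      congr 1
      rw [Finset.sum_sub_distrib, smul_sub, FunSpace.emp, Finset.sum_const, Finset.card_univ,
        Fintype.card_fin, ← Nat.cast_smul_eq_nsmul ℝ, smul_smul, inv_mul_cancel₀ hn0, one_smul]
    have h2 : ∫ ω, A (S.emp (fun s : Fin (n + 1) => X i s ω) - B.F i) ∂μ = c := by
      simp only [h1]
      rw [integral_const_mul, integral_finsetSum _ fun (s : Fin (n + 1)) _ => (hXi s).1]
      simp only [(hXi _).2, Finset.sum_const, Finset.card_univ, Fintype.card_fin, nsmul_eq_mul]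
      rw [inv_mul_cancel_left₀ hn0]
    rw [← h2, ← Real.norm_eq_abs]
    refine (norm_integral_le_of_norm_le (hdi.const_mul ‖A‖) (ae_of_all _ fun ω =>
      A.le_opNorm _)).trans ?_
    rw [integral_const_mul]
    exact mul_le_mul_of_nonneg_left hdI (norm_nonneg _)
  have hlim : Tendsto (fun n : ℕ => ‖A‖ * (expConst * (Real.sqrt (a * (n + 1 : ℕ)))⁻¹)) atTop
      (nhds 0) := by
    have h1 : Tendsto (fun n : ℕ => a * ((n + 1 : ℕ) : ℝ)) atTop atTop :=
      ((tendsto_natCast_atTop_atTop (R := ℝ)).comp (tendsto_add_atTop_nat 1)).const_mul_atTop ha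
    have h2 := (Real.tendsto_sqrt_atTop.comp h1).inv_tendsto_atTop
    simpa using (h2.const_mul expConst).const_mul ‖A‖
  exact abs_nonpos_iff.1 (ge_of_tendsto' hlim hbound)

/-- The fluctuations of the linear term along a policy have expectation zero. -/
lemma IsModel.integral_fluct (hM : IsModel B μ V X) (hR : MeasurableEDPM B R)
    (H : Landscape B R a b q δ D k) (A' : SmoothAt B R d₁ d₂ M₀ k A) (π : Policy K 𝕍) (T : ℕ) :
    Integrable (fun ω => S.fluct B A (fun i n => X i n ω)
      (fun i => π.pulls (V ω) (fun i n => X i n ω) T i) T) μ ∧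
    ∫ ω, S.fluct B A (fun i n => X i n ω)
      (fun i => π.pulls (V ω) (fun i n => X i n ω) T i) T ∂μ = 0 := by
  -- `A` belongs to arm `k`, but each arm is centred at its own distribution function; the change of
  -- centre is a constant.
  have hAi : ∀ i, Measurable fun x => A (S.step x - B.F i) := fun i => by
    have h1 : (fun x => A (S.step x - B.F i))
        = fun x => A (S.step x - B.F k) + A (B.F k - B.F i) := by
      funext x; rw [← map_add]; congr 1; abel
    rw [h1]
    exact (A'.measurable_map_step H hR).add_const _
  have hrec := fun i n => hM.integral_received π T i n (hAi i)
    (hM.integrable_map_step hR H.stable i (hAi i)) (hM.integral_map_step hR H.stable i (hAi i))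
  have heq : ∀ ω, S.fluct B A (fun i n => X i n ω)
      (fun i => π.pulls (V ω) (fun i n => X i n ω) T i) T
      = (T : ℝ)⁻¹ * ∑ i, ∑ n ∈ Finset.range T,
        (if n < π.pulls (V ω) (fun i n => X i n ω) T i then A (S.step (X i n ω) - B.F i) else 0) := by
    intro ω
    have h1 : ∀ i, ∑ n ∈ Finset.range T, (if n < π.pulls (V ω) (fun i n => X i n ω) T i then
        A (S.step (X i n ω) - B.F i) else 0)
        = A (S.esum (fun n => X i n ω) (π.pulls (V ω) (fun i n => X i n ω) T i)
          - (π.pulls (V ω) (fun i n => X i n ω) T i : ℝ) • B.F i) := fun i => by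
      rw [← Finset.sum_filter]
      have h2 : (Finset.range T).filter (fun n => n < π.pulls (V ω) (fun i n => X i n ω) T i)
          = Finset.range (π.pulls (V ω) (fun i n => X i n ω) T i) := by
        ext n
        simp only [Finset.mem_filter, Finset.mem_range, and_iff_right_iff_imp]
        exact fun h => h.trans_le (π.pulls_le _ _ T i)
      rw [h2, ← map_sum, Finset.sum_sub_distrib, Finset.sum_const, Finset.card_range,
        ← Nat.cast_smul_eq_nsmul ℝ, FunSpace.esum]
    simp only [h1]
    rw [← map_sum, ← smul_eq_mul, ← map_smul, FunSpace.fluct]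
    congr 1
    rw [FunSpace.pool, Arms.mix, Finset.sum_sub_distrib, smul_sub]
    congr 1
    rw [Finset.smul_sum]
    exact Finset.sum_congr rfl fun i _ => by rw [smul_smul, freq, div_eq_inv_mul]
  simp only [heq]
  refine ⟨(integrable_finsetSum _ fun i _ =>
    integrable_finsetSum _ fun n _ => (hrec i n).1).const_mul _, ?_⟩
  rw [integral_const_mul, integral_finsetSum _ fun i _ =>
    integrable_finsetSum _ fun n _ => (hrec i n).1]
  have h0 : ∀ i, ∫ ω, ∑ n ∈ Finset.range T,
      (if n < π.pulls (V ω) (fun i n => X i n ω) T i then A (S.step (X i n ω) - B.F i) else 0) ∂μ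
      = 0 := fun i => by
    rw [integral_finsetSum _ fun n _ => (hrec i n).1]
    exact Finset.sum_eq_zero fun n _ => (hrec i n).2
  rw [Finset.sum_eq_zero fun i _ => h0 i, mul_zero]

end Linear

/-! ### Pull counts of suboptimal arms under UCB -/

section UCB

variable {K : ℕ} {𝕍 : Type*} [MeasurableSpace 𝕍] {L : Type*} [NormedAddCommGroup L]
  [NormedSpace ℝ L] {S : FunSpace L} {B : Arms S K} {R : L → ℝ} {Ω : Type*}
  {X : Fin K → ℕ → Ω → ℝ} {a b q δ D α : ℝ} {k : Fin K}

/-- The confidence radius that forces the exploration bonus of a suboptimal arm to be small. -/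
noncomputable def exploreRadius (b q δ : ℝ) : ℝ :=
  min (δ / (4 * b)) ((δ / (4 * b)) ^ (1 / q))

lemma exploreRadius_pos {b q δ : ℝ} (hb : 0 < b) (hδ : 0 < δ) : 0 < exploreRadius b q δ :=
  lt_min (by positivity) (by positivity)

lemma phiInv_eq {a b q y : ℝ} (hy : 0 ≤ y / a) : phiInv a b q y
    = max (2 * b * Real.sqrt (y / a)) (2 * b * Real.sqrt (y / a) ^ q) := by
  rw [phiInv, Real.sqrt_eq_rpow, ← Real.rpow_mul hy]
  congr 3; ring

/-- The deviation of the value is at most the exploration bonus if the deviation of the empirical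
distribution function is at most the confidence radius. -/
lemma Landscape.value_dev_le (H : Landscape B R a b q δ D k) (j : Fin K) {y : ℝ} (hy : 0 ≤ y / a)
    {G : L} (hG : G ∈ S.empSet) (hn : ‖G - B.F j‖ ≤ Real.sqrt (y / a)) :
    |R G - R (B.F j)| ≤ phiInv a b q y := by
  have hb := H.stable.b_pos
  refine (H.abs_sub_le (B.F_mem_mixSet j) (Or.inr hG) hn).trans ?_
  rw [phiInv_eq hy]
  have h1 := le_max_left (2 * b * Real.sqrt (y / a)) (2 * b * Real.sqrt (y / a) ^ q)
  have h2 := le_max_right (2 * b * Real.sqrt (y / a)) (2 * b * Real.sqrt (y / a) ^ q)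
  linarith

/-- Both branches of the maximum in `phiInv` are inverted, which explains the two terms in
`exploreRadius`. -/
lemma exploreRadius_le {a b q δ y : ℝ} (hb : 0 < b) (hq : 0 < q) (hδ : 0 < δ) (hy : 0 ≤ y / a)
    (h : δ / 2 ≤ phiInv a b q y) : exploreRadius b q δ ≤ Real.sqrt (y / a) := by
  rw [phiInv_eq hy] at h
  have hs := Real.sqrt_nonneg (y / a)
  rcases le_max_iff.1 h with h1 | h1
  · refine (min_le_left _ _).trans ?_
    rw [div_le_iff₀ (by positivity)]; linarith
  · refine (min_le_right _ _).trans ?_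
    have h2 : δ / (4 * b) ≤ Real.sqrt (y / a) ^ q := by
      rw [div_le_iff₀ (by positivity)]; linarith
    have h3 := Real.rpow_le_rpow (by positivity) h2 (by positivity : 0 ≤ 1 / q)
    rwa [← Real.rpow_mul hs, mul_one_div_cancel hq.ne', Real.rpow_one] at h3

/-- Some empirical distribution function of arm `j` is outside its confidence region in round
`t + 1`. -/
def badSet (B : Arms S K) (a α : ℝ) (X : Fin K → ℕ → Ω → ℝ) (j : Fin K) (t : ℕ) : Set Ω :=
  {ω | ∃ s ∈ Finset.Icc 1 t,
    Real.sqrt (α * Real.log ((t + 1 : ℕ) : ℝ) / s / a) ≤ B.dev X j s ω}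

variable {π : Policy K 𝕍}

/-- Outside the bad events, a suboptimal arm is only pulled if it has been pulled rarely. -/
lemma IsUCB.pulls_le (hU : IsUCB S R a b q α π) (H : Landscape B R a b q δ D k) (hα : 0 < α)
    (v : 𝕍) (ω : Ω) {t : ℕ} (ht : K ≤ t) {i : Fin K} (hi : i ≠ k)
    (hact : π.action v (fun i n => X i n ω) t = i)
    (hbi : ω ∉ badSet B a α X i t) (hbk : ω ∉ badSet B a α X k t) :
    (π.pulls v (fun i n => X i n ω) t i : ℝ)
      ≤ α * Real.log ((t + 1 : ℕ) : ℝ) / (a * exploreRadius b q δ ^ 2) := by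
  have ha := H.stable.a_pos
  have hb := H.stable.b_pos
  set x : Fin K → ℕ → ℝ := fun i n => X i n ω with hx
  have hp1 : ∀ j, 1 ≤ π.pulls v x t j := fun j => by
    rw [← (hU v x).1 j]; exact π.pulls_mono v x j ht
  have hlog : 0 ≤ Real.log ((t + 1 : ℕ) : ℝ) := Real.log_natCast_nonneg _
  have hdev : ∀ j, ω ∉ badSet B a α X j t →
      |R (S.emp fun s : Fin (π.pulls v x t j) => x j s) - R (B.F j)|
        ≤ phiInv a b q (α * Real.log ((t + 1 : ℕ) : ℝ) / (π.pulls v x t j : ℝ)) := fun j hj => by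
    refine H.value_dev_le j (by positivity) ⟨_, hp1 j, _, rfl⟩ ?_
    by_contra! hc
    exact hj ⟨π.pulls v x t j, Finset.mem_Icc.2 ⟨hp1 j, π.pulls_le v x t j⟩, hc.le⟩
  -- The index of `i` is at least that of `k`, hence at least `R (B.F k)`; it is also at most `R
  -- (B.F i)` plus twice the bonus. So the bonus is at least `δ / 2`.
  have h1 := (hU v x).2 t ht k
  rw [hact, ucbIndex, ucbIndex] at h1
  have h2 := abs_le.1 (hdev i hbi)
  have h3 := abs_le.1 (hdev k hbk)
  have h4 := H.gap i hi
  have hpi : (0 : ℝ) < π.pulls v x t i := by exact_mod_cast hp1 i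
  have h5 := exploreRadius_le (q := q) (δ := δ) hb H.q_pos H.pos
    (y := α * Real.log ((t + 1 : ℕ) : ℝ) / (π.pulls v x t i : ℝ)) (a := a) (by positivity)
    (by linarith [h2.2, h3.1])
  have hw := exploreRadius_pos (q := q) hb H.pos
  have h6 := pow_le_pow_left₀ hw.le h5 2
  rw [Real.sq_sqrt (by positivity), div_div, le_div_iff₀ (by positivity)] at h6
  rw [le_div_iff₀ (by positivity)]
  linarith

/-- Induction over rounds: a pull in a bad round is charged to its indicator, and after a pull in a
good round the count exceeds the logarithmic threshold by at most one. -/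
lemma IsUCB.pulls_le_count (hU : IsUCB S R a b q α π) (H : Landscape B R a b q δ D k)
    (hα : 0 < α) (v : 𝕍) (ω : Ω) {i : Fin K} (hi : i ≠ k) {T t : ℕ} (ht : t ≤ T) :
    (π.pulls v (fun i n => X i n ω) t i : ℝ)
      ≤ α * Real.log T / (a * exploreRadius b q δ ^ 2) + 2
        + ∑ s ∈ Finset.Ico K t, ((badSet B a α X i s).indicator (fun _ => 1) ω
          + (badSet B a α X k s).indicator (fun _ => 1) ω) := by
  have ha := H.stable.a_pos
  have hw := exploreRadius_pos (q := q) H.stable.b_pos H.pos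
  set x : Fin K → ℕ → ℝ := fun i n => X i n ω with hx
  have hind : ∀ j s, 0 ≤ (badSet B a α X j s).indicator (fun _ => (1 : ℝ)) ω := fun j s =>
    Set.indicator_nonneg (fun _ _ => zero_le_one) _
  have hu : 0 ≤ α * Real.log T / (a * exploreRadius b q δ ^ 2) := by
    have := Real.log_natCast_nonneg T; positivity
  induction t with
  | zero => simp [Policy.pulls_zero]; linarith
  | succ t ih =>
    have ih := ih (by omega)
    have hsum : 0 ≤ ∑ s ∈ Finset.Ico K (t + 1), ((badSet B a α X i s).indicator (fun _ => (1 : ℝ)) ω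
          + (badSet B a α X k s).indicator (fun _ => 1) ω) :=
      Finset.sum_nonneg fun s _ => add_nonneg (hind i s) (hind k s)
    rcases lt_or_ge t K with htK | htK
    · have h1 : π.pulls v x (t + 1) i ≤ 1 :=
        (π.pulls_mono v x i htK).trans_eq ((hU v x).1 i)
      have h2 : (π.pulls v x (t + 1) i : ℝ) ≤ 1 := by exact_mod_cast h1
      linarith
    · rw [Finset.sum_Ico_succ_top htK] at hsum ⊢
      have hi' := hind i t
      have hk' := hind k t
      rw [Policy.pulls_succ]
      by_cases hact : π.action v x t = i
      · rw [if_pos hact]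
        push_cast
        by_cases hbad : ω ∈ badSet B a α X i t ∨ ω ∈ badSet B a α X k t
        · have : 1 ≤ (badSet B a α X i t).indicator (fun _ => (1 : ℝ)) ω
              + (badSet B a α X k t).indicator (fun _ => 1) ω := by
            rcases hbad with h | h
            · rw [Set.indicator_of_mem h]; linarith
            · rw [Set.indicator_of_mem h]; linarith
          linarith
        · rw [not_or] at hbad
          have h1 := hU.pulls_le H hα v ω htK hi hact hbad.1 hbad.2
          have h2 : Real.log ((t + 1 : ℕ) : ℝ) ≤ Real.log T :=
            Real.log_le_log (by positivity) (by exact_mod_cast ht)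
          have h3 : α * Real.log ((t + 1 : ℕ) : ℝ) / (a * exploreRadius b q δ ^ 2)
              ≤ α * Real.log T / (a * exploreRadius b q δ ^ 2) := by gcongr
          linarith
      · rw [if_neg hact, add_zero]
        linarith

variable [MeasurableSpace Ω] {μ : Measure Ω} {V : Ω → 𝕍}

lemma IsModel.measurableSet_badSet (hM : IsModel B μ V X) (hR : MeasurableEDPM B R) (j : Fin K)
    (t : ℕ) : MeasurableSet (badSet B a α X j t) := by
  have : badSet B a α X j t = ⋃ s ∈ Finset.Icc 1 t,
      {ω | Real.sqrt (α * Real.log ((t + 1 : ℕ) : ℝ) / s / a) ≤ B.dev X j s ω} := by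
    ext ω; simp [badSet]
  rw [this]
  exact Finset.measurableSet_biUnion _ fun s _ =>
    measurableSet_le measurable_const (hM.measurable_dev hR j s)

/-- The union over `t` sample sizes costs one power of `t + 1`; summability over rounds then
requires `α > 2`. -/
lemma IsModel.prob_badSet_le (hM : IsModel B μ V X) (hR : MeasurableEDPM B R)
    (hst : StronglyStable B R a b q) (hα : 0 < α) (j : Fin K) {t : ℕ} (ht : 1 ≤ t) :
    μ.real (badSet B a α X j t) ≤ 2 * ((t : ℝ) + 1) ^ (1 - α) := by
  have := hM.isProb
  have ha := hst.a_pos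
  have ht0 : (0 : ℝ) < t := by exact_mod_cast ht
  have hlog : 0 < Real.log ((t + 1 : ℕ) : ℝ) := Real.log_pos (by exact_mod_cast Nat.lt_add_of_pos_left ht)
  have heq : badSet B a α X j t = ⋃ s ∈ Finset.Icc 1 t,
      {ω | Real.sqrt (α * Real.log ((t + 1 : ℕ) : ℝ) / s / a) ≤ B.dev X j s ω} := by
    ext ω; simp [badSet]
  have hterm : ∀ s ∈ Finset.Icc 1 t,
      μ.real {ω | Real.sqrt (α * Real.log ((t + 1 : ℕ) : ℝ) / s / a) ≤ B.dev X j s ω}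
        ≤ 2 * ((t : ℝ) + 1) ^ (-α) := fun s hs => by
    have hs1 := (Finset.mem_Icc.1 hs).1
    have hs0 : (0 : ℝ) < s := by exact_mod_cast hs1
    refine (hM.dev_tail hR hst j hs1 (by positivity)).trans (le_of_eq ?_)
    rw [Real.sq_sqrt (by positivity), Real.rpow_def_of_pos (by positivity)]
    push_cast
    congr 2
    field_simp
  rw [heq]
  refine (measureReal_biUnion_finset_le _ _).trans ((Finset.sum_le_sum hterm).trans ?_)
  rw [Finset.sum_const, Nat.card_Icc, nsmul_eq_mul, Nat.add_sub_cancel, sub_eq_add_neg,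
    Real.rpow_add (by positivity), Real.rpow_one]
  have h1 : 0 ≤ ((t : ℝ) + 1) ^ (-α) := by positivity
  nlinarith

/-- The sum that bounds the expected number of rounds with a bad event. -/
noncomputable def tailSum (α : ℝ) : ℝ := ∑' n : ℕ, ((n : ℝ) + 1) ^ (1 - α)

lemma summable_tail (hα : 2 < α) : Summable fun n : ℕ => ((n : ℝ) + 1) ^ (1 - α) := by
  have h1 : Summable fun n : ℕ => (n : ℝ) ^ (1 - α) :=
    Real.summable_nat_rpow.2 (by linarith)
  simpa using (summable_nat_add_iff 1).2 h1

lemma tailSum_nonneg (α : ℝ) : 0 ≤ tailSum α := tsum_nonneg fun _ => by positivity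

/-- The constant in the bound for the expected frequency of the suboptimal arms. -/
noncomputable def pullConst (a b q α δ : ℝ) : ℝ :=
  α / (a * exploreRadius b q δ ^ 2) + (2 + 4 * tailSum α) / Real.log 2

lemma IsModel.integrable_freq (hM : IsModel B μ V X) (π : Policy K 𝕍) (T : ℕ) (i : Fin K) :
    Integrable (fun ω => freq (fun j => π.pulls (V ω) (fun i n => X i n ω) T j) T i) μ := by
  have := hM.isProb
  have hm : Measurable fun ω => freq (fun j => π.pulls (V ω) (fun i n => X i n ω) T j) T i := by
    have h1 := (π.measurable_pulls T i).comp hM.measurable_joint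
    exact ((measurable_from_top (f := fun n : ℕ => (n : ℝ))).comp h1).div_const _
  refine (integrable_const (1 : ℝ)).mono' hm.aestronglyMeasurable (ae_of_all _ fun ω => ?_)
  rw [freq, Real.norm_of_nonneg (by positivity)]
  exact div_le_one_of_le₀ (by exact_mod_cast π.pulls_le _ _ T i) (by positivity)

/-- The expected frequency of the suboptimal arms under the UCB policy. -/
lemma IsModel.integral_freq_le (hM : IsModel B μ V X) (hR : MeasurableEDPM B R)
    (H : Landscape B R a b q δ D k) (hU : IsUCB S R a b q α π) (hα : 2 < α) (hK : 2 ≤ K) {T : ℕ}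
    (hT : 1 ≤ T) :
    ∫ ω, (1 - freq (fun j => π.pulls (V ω) (fun i n => X i n ω) T j) T k) ∂μ
      ≤ pullConst a b q α δ * ((K : ℝ) ^ 2 * Real.log (K * T) / T) := by
  have hP := hM.isProb
  have ha := H.stable.a_pos
  have hα0 : 0 < α := by linarith
  have hT0 : (0 : ℝ) < T := by exact_mod_cast hT
  have hT1 : (1 : ℝ) ≤ T := by exact_mod_cast hT
  have hK2 : (2 : ℝ) ≤ K := by exact_mod_cast hK
  have hw := exploreRadius_pos (q := q) H.stable.b_pos H.pos
  have hbm := fun j t => hM.measurableSet_badSet (a := a) (α := α) hR j t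
  have hbi : ∀ j t, Integrable ((badSet B a α X j t).indicator fun _ => (1 : ℝ)) μ := fun j t =>
    (integrable_const 1).indicator (hbm j t)
  set u := α * Real.log T / (a * exploreRadius b q δ ^ 2) with hu
  have hu0 : 0 ≤ u := by have := Real.log_nonneg hT1; positivity
  have hpulls : ∀ i, i ≠ k → ∫ ω, (π.pulls (V ω) (fun i n => X i n ω) T i : ℝ) / T ∂μ
      ≤ (u + 2 + 4 * tailSum α) / T := fun i hi => by
    have hpair : ∀ s, Integrable (fun ω => (badSet B a α X i s).indicator (fun _ => (1 : ℝ)) ω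
        + (badSet B a α X k s).indicator (fun _ => 1) ω) μ := fun s => (hbi i s).add (hbi k s)
    have hdom : Integrable (fun ω => u + 2 + ∑ s ∈ Finset.Ico K T,
        ((badSet B a α X i s).indicator (fun _ => (1 : ℝ)) ω
          + (badSet B a α X k s).indicator (fun _ => 1) ω)) μ :=
      (integrable_const _).add (integrable_finsetSum _ fun s _ => hpair s)
    rw [integral_div]
    refine div_le_div_of_nonneg_right ?_ hT0.le
    have hint : Integrable (fun ω => (π.pulls (V ω) (fun i n => X i n ω) T i : ℝ)) μ := by
      refine ((hM.integrable_freq π T i).mul_const (T : ℝ)).congr (ae_of_all _ fun ω => ?_)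
      simp only [freq]; field_simp
    refine (integral_mono hint hdom fun ω =>
      hU.pulls_le_count H hα0 (V ω) ω hi le_rfl).trans ?_
    rw [integral_add (integrable_const _) (integrable_finsetSum _ fun s _ => hpair s),
      integral_finsetSum _ fun s _ => hpair s]
    simp only [integral_const, probReal_univ, one_smul]
    have h1 : ∀ s ∈ Finset.Ico K T, ∫ ω, ((badSet B a α X i s).indicator (fun _ => (1 : ℝ)) ω
        + (badSet B a α X k s).indicator (fun _ => 1) ω) ∂μ ≤ 4 * ((s : ℝ) + 1) ^ (1 - α) :=
        fun s hs => by
      have hs1 : 1 ≤ s := by have := (Finset.mem_Ico.1 hs).1; omega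
      rw [integral_add (hbi i s) (hbi k s), integral_indicator_const _ (hbm i s),
        integral_indicator_const _ (hbm k s), smul_eq_mul, smul_eq_mul, mul_one, mul_one]
      linarith [hM.prob_badSet_le hR H.stable hα0 i hs1, hM.prob_badSet_le hR H.stable hα0 k hs1]
    have h2 := Finset.sum_le_sum h1
    rw [← Finset.mul_sum] at h2
    have h3 : ∑ s ∈ Finset.Ico K T, ((s : ℝ) + 1) ^ (1 - α) ≤ tailSum α :=
      (summable_tail hα).sum_le_tsum _ fun _ _ => by positivity
    linarith
  have hsum : ∀ ω, 1 - freq (fun j => π.pulls (V ω) (fun i n => X i n ω) T j) T k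
      = ∑ i ∈ Finset.univ.erase k, (π.pulls (V ω) (fun i n => X i n ω) T i : ℝ) / T := fun ω => by
    have h1 : ∑ i, (π.pulls (V ω) (fun i n => X i n ω) T i : ℝ) / T = 1 := by
      rw [← Finset.sum_div, ← Nat.cast_sum, π.sum_pulls]; field_simp
    rw [← h1, ← Finset.add_sum_erase _ _ (Finset.mem_univ k), freq]; ring
  simp only [hsum]
  rw [integral_finsetSum _ fun i _ => by simpa only [freq] using hM.integrable_freq π T i]
  refine (Finset.sum_le_sum fun i hi => hpulls i (Finset.ne_of_mem_erase hi)).trans ?_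
  have hζ := tailSum_nonneg α
  have hc : 0 ≤ (u + 2 + 4 * tailSum α) / T := by positivity
  refine (Finset.sum_le_univ_sum_of_nonneg fun _ => hc).trans ?_
  rw [Finset.sum_const, Finset.card_univ, Fintype.card_fin, nsmul_eq_mul]
  set l := Real.log (K * T) with hl
  have hl2 : Real.log 2 ≤ l := Real.log_le_log (by norm_num) (by nlinarith)
  have hlog2 : 0 < Real.log 2 := Real.log_pos (by norm_num)
  have hlT : Real.log T ≤ l := Real.log_le_log hT0 (by nlinarith)
  have h1 : u ≤ α / (a * exploreRadius b q δ ^ 2) * l := by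
    rw [hu, mul_div_right_comm]
    exact mul_le_mul_of_nonneg_left hlT (by positivity)
  have h2 : 2 + 4 * tailSum α ≤ (2 + 4 * tailSum α) / Real.log 2 * l := by
    rw [div_mul_eq_mul_div, le_div_iff₀ hlog2]
    exact mul_le_mul_of_nonneg_left hl2 (by positivity)
  have h3 : u + 2 + 4 * tailSum α ≤ pullConst a b q α δ * l := by
    rw [pullConst, add_mul]; linarith
  -- The argument yields a factor `K`; it is weakened to match the rate of the fluctuations.
  have h4 : (K : ℝ) ≤ (K : ℝ) ^ 2 := by nlinarith
  calc (K : ℝ) * ((u + 2 + 4 * tailSum α) / T) ≤ (K : ℝ) ^ 2 * ((pullConst a b q α δ * l) / T) := by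
        gcongr
    _ = pullConst a b q α δ * ((K : ℝ) ^ 2 * l / T) := by ring

end UCB

/-! ### Expected performance and regret -/

section Regret

variable {K : ℕ} {𝕍 : Type*} [MeasurableSpace 𝕍] {L : Type*} [NormedAddCommGroup L]
  [NormedSpace ℝ L] {S : FunSpace L} {B : Arms S K} {R : L → ℝ} {Ω : Type*} [MeasurableSpace Ω]
  {μ : Measure Ω} {V : Ω → 𝕍} {X : Fin K → ℕ → Ω → ℝ} {a b q δ D α d₁ d₂ M₀ : ℝ} {k : Fin K}
  {π : Policy K 𝕍} {A : L →L[ℝ] ℝ}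

lemma Setting.exists_landscape (hs : Setting B R μ V X π a b q α δ D) (hδ : 0 < δ) :
    ∃ k, Landscape B R a b q δ D k := by
  obtain ⟨k, hk, hgap⟩ := hs.gaps
  refine ⟨k, hs.stable, hs.quasiconvex, hδ, fun i hi => ?_, hs.dist_le⟩
  have := hgap i hi
  rw [gap_eq hs.quasiconvex hk] at this
  linarith

/-- The number of pulls of the arms along a policy. -/
def runPulls (V : Ω → 𝕍) (X : Fin K → ℕ → Ω → ℝ) (π : Policy K 𝕍) (T : ℕ) (ω : Ω) (i : Fin K) : ℕ :=
  π.pulls (V ω) (fun i n => X i n ω) T i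

lemma perf_eq_pool {Ω : Type*} {V : Ω → 𝕍} {X : Fin K → ℕ → Ω → ℝ} (T : ℕ) (ω : Ω) :
    perf S R V X π T ω = R (S.pool (fun i n => X i n ω) (runPulls V X π T ω) T) := by
  rw [perf, Policy.value, π.emp_hist]; rfl

/-- A common bound for the deviations, with its moment bounds. -/
structure IsDeviation (B : Arms S K) (μ : Measure Ω) (X : Fin K → ℕ → Ω → ℝ) (a : ℝ) (T : ℕ)
    (z : Ω → ℝ) : Prop where
  nonneg : ∀ ω, 0 ≤ z ω
  bound : ∀ ω i s, s ≤ T → ‖S.esum (fun n => X i n ω) s - (s : ℝ) • B.F i‖ ≤ T * z ω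
  integrable : ∀ r : ℝ, 0 < r → Integrable (fun ω => (K * z ω) ^ r) μ
  moment : 2 ≤ K → ∀ r : ℝ, 0 < r → ∫ ω, (K * z ω) ^ r ∂μ
    ≤ momConst a r * ((K : ℝ) ^ 2 * Real.log (K * T) / T) ^ (r / 2)

namespace IsDeviation

variable {T : ℕ} {z : Ω → ℝ}

lemma isSample (hz : IsDeviation B μ X a T z) (hT : 1 ≤ T) (V : Ω → 𝕍) (π : Policy K 𝕍) (ω : Ω) :
    IsSample B (fun i n => X i n ω) (runPulls V X π T ω) T (z ω) :=
  ⟨hT, π.sum_pulls _ _ T, fun i => hz.bound ω i _ (π.pulls_le _ _ T i)⟩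

lemma scaled_nonneg (hz : IsDeviation B μ X a T z) (ω : Ω) : 0 ≤ K * z ω :=
  mul_nonneg (Nat.cast_nonneg K) (hz.nonneg ω)

lemma integrable_one (hz : IsDeviation B μ X a T z) : Integrable (fun ω => K * z ω) μ := by
  simpa using hz.integrable 1 one_pos

lemma integrable_quadErr (hz : IsDeviation B μ X a T z) (hq : 0 < q) :
    Integrable (fun ω => quadErr q (K * z ω)) μ := by
  simp only [quadErr, ← Real.rpow_two]
  exact (hz.integrable 2 two_pos).add (hz.integrable (q + 2) (by linarith))

/-- Moments of order at least `2 * p` are bounded by the power `p` of the rate. -/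
lemma moment_le (hz : IsDeviation B μ X a T z) (ha : 0 < a) (hK : 2 ≤ K) {r p : ℝ} (hr : 0 < r)
    (hp0 : 0 ≤ p) (hp : p ≤ r / 2) (hε0 : 0 ≤ (K : ℝ) ^ 2 * Real.log (K * T) / T)
    (hε : (K : ℝ) ^ 2 * Real.log (K * T) / T ≤ 1) :
    ∫ ω, (K * z ω) ^ r ∂μ ≤ momConst a r * ((K : ℝ) ^ 2 * Real.log (K * T) / T) ^ p := by
  refine (hz.moment hK r hr).trans (mul_le_mul_of_nonneg_left ?_ ?_)
  · exact Real.rpow_le_rpow_of_exponent_ge' hε0 hε hp0 hp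
  · have := Real.log_nonneg (one_le_two.trans two_le_expConst)
    have : 0 < Real.log 2 := Real.log_pos (by norm_num)
    unfold momConst; positivity

lemma integral_quadErr_le (hz : IsDeviation B μ X a T z) (ha : 0 < a) (hq : 0 < q) (hK : 2 ≤ K)
    (hε0 : 0 ≤ (K : ℝ) ^ 2 * Real.log (K * T) / T)
    (hε : (K : ℝ) ^ 2 * Real.log (K * T) / T ≤ 1) :
    ∫ ω, quadErr q (K * z ω) ∂μ
      ≤ (momConst a 2 + momConst a (q + 2)) * ((K : ℝ) ^ 2 * Real.log (K * T) / T) := by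
  simp only [quadErr, ← Real.rpow_two (K * z _)]
  rw [integral_add (hz.integrable 2 two_pos) (hz.integrable (q + 2) (by linarith)), add_mul]
  have h1 := hz.moment_le ha hK two_pos zero_le_one (by norm_num) hε0 hε
  have h2 := hz.moment_le ha hK (r := q + 2) (p := 1) (by linarith) zero_le_one (by linarith) hε0 hε
  rw [Real.rpow_one] at h1 h2
  exact add_le_add h1 h2

end IsDeviation

section Bounds

variable {T : ℕ} {z : Ω → ℝ}

lemma IsModel.integrable_subopt (hM : IsModel B μ V X) (π : Policy K 𝕍) (T : ℕ) (i : Fin K) :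
    Integrable (fun ω => 1 - freq (runPulls V X π T ω) T i) μ := by
  have := hM.isProb
  exact (integrable_const 1).sub (hM.integrable_freq π T i)

lemma subopt_mem (hz : IsDeviation B μ X a T z) (hT : 1 ≤ T) (ω : Ω) :
    0 ≤ 1 - freq (runPulls V X π T ω) T k ∧ 1 - freq (runPulls V X π T ω) T k ≤ 1 := by
  have h := (hz.isSample hT V π ω).freq_mem
  have h1 := stdSimplex_le_one h k
  have h2 := h.1 k
  constructor <;> linarith

/-- The deviation of the performance from the optimal value. -/
lemma abs_perf_sub_le (H : Landscape B R a b q δ D k) (hz : IsDeviation B μ X a T z) (hT : 1 ≤ T)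
    (ω : Ω) : |perf S R V X π T ω - R (B.F k)| ≤
      b * (K * z ω + D * (1 - freq (runPulls V X π T ω) T k)
        + 2 ^ q * ((K * z ω) ^ q + D ^ q * (1 - freq (runPulls V X π T ω) T k))) := by
  have hq := H.q_pos
  have hD := H.D_nonneg
  have hh := hz.scaled_nonneg ω
  obtain ⟨hl0, hl1⟩ := subopt_mem (V := V) (π := π) (k := k) hz hT ω
  rw [perf_eq_pool]
  refine (H.abs_pool_sub_le (hz.isSample hT V π ω)).trans ?_
  have h1 := add_rpow_le_two_rpow hh (mul_nonneg hD hl0) hq.le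
  rw [Real.mul_rpow hD hl0] at h1
  have h2 := mul_le_mul_of_nonneg_left (rpow_le_self_of_le_one' hl0 hl1 H.stable.one_le_q)
    (Real.rpow_nonneg hD q)
  have h3 : (0 : ℝ) ≤ 2 ^ q := by positivity
  refine mul_le_mul_of_nonneg_left ?_ H.stable.b_pos.le
  have h4 := mul_le_mul_of_nonneg_left h2 h3
  linarith

lemma IsModel.integrable_perf (hM : IsModel B μ V X) (hR : MeasurableEDPM B R)
    (H : Landscape B R a b q δ D k) (hz : IsDeviation B μ X a T z) (hT : 1 ≤ T)
    (π : Policy K 𝕍) : Integrable (perf S R V X π T) μ := by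
  have := hM.isProb
  have hl := hM.integrable_subopt π T k
  have hdom := (((hz.integrable_one.add (hl.const_mul D)).add
    (((hz.integrable q H.q_pos).add (hl.const_mul (D ^ q))).const_mul (2 ^ q))).const_mul b)
  have h1 : Integrable (fun ω => perf S R V X π T ω - R (B.F k)) μ :=
    hdom.mono' ((hM.measurable_perf hR π T).sub_const _).aestronglyMeasurable
      (ae_of_all _ fun ω => abs_perf_sub_le H hz hT ω)
  refine (h1.add (integrable_const (R (B.F k)))).congr (ae_of_all _ fun ω => ?_)
  simp

lemma IsModel.integral_perf_le (hM : IsModel B μ V X) (hR : MeasurableEDPM B R)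
    (H : Landscape B R a b q δ D k) (hz : IsDeviation B μ X a T z) (hT : 1 ≤ T)
    (π : Policy K 𝕍) : ∫ ω, perf S R V X π T ω ∂μ
      ≤ R (B.F k) + b * (∫ ω, K * z ω ∂μ + ∫ ω, (K * z ω) ^ q ∂μ) := by
  have := hM.isProb
  have h1 := hz.integrable_one
  have h2 := hz.integrable q H.q_pos
  have h3 : Integrable (fun ω => b * (K * z ω + (K * z ω) ^ q)) μ := (h1.add h2).const_mul b
  refine (integral_mono (hM.integrable_perf hR H hz hT π)
    ((integrable_const (R (B.F k))).add h3) fun ω => ?_).trans (le_of_eq ?_)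
  · show perf S R V X π T ω ≤ R (B.F k) + b * (K * z ω + (K * z ω) ^ q)
    rw [perf_eq_pool]
    exact H.pool_le (hz.isSample hT V π ω)
  · simp only [Pi.add_apply]
    rw [integral_add (integrable_const _) h3, integral_const_mul, integral_add h1 h2]
    simp

lemma IsModel.bddAbove_perf (hM : IsModel B μ V X) (hR : MeasurableEDPM B R)
    (H : Landscape B R a b q δ D k) (hz : IsDeviation B μ X a T z) (hT : 1 ≤ T) :
    BddAbove (Set.range fun π : Policy K 𝕍 => ∫ ω, perf S R V X π T ω ∂μ) :=
  ⟨_, Set.forall_mem_range.2 fun π => hM.integral_perf_le hR H hz hT π⟩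

lemma IsModel.integral_perf_ge (hM : IsModel B μ V X) (hR : MeasurableEDPM B R)
    (H : Landscape B R a b q δ D k) (hz : IsDeviation B μ X a T z) (hT : 1 ≤ T)
    (π : Policy K 𝕍) :
    R (B.F k) - b * (∫ ω, K * z ω ∂μ + D * ∫ ω, (1 - freq (runPulls V X π T ω) T k) ∂μ
      + 2 ^ q * (∫ ω, (K * z ω) ^ q ∂μ + D ^ q * ∫ ω, (1 - freq (runPulls V X π T ω) T k) ∂μ))
      ≤ ∫ ω, perf S R V X π T ω ∂μ := by
  have := hM.isProb
  have h1 := hz.integrable_one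
  have h2 := hz.integrable q H.q_pos
  have hl := hM.integrable_subopt π T k
  have i1 : Integrable (fun ω => K * z ω + D * (1 - freq (runPulls V X π T ω) T k)) μ :=
    h1.add (hl.const_mul D)
  have i2 : Integrable
      (fun ω => (K * z ω) ^ q + D ^ q * (1 - freq (runPulls V X π T ω) T k)) μ :=
    h2.add (hl.const_mul _)
  have i3 : Integrable (fun ω => b * (K * z ω + D * (1 - freq (runPulls V X π T ω) T k)
      + 2 ^ q * ((K * z ω) ^ q + D ^ q * (1 - freq (runPulls V X π T ω) T k)))) μ :=
    (i1.add (i2.const_mul _)).const_mul b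
  have h3 := integral_mono ((integrable_const (R (B.F k))).sub i3)
    (hM.integrable_perf hR H hz hT π) fun ω => by
      have := (abs_le.1 (abs_perf_sub_le (V := V) (π := π) (R := R) H hz hT ω)).1
      simp only [Pi.sub_apply]
      linarith
  refine le_trans (le_of_eq ?_) h3
  simp only [Pi.sub_apply]
  rw [integral_sub (integrable_const _) i3, integral_const_mul b,
    integral_add i1 (i2.const_mul _), integral_const_mul (2 ^ q), integral_add h1 (hl.const_mul D),
    integral_add h2 (hl.const_mul _), integral_const_mul D, integral_const_mul (D ^ q)]
  simp

/-- The constant of the upper bound for the value of a sample under smoothness. -/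
noncomputable def upperConst (b q δ D d₁ d₂ M₀ : ℝ) : ℝ :=
  max (smoothConst b d₁ d₂ M₀ * 2 ^ (q + 2)) (flatConst b q δ D d₁ d₂ M₀)

/-- The constant of the frequency of the suboptimal arms in the lower bound under smoothness. -/
noncomputable def lowerConst (b q D d₁ d₂ M₀ : ℝ) : ℝ :=
  smoothConst b d₁ d₂ M₀ * (2 ^ (q + 2) * quadErr q D) + d₁ * D

/-- Upper bound for the value of a sample, up to a multiple of the fluctuations. -/
lemma SmoothAt.exists_pool_le (H : Landscape B R a b q δ D k) (A' : SmoothAt B R d₁ d₂ M₀ k A) :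
    ∃ s c : ℝ, 0 ≤ c ∧ ∀ (x : Fin K → ℕ → ℝ) (τ : Fin K → ℕ) (T : ℕ) (z : ℝ), IsSample B x τ T z →
      R (S.pool x τ T) ≤ R (B.F k) + s * S.fluct B A x τ T
        + upperConst b q δ D d₁ d₂ M₀ * quadErr q (K * z)
        + c * ((K * z) ^ (4 : ℝ) + (K * z) ^ (q + 4)) := by
  have hmax1 := le_max_left (smoothConst b d₁ d₂ M₀ * 2 ^ (q + 2)) (flatConst b q δ D d₁ d₂ M₀)
  have hmax2 := le_max_right (smoothConst b d₁ d₂ M₀ * 2 ^ (q + 2)) (flatConst b q δ D d₁ d₂ M₀)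
  -- The fluctuation is kept with coefficient one in the separated case and absent in the other; a
  -- common form suffices because it integrates to zero.
  by_cases hA : ∀ i, i ≠ k → A (B.F i - B.F k) < 0
  · obtain ⟨c, hc, h⟩ := A'.pool_le_of_separated H hA
    refine ⟨1, c, hc, fun x τ T z hs => (h x τ T z hs).trans ?_⟩
    have := mul_le_mul_of_nonneg_right hmax1 (quadErr_nonneg (q := q) (hs.h_nonneg k))
    rw [upperConst]
    linarith
  · push Not at hA
    obtain ⟨i, hi, hAi⟩ := hA
    refine ⟨0, 0, le_rfl, fun x τ T z hs => (A'.pool_le_of_not_separated H hi hAi hs).trans ?_⟩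
    have := mul_le_mul_of_nonneg_right hmax2 (quadErr_nonneg (q := q) (hs.h_nonneg k))
    rw [upperConst]
    linarith

lemma IsModel.integral_perf_le_of_smooth (hM : IsModel B μ V X) (hR : MeasurableEDPM B R)
    (H : Landscape B R a b q δ D k) (A' : SmoothAt B R d₁ d₂ M₀ k A) {s c : ℝ}
    (hsc : ∀ (x : Fin K → ℕ → ℝ) (τ : Fin K → ℕ) (T : ℕ) (z : ℝ), IsSample B x τ T z →
      R (S.pool x τ T) ≤ R (B.F k) + s * S.fluct B A x τ T
        + upperConst b q δ D d₁ d₂ M₀ * quadErr q (K * z)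
        + c * ((K * z) ^ (4 : ℝ) + (K * z) ^ (q + 4)))
    (hz : IsDeviation B μ X a T z) (hT : 1 ≤ T) (π : Policy K 𝕍) :
    ∫ ω, perf S R V X π T ω ∂μ ≤ R (B.F k)
      + upperConst b q δ D d₁ d₂ M₀ * ∫ ω, quadErr q (K * z ω) ∂μ
      + c * (∫ ω, (K * z ω) ^ (4 : ℝ) ∂μ + ∫ ω, (K * z ω) ^ (q + 4) ∂μ) := by
  have := hM.isProb
  have hq := H.q_pos
  obtain ⟨f1, f2⟩ := hM.integral_fluct hR H A' π T
  have h1 := hz.integrable_quadErr hq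
  have h4 := hz.integrable 4 (by norm_num)
  have h5 := hz.integrable (q + 4) (by linarith)
  have i1 : Integrable (fun ω => R (B.F k) + s * S.fluct B A (fun i n => X i n ω)
      (fun i => π.pulls (V ω) (fun i n => X i n ω) T i) T) μ :=
    (integrable_const _).add (f1.const_mul s)
  have i2 : Integrable (fun ω => c * ((K * z ω) ^ (4 : ℝ) + (K * z ω) ^ (q + 4))) μ :=
    (h4.add h5).const_mul c
  have i3 : Integrable (fun ω => R (B.F k) + s * S.fluct B A (fun i n => X i n ω)
      (fun i => π.pulls (V ω) (fun i n => X i n ω) T i) T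
      + upperConst b q δ D d₁ d₂ M₀ * quadErr q (K * z ω)) μ := i1.add (h1.const_mul _)
  have h3 := integral_mono (hM.integrable_perf hR H hz hT π) (i3.add i2) fun ω => by
    rw [perf_eq_pool]
    exact hsc _ _ _ _ (hz.isSample hT V π ω)
  refine h3.trans (le_of_eq ?_)
  simp only [Pi.add_apply]
  rw [integral_add i3 i2, integral_add i1 (h1.const_mul _),
    integral_add (integrable_const _) (f1.const_mul s), integral_const_mul, integral_const_mul,
    integral_const_mul, integral_add h4 h5, f2]
  simp

lemma IsModel.integral_perf_ge_of_smooth (hM : IsModel B μ V X) (hR : MeasurableEDPM B R)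
    (H : Landscape B R a b q δ D k) (A' : SmoothAt B R d₁ d₂ M₀ k A)
    (hz : IsDeviation B μ X a T z) (hT : 1 ≤ T) (π : Policy K 𝕍) :
    R (B.F k) - (smoothConst b d₁ d₂ M₀ * 2 ^ (q + 2) * ∫ ω, quadErr q (K * z ω) ∂μ
      + lowerConst b q D d₁ d₂ M₀ * ∫ ω, (1 - freq (runPulls V X π T ω) T k) ∂μ)
      ≤ ∫ ω, perf S R V X π T ω ∂μ := by
  have := hM.isProb
  obtain ⟨f1, f2⟩ := hM.integral_fluct hR H A' π T
  have h1 := (hz.integrable_quadErr H.q_pos).const_mul (smoothConst b d₁ d₂ M₀ * 2 ^ (q + 2))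
  have hl := (hM.integrable_subopt π T k).const_mul (lowerConst b q D d₁ d₂ M₀)
  have i1 : Integrable (fun ω => R (B.F k) + S.fluct B A (fun i n => X i n ω)
      (fun i => π.pulls (V ω) (fun i n => X i n ω) T i) T) μ :=
    (integrable_const _).add f1
  have i2 : Integrable (fun ω => smoothConst b d₁ d₂ M₀ * 2 ^ (q + 2) * quadErr q (K * z ω)
      + lowerConst b q D d₁ d₂ M₀ * (1 - freq (runPulls V X π T ω) T k)) μ := h1.add hl
  have h3 := integral_mono (i1.sub i2) (hM.integrable_perf hR H hz hT π) fun ω => by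
      rw [perf_eq_pool]
      have := A'.pool_ge H (hz.isSample hT V π ω)
      rw [← lowerConst, ← mul_assoc (smoothConst b d₁ d₂ M₀)] at this
      exact this
  refine le_trans (le_of_eq ?_) h3
  simp only [Pi.sub_apply]
  rw [integral_sub i1 i2, integral_add (integrable_const _) f1, integral_add h1 hl,
    integral_const_mul, integral_const_mul, f2]
  simp

end Bounds

/-- The policy itself competes in the supremum, so the regret is nonnegative and an upper bound
suffices. -/
lemma regret_le {T : ℕ} {u l : ℝ} (hu : ∀ π' : Policy K 𝕍, ∫ ω, perf S R V X π' T ω ∂μ ≤ u)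
    (hl : l ≤ ∫ ω, perf S R V X π T ω ∂μ) : |regret S R μ V X π T| ≤ u - l := by
  have hbdd : BddAbove (Set.range fun π' : Policy K 𝕍 => ∫ ω, perf S R V X π' T ω ∂μ) :=
    ⟨u, Set.forall_mem_range.2 hu⟩
  have h1 : ∫ ω, perf S R V X π T ω ∂μ ≤ ⨆ π' : Policy K 𝕍, ∫ ω, perf S R V X π' T ω ∂μ :=
    le_ciSup hbdd π
  have : Nonempty (Policy K 𝕍) := ⟨π⟩
  have h2 : (⨆ π' : Policy K 𝕍, ∫ ω, perf S R V X π' T ω ∂μ) ≤ u := ciSup_le hu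
  rw [regret, abs_of_nonneg (sub_nonneg.2 h1)]
  linarith

/-- With a single arm all policies coincide. -/
lemma regret_eq_zero [Subsingleton (Fin K)] (T : ℕ) : regret S R μ V X π T = 0 := by
  have hhist : ∀ (π' : Policy K 𝕍) v x t, π'.hist v x t = π.hist v x t := fun π' v x t => by
    induction t with
    | zero => rfl
    | succ t ih =>
      have h1 : π'.action v x t = π.action v x t := Subsingleton.elim _ _
      have h2 : ∀ j, π'.pulls v x t j = π.pulls v x t j := fun j => by
        rw [Policy.pulls, Policy.pulls, ih]
      rw [Policy.hist_succ, Policy.hist_succ, ih, h1, h2]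
  have hperf : ∀ π' : Policy K 𝕍, perf S R V X π' T = perf S R V X π T := fun π' => by
    funext ω
    rw [perf, perf, Policy.value, Policy.value, hhist]
  have : Nonempty (Policy K 𝕍) := ⟨π⟩
  simp [regret, hperf]

/-- The constant of the bound for the regret. -/
noncomputable def regretConst (a b q α δ D : ℝ) : ℝ :=
  b * (momConst a 1 + momConst a q) + b * (momConst a 1 + D * pullConst a b q α δ
    + 2 ^ q * (momConst a q + D ^ q * pullConst a b q α δ))

/-- The constant of the bound for the regret under smoothness. -/
noncomputable def smoothRegretConst (a b q α δ D d₁ d₂ M₀ : ℝ) : ℝ :=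
  (upperConst b q δ D d₁ d₂ M₀ + smoothConst b d₁ d₂ M₀ * 2 ^ (q + 2))
      * (momConst a 2 + momConst a (q + 2))
    + lowerConst b q D d₁ d₂ M₀ * pullConst a b q α δ + 1

lemma Setting.exists_isDeviation (hs : Setting B R μ V X π a b q α δ D) {T : ℕ} (hT : 1 ≤ T) :
    ∃ z, IsDeviation B μ X a T z := by
  obtain ⟨k, -⟩ := hs.gaps
  obtain ⟨z, h1, h2, h3, h4⟩ := hs.model.exists_deviation hs.measurable hs.stable k.pos hT
  exact ⟨z, h1, h2, h3, h4⟩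

lemma pullConst_nonneg (ha : 0 < a) (hα : 2 < α) : 0 ≤ pullConst a b q α δ := by
  have := tailSum_nonneg α
  have : 0 < Real.log 2 := Real.log_pos (by norm_num)
  have : 0 < α := by linarith
  unfold pullConst; positivity

lemma rate_nonneg {T : ℕ} (hK : 2 ≤ K) (hT : 1 ≤ T) :
    0 ≤ (K : ℝ) ^ 2 * Real.log (K * T) / T := by
  have : 0 ≤ Real.log (K * T) := Real.log_nonneg
    (one_le_mul_of_one_le_of_one_le (by exact_mod_cast one_le_two.trans hK) (by exact_mod_cast hT))
  positivity

lemma Setting.regret_bound (hs : Setting B R μ V X π a b q α δ D) (hα : 2 < α) (hδ : 0 < δ)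
    (hK : 2 ≤ K) {T : ℕ} (hT : 1 ≤ T) (hKT : (K : ℝ) ^ 2 * Real.log (K * T) ≤ T) :
    |regret S R μ V X π T|
      ≤ regretConst a b q α δ D * Real.sqrt ((K : ℝ) ^ 2 * Real.log (K * T) / T) := by
  obtain ⟨k, H⟩ := hs.exists_landscape hδ
  obtain ⟨z, hz⟩ := hs.exists_isDeviation hT
  have hT0 : (0 : ℝ) < T := by exact_mod_cast hT
  have ha := hs.stable.a_pos
  have hb := hs.stable.b_pos
  have hD := H.D_nonneg
  have hε0 := rate_nonneg (T := T) hK hT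
  have hε1 : (K : ℝ) ^ 2 * Real.log (K * T) / T ≤ 1 := div_le_one_of_le₀ hKT hT0.le
  have hl := hs.model.integral_freq_le hs.measurable H hs.ucb hα hK hT
  have m1 := hz.moment_le ha hK one_pos (p := 1 / 2) (by norm_num) le_rfl hε0 hε1
  have mq := hz.moment_le ha hK H.q_pos (p := 1 / 2) (by norm_num)
    (by linarith [H.stable.one_le_q]) hε0 hε1
  simp only [Real.rpow_one] at m1
  rw [← Real.sqrt_eq_rpow] at m1 mq
  set ε := (K : ℝ) ^ 2 * Real.log (K * T) / T with hε
  -- Since `ε ≤ 1`, the frequency term of order `ε` is absorbed by the dominating order `√ε`.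
  have hεs : ε ≤ Real.sqrt ε := Real.le_sqrt_of_sq_le (by nlinarith)
  have hl' := hl.trans (mul_le_mul_of_nonneg_left hεs (pullConst_nonneg ha hα))
  refine (regret_le (fun π' => hs.model.integral_perf_le hs.measurable H hz hT π')
    (hs.model.integral_perf_ge hs.measurable H hz hT π)).trans ?_
  change ∫ ω, (1 - freq (runPulls V X π T ω) T k) ∂μ ≤ _ at hl'
  set E1 := ∫ ω, K * z ω ∂μ
  set Eq := ∫ ω, (K * z ω) ^ q ∂μ
  set El := ∫ ω, (1 - freq (runPulls V X π T ω) T k) ∂μ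
  have h1 : E1 + Eq ≤ (momConst a 1 + momConst a q) * Real.sqrt ε := by linarith
  have h2 : E1 + D * El + 2 ^ q * (Eq + D ^ q * El) ≤ (momConst a 1 + D * pullConst a b q α δ
      + 2 ^ q * (momConst a q + D ^ q * pullConst a b q α δ)) * Real.sqrt ε := by
    have h3 := mul_le_mul_of_nonneg_left hl' hD
    have h4 := mul_le_mul_of_nonneg_left hl' (Real.rpow_nonneg hD q)
    have h5 := mul_le_mul_of_nonneg_left (add_le_add mq h4) (by positivity : (0 : ℝ) ≤ 2 ^ q)
    linarith
  have h3 := mul_le_mul_of_nonneg_left h1 hb.le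
  have h4 := mul_le_mul_of_nonneg_left h2 hb.le
  rw [regretConst]
  linarith

lemma tendsto_rate (K : ℕ) (hK : 2 ≤ K) :
    Tendsto (fun T : ℕ => (K : ℝ) ^ 2 * Real.log (K * T) / T) atTop (nhds 0) := by
  have hK0 : (0 : ℝ) < K := by positivity
  have h1 : Tendsto (fun T : ℕ => (K : ℝ) * T) atTop atTop :=
    tendsto_natCast_atTop_atTop.const_mul_atTop hK0
  have h2 := (Real.isLittleO_log_id_atTop.tendsto_div_nhds_zero.comp h1).const_mul ((K : ℝ) ^ 3)
  rw [mul_zero] at h2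
  refine h2.congr' ?_
  filter_upwards [eventually_ge_atTop 1] with T hT
  have hT0 : (0 : ℝ) < T := by exact_mod_cast hT
  simp only [Function.comp_apply, id_eq]
  field_simp

lemma Setting.smooth_regret_bound (hs : Setting B R μ V X π a b q α δ D)
    (hsm : Smooth B R d₁ d₂ M₀) (hα : 2 < α) (hδ : 0 < δ) (hK : 2 ≤ K) :
    ∀ᶠ T : ℕ in atTop, |regret S R μ V X π T|
      ≤ smoothRegretConst a b q α δ D d₁ d₂ M₀ * ((K : ℝ) ^ 2 * Real.log (K * T) / T) := by
  obtain ⟨k, H⟩ := hs.exists_landscape hδ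
  obtain ⟨A, A'⟩ := hsm.smoothAt k
  obtain ⟨s, c, hc, hsc⟩ := A'.exists_pool_le H
  have ha := hs.stable.a_pos
  have hD := H.D_nonneg
  have hq := H.q_pos
  have hc₁ := smoothConst_nonneg H A'
  -- The constant `c` depends on the instance but multiplies a term of order `ε ^ 2`. Once `ε * c *
  -- (momConst a 4 + momConst a (q + 4)) ≤ 1`, its contribution is at most `ε`, the final `1` in
  -- `smoothRegretConst`.
  have hlim := (tendsto_rate K hK).mul_const (c * (momConst a 4 + momConst a (q + 4)))
  rw [zero_mul] at hlim
  filter_upwards [eventually_ge_atTop 1, (tendsto_rate K hK).eventually (ge_mem_nhds one_pos),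
    hlim.eventually (ge_mem_nhds one_pos)] with T hT hε1 hsmall
  obtain ⟨z, hz⟩ := hs.exists_isDeviation hT
  have hε0 := rate_nonneg (T := T) hK hT
  have hl := hs.model.integral_freq_le hs.measurable H hs.ucb hα hK hT
  have mQ := hz.integral_quadErr_le ha hq hK hε0 hε1
  have m4 := hz.moment_le ha hK (r := 4) (p := 2) (by norm_num) (by norm_num) (by norm_num) hε0 hε1
  have mq4 := hz.moment_le ha hK (r := q + 4) (p := 2) (by linarith) (by norm_num) (by linarith)
    hε0 hε1
  rw [Real.rpow_two] at m4 mq4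
  set ε := (K : ℝ) ^ 2 * Real.log (K * T) / T with hε
  refine (regret_le (fun π' => hs.model.integral_perf_le_of_smooth hs.measurable H A' hsc hz hT π')
    (hs.model.integral_perf_ge_of_smooth hs.measurable H A' hz hT π)).trans ?_
  change ∫ ω, (1 - freq (runPulls V X π T ω) T k) ∂μ ≤ _ at hl
  set E4 := ∫ ω, (K * z ω) ^ (4 : ℝ) ∂μ
  set Eq4 := ∫ ω, (K * z ω) ^ (q + 4) ∂μ
  set EQ := ∫ ω, quadErr q (K * z ω) ∂μ
  set El := ∫ ω, (1 - freq (runPulls V X π T ω) T k) ∂μ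
  have hc1 : 0 ≤ smoothConst b d₁ d₂ M₀ * 2 ^ (q + 2) := by positivity
  have hcu : 0 ≤ upperConst b q δ D d₁ d₂ M₀ := hc1.trans (le_max_left _ _)
  have hcl : 0 ≤ lowerConst b q D d₁ d₂ M₀ := by
    have := quadErr_nonneg (q := q) hD
    have := A'.d₁_nonneg
    unfold lowerConst; positivity
  have h1 : c * (E4 + Eq4) ≤ ε := by
    calc c * (E4 + Eq4) ≤ c * (momConst a 4 * ε ^ 2 + momConst a (q + 4) * ε ^ 2) :=
          mul_le_mul_of_nonneg_left (add_le_add m4 mq4) hc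
      _ = ε * (c * (momConst a 4 + momConst a (q + 4))) * ε := by ring
      _ ≤ 1 * ε := mul_le_mul_of_nonneg_right hsmall hε0
      _ = ε := one_mul ε
  have h2 := mul_le_mul_of_nonneg_left mQ (add_nonneg hcu hc1)
  have h3 := mul_le_mul_of_nonneg_left hl hcl
  rw [smoothRegretConst]
  linarith

end Regret

end EDPM

/-! ### The main theorem -/

theorem mainTheorem6 (a b q α δ D : ℝ) (hα : 2 < α) (hδ : 0 < δ) :
    (∃ C : ℝ, ∀ (K : ℕ) (L : Type*) [NormedAddCommGroup L] [NormedSpace ℝ L]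
        (S : EDPM.FunSpace L) (B : EDPM.Arms S K) (R : L → ℝ)
        (𝕍 : Type*) [MeasurableSpace 𝕍] (Ω : Type*) [MeasurableSpace Ω] (μ : Measure Ω)
        (V : Ω → 𝕍) (X : Fin K → ℕ → Ω → ℝ) (π : EDPM.Policy K 𝕍),
        EDPM.Setting B R μ V X π a b q α δ D →
        ∀ T : ℕ, 1 ≤ T →
          (∀ π' : EDPM.Policy K 𝕍, Integrable (EDPM.perf S R V X π' T) μ) ∧
          BddAbove (Set.range fun π' : EDPM.Policy K 𝕍 => ∫ ω, EDPM.perf S R V X π' T ω ∂μ) ∧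
          ((K : ℝ) ^ 2 * Real.log (K * T) ≤ T →
            |EDPM.regret S R μ V X π T| ≤ C * Real.sqrt ((K : ℝ) ^ 2 * Real.log (K * T) / T))) ∧
    (∀ d₁ d₂ M₀ : ℝ, ∃ C : ℝ, ∀ (K : ℕ) (L : Type*) [NormedAddCommGroup L] [NormedSpace ℝ L]
        (S : EDPM.FunSpace L) (B : EDPM.Arms S K) (R : L → ℝ)
        (𝕍 : Type*) [MeasurableSpace 𝕍] (Ω : Type*) [MeasurableSpace Ω] (μ : Measure Ω)
        (V : Ω → 𝕍) (X : Fin K → ℕ → Ω → ℝ) (π : EDPM.Policy K 𝕍),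
        EDPM.Setting B R μ V X π a b q α δ D →
        EDPM.Smooth B R d₁ d₂ M₀ →
        ∀ᶠ T : ℕ in atTop,
          |EDPM.regret S R μ V X π T| ≤ C * ((K : ℝ) ^ 2 * Real.log (K * T) / T)) := by
  constructor
  -- The constant is chosen before any sign of the parameters is known; the absolute value makes it
  -- nonnegative, as needed for a single arm.
  · refine ⟨|EDPM.regretConst a b q α δ D|, ?_⟩
    intro K L _ _ S B R 𝕍 _ Ω _ μ V X π hs T hT
    obtain ⟨k, H⟩ := hs.exists_landscape hδ
    obtain ⟨z, hz⟩ := hs.exists_isDeviation hT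
    refine ⟨fun π' => hs.model.integrable_perf hs.measurable H hz hT π',
      hs.model.bddAbove_perf hs.measurable H hz hT, fun hKT => ?_⟩
    -- For a single arm the moment bounds are not available, as `log (K * T)` vanishes at `T = 1`,
    -- but then there is no choice and the regret is zero.
    rcases lt_or_ge K 2 with hK | hK
    · have : Subsingleton (Fin K) := Fin.subsingleton_iff_le_one.2 (by omega)
      rw [EDPM.regret_eq_zero, abs_zero]
      positivity
    · exact (hs.regret_bound hα hδ hK hT hKT).trans
        (mul_le_mul_of_nonneg_right (le_abs_self _) (Real.sqrt_nonneg _))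
  · intro d₁ d₂ M₀
    refine ⟨|EDPM.smoothRegretConst a b q α δ D d₁ d₂ M₀|, ?_⟩
    intro K L _ _ S B R 𝕍 _ Ω _ μ V X π hs hsm
    rcases lt_or_ge K 2 with hK | hK
    · have : Subsingleton (Fin K) := Fin.subsingleton_iff_le_one.2 (by omega)
      obtain ⟨k, -⟩ := hs.gaps
      filter_upwards [eventually_ge_atTop 1] with T hT
      rw [EDPM.regret_eq_zero, abs_zero]
      have h1 : 0 ≤ Real.log (K * T) := Real.log_nonneg
        (one_le_mul_of_one_le_of_one_le (by exact_mod_cast k.pos) (by exact_mod_cast hT))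
      positivity
    · filter_upwards [hs.smooth_regret_bound hsm hα hδ hK, eventually_ge_atTop 1] with T h hT
      exact h.trans (mul_le_mul_of_nonneg_right (le_abs_self _) (EDPM.rate_nonneg hK hT))
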